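/- Let $d\ge 1$, let $\Omega\subset\mathbb{R}^d$ be a bounded Lipschitz domain, $T>0$, $I=(0,T)$, $s\in(0,1)$, $U:=L^2(I\times\Omega)$ (identified with its dual, so that $f'(u)\in U$ denotes the Riesz representative). Let $W$ be one of the following fractional Sobolev spaces, with its inner product $(\cdot,\cdot)_W$ and norm $\|\cdot\|_W$: (a) $H^s(\Omega)=\{w\in L^2(\Omega):\ |w(x)-w(y)|\,|x-y|^{-d/2-s}\in L^2(\Omega\times\Omega)\}$ with $$(u,w)_{H^s(\Omega)}=\int_\Omega uw\,dx+\frac{c_{d,s}}{2}\int_\Omega\int_\Omega\frac{(u(x)-u(y))(w(x)-w(y))}{|x-y|^{d+2s}}\,dy\,dx,\qquad c_{d,s}=\frac{s2^{2s}\Gamma(s+\frac d2)}{\pi^{d/2}\Gamma(1-s)};$$ (b) $H^s_0(\Omega)$, the closure of $C_c^\infty(\Omega)$ in $H^s(\Omega)$, with the same inner product; (c) $\tilde H^s(\Omega)$, the functions in $H^s(\mathbb{R}^d)$ that vanish on $\mathbb{R}^d\setminus\Omega$, with the $H^s(\mathbb{R}^d)$ inner product; (d) the spectral space $\mathbb{H}^s(\Omega)=\{w=\sum_n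 w_n\phi_n\in L^2(\Omega):\ \sum_n\lambda_n^s w_n^2<\infty\}$ with $(u,w)_{\mathbb{H}^s(\Omega)}=\sum_n\lambda_n^s u_nw_n$, where $w_n=\int_\Omega w\phi_n\,dx$ and $\phi_n$ are the $L^2(\Omega)$-orthonormal eigenfunctions of the Laplacian with zero Dirichlet boundary conditions to the eigenvalues $\lambda_n$. Let $\alpha,\beta,\gamma>0$, $p\in(0,1)$, and let $f:U\to\mathbb{R}$ be weakly lower semicontinuous, bounded from below by a continuous affine function, and continuously Fréchet differentiable. Assume that $f'$ is completely continuous ($u_k\rightharpoonup u$ in $U$ implies $f'(u_k)\to f'(u)$ in $U$) and Lipschitz continuous on bounded sets. Put $$K=\{(u,w)\in U\times W:\ |u(t,x)|\le w(x)\ \text{for a.a. }(t,x)\in I\times\Omega\},$$ and for $\epsilon>0$ let $\psi_\epsilon(t)=\frac p2\frac{t}{\epsilon^{2-p}}+(1-\frac p2)\epsilon^p$ for $t\in[0,\epsilon^2)$ and $\psi_\epsilon(t)=t^{p/2}$ for $t\ge\epsilon^2$. Iterative scheme. Let $b>1$, $L>0$, let $(\epsilon_k)$ be a monotonically decreasing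 sequence of positive numbers with $\epsilon_k\to0$, and let $(u_0,w_0)\in U\times W$. For $k=0,1,2,\dots$ let $L_k$ be the smallest number in $\{Lb^l:\ l=0,1,2,\dots\}$ such that the solution $(u_{k+1},w_{k+1})$ of $$\min_{(u,w)\in K}\ f'(u_k)(u-u_k)+\frac\alpha2\|u\|_U^2+\frac\beta2\|w\|_W^2+\gamma\int_\Omega\psi_{\epsilon_k}'(w_k^2)(w^2-w_k^2)\,dx+\frac{L_k}2\|u-u_k\|_U^2$$ satisfies $f(u_{k+1})\le f(u_k)+f'(u_k)(u_{k+1}-u_k)+L_k\|u_{k+1}-u_k\|_U^2$. Theorem. Let $(\bar u,\bar w)\in U\times W$ be a weak limit point of the scheme, i.e. the weak limit in $U\times W$ of a subsequence of a sequence $(u_k,w_k)$ generated by it. Let $r\in(1,\infty)$ and $q\in(2,\infty)$ be such that $\frac1r+\frac2q<1$ and $W$ is continuously embedded in $L^q(\Omega)$, and suppose that the map $x\mapsto\|f'(\bar u)(\cdot,x)\|_{L^1(I)}$ is in $L^r(\Omega)$. Then $\bar w\in L^\infty(\Omega)$ and $\bar u\in L^\infty(I\times\Omega)$. -/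

import Mathlib

open MeasureTheory Filter Set Topology
open scoped ENNReal NNReal

noncomputable section

namespace SparseControl

/-- The space `ℝ^d` with its Euclidean norm. -/
abbrev E (d : ℕ) := EuclideanSpace ℝ (Fin d)

/-- A bounded Lipschitz domain: bounded, open, connected, nonempty, and near each boundary point
`Ω` is, in suitable orthogonal coordinates with vertical direction `e`, the set of points lying
strictly above the graph of a Lipschitz function `γ` of the coordinates orthogonal to `e`. -/
structure IsBoundedLipschitzDomain {d : ℕ} (Ω : Set (E d)) : Prop where
  isOpen : IsOpen Ω
  isConnected : IsConnected Ω
  isBounded : Bornology.IsBounded Ω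
  lipschitz_boundary : ∀ x ∈ frontier Ω, ∃ (e : E d) (γ : E d → ℝ) (M : ℝ≥0) (ρ : ℝ),
    ‖e‖ = 1 ∧ LipschitzWith M γ ∧ 0 < ρ ∧
      ∀ y ∈ Metric.ball x ρ, (y ∈ Ω ↔ γ (y - inner ℝ e y • e) < inner ℝ e y)

/-- Lebesgue measure on `Ω`. -/
abbrev space {d : ℕ} (Ω : Set (E d)) : Measure (E d) := volume.restrict Ω

/-- Lebesgue measure on the cylinder `I × Ω`, `I = (0, T)`. -/
abbrev cyl {d : ℕ} (T : ℝ) (Ω : Set (E d)) : Measure (ℝ × E d) :=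
  (volume.restrict (Ioo 0 T)).prod (volume.restrict Ω)

/-- `L²(Ω)`. -/
abbrev L2 {d : ℕ} (Ω : Set (E d)) := Lp ℝ 2 (space Ω)

/-- `U = L²(I × Ω)`. -/
abbrev U {d : ℕ} (T : ℝ) (Ω : Set (E d)) := Lp ℝ 2 (cyl T Ω)

/-- `C_c^∞(Ω)`. -/
structure IsTestFunction {d : ℕ} (Ω : Set (E d)) (φ : E d → ℝ) : Prop where
  smooth : ContDiff ℝ ((⊤ : ℕ∞) : WithTop ℕ∞) φ
  hasCompactSupport : HasCompactSupport φ
  tsupport_subset : tsupport φ ⊆ Ω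

/-! ### Fractional Sobolev spaces -/

/-- The constant `c_{d,s}`. -/
def fracConst (d : ℕ) (s : ℝ) : ℝ :=
  s * 2 ^ (2 * s) * Real.Gamma (s + d / 2) / (Real.pi ^ ((d : ℝ) / 2) * Real.Gamma (1 - s))

/-- `w ∈ H^s(D)`, for a set `D ⊆ ℝ^d`. -/
def MemHs {d : ℕ} (D : Set (E d)) (s : ℝ) (w : E d → ℝ) : Prop :=
  MemLp w 2 (space D) ∧
    MemLp (fun z : E d × E d => |w z.1 - w z.2| / ‖z.1 - z.2‖ ^ ((d : ℝ) / 2 + s)) 2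
      ((space D).prod (space D))

/-- The inner product `(u, w)_{H^s(D)}`. -/
def hsInner {d : ℕ} (D : Set (E d)) (s : ℝ) (u w : E d → ℝ) : ℝ :=
  (∫ x, u x * w x ∂(space D)) +
    fracConst d s / 2 *
      ∫ z : E d × E d, (u z.1 - u z.2) * (w z.1 - w z.2) / ‖z.1 - z.2‖ ^ ((d : ℝ) + 2 * s)
        ∂((space D).prod (space D))

/-- `φ` is (zero or) an eigenfunction of the Laplacian on `Ω` with zero Dirichlet boundary
conditions, to the eigenvalue `μ`: `φ` belongs to `H_0^1(Ω)` with weak gradient `G` (that is,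
`(φ, G)` is an `L²`-limit of pairs `(ψ, ∇ψ)` with `ψ ∈ C_c^∞(Ω)`), and `-Δφ = μ φ` weakly. -/
def IsDirichletEigenfunction {d : ℕ} (Ω : Set (E d)) (μ : ℝ) (φ : L2 Ω) : Prop :=
  ∃ G : E d → E d, MemLp G 2 (space Ω) ∧
    (∀ δ > 0, ∃ ψ : E d → ℝ, IsTestFunction Ω ψ ∧
      ∫ x, (φ x - ψ x) ^ 2 ∂(space Ω) < δ ∧ ∫ x, ‖G x - gradient ψ x‖ ^ 2 ∂(space Ω) < δ) ∧
    ∀ v : E d → ℝ, IsTestFunction Ω v →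
      ∫ x, inner ℝ (G x) (gradient v x) ∂(space Ω) = μ * ∫ x, φ x * v x ∂(space Ω)

/-- The eigenspace of the Dirichlet Laplacian to the eigenvalue `μ`
(zero if `μ` is not an eigenvalue). -/
def dirichletEigenspace {d : ℕ} (Ω : Set (E d)) (μ : ℝ) : Submodule ℝ (L2 Ω) :=
  Submodule.span ℝ {φ | IsDirichletEigenfunction Ω μ φ}

/-- The `L²(Ω)`-orthogonal projection onto the eigenspace to `μ`. For an orthonormal basis `φ_n`
of eigenfunctions with eigenvalues `λ_n`, it maps `w` to the sum of `(∫ w φ_n) φ_n` over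
all `n` with `λ_n = μ`. -/
def eigenProj {d : ℕ} (Ω : Set (E d)) (μ : ℝ) : L2 Ω →L[ℝ] L2 Ω :=
  (dirichletEigenspace Ω μ).topologicalClosure.starProjection

/-- `w` belongs to the spectral space: `w = ∑ w_n φ_n` in `L²(Ω)` and `∑ λ_n^s w_n² < ∞`
(terms with equal eigenvalue are collected). -/
def MemSpectral {d : ℕ} (Ω : Set (E d)) (s : ℝ) (w : L2 Ω) : Prop :=
  HasSum (fun μ : ℝ => eigenProj Ω μ w) w ∧
    Summable (fun μ : ℝ => μ ^ s * ‖eigenProj Ω μ w‖ ^ 2)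

/-- The inner product `∑ λ_n^s u_n w_n` of the spectral space. -/
def spectralInner {d : ℕ} (Ω : Set (E d)) (s : ℝ) (u w : L2 Ω) : ℝ :=
  ∑' μ : ℝ, μ ^ s * inner ℝ (eigenProj Ω μ u) (eigenProj Ω μ w)

/-- The four kinds of fractional Sobolev spaces that `W` may stand for. -/
inductive Kind
  /-- `H^s(Ω)` -/
  | sobolev
  /-- `H_0^s(Ω)`, the closure of `C_c^∞(Ω)` in `H^s(Ω)` -/
  | sobolevZero
  /-- the functions in `H^s(ℝ^d)` that vanish outside `Ω` -/
  | tilde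
  /-- the spectral space -/
  | spectral

/-- The space `W`, as a set of elements of `L²(Ω)`. -/
def W {d : ℕ} (kind : Kind) (Ω : Set (E d)) (s : ℝ) : Set (L2 Ω) :=
  match kind with
  | .sobolev => {w | MemHs Ω s w}
  | .sobolevZero => {w | MemHs Ω s w ∧ ∀ δ > 0, ∃ φ : E d → ℝ, IsTestFunction Ω φ ∧
      hsInner Ω s (fun x => w x - φ x) (fun x => w x - φ x) < δ}
  | .tilde => {w | MemHs univ s (Ω.indicator w)}
  | .spectral => {w | MemSpectral Ω s w}

/-- The inner product `(u, w)_W`. -/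
def innerW {d : ℕ} (kind : Kind) (Ω : Set (E d)) (s : ℝ) (u w : L2 Ω) : ℝ :=
  match kind with
  | .sobolev => hsInner Ω s u w
  | .sobolevZero => hsInner Ω s u w
  | .tilde => hsInner univ s (Ω.indicator u) (Ω.indicator w)
  | .spectral => spectralInner Ω s u w

/-- `‖w‖_W`. -/
def normW {d : ℕ} (kind : Kind) (Ω : Set (E d)) (s : ℝ) (w : L2 Ω) : ℝ :=
  √(innerW kind Ω s w w)

/-- The continuous embedding `W ↪ L^q(Ω)`. -/
def EmbedsInLq {d : ℕ} (kind : Kind) (Ω : Set (E d)) (s q : ℝ) : Prop :=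
  ∃ C : ℝ, ∀ w ∈ W kind Ω s,
    eLpNorm w (ENNReal.ofReal q) (space Ω) ≤ ENNReal.ofReal (C * normW kind Ω s w)

/-- Weak convergence `w_n ⇀ w̄` in the Hilbert space `W`. -/
def WeakConvW {d : ℕ} (kind : Kind) (Ω : Set (E d)) (s : ℝ) (w : ℕ → L2 Ω) (wbar : L2 Ω) : Prop :=
  (∀ n, w n ∈ W kind Ω s) ∧ wbar ∈ W kind Ω s ∧
    ∀ z ∈ W kind Ω s,
      Tendsto (fun n => innerW kind Ω s (w n) z) atTop (𝓝 (innerW kind Ω s wbar z))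

/-- Weak convergence of a sequence in a real Hilbert space. -/
def WeakConv {H : Type*} [NormedAddCommGroup H] [InnerProductSpace ℝ H]
    (u : ℕ → H) (ubar : H) : Prop :=
  ∀ v : H, Tendsto (fun n => inner ℝ (u n) v) atTop (𝓝 (inner ℝ ubar v))

/-! ### The optimization problem and the iterative scheme -/

/-- The standing assumptions on `f` on the Hilbert space `U`; `gradient f u` is the Riesz
representative of `f'(u)`. -/
structure ObjectiveAssumptions {H : Type*} [NormedAddCommGroup H] [InnerProductSpace ℝ H]
    [CompleteSpace H] (f : H → ℝ) : Prop where
  weakly_lsc : ∀ (u : ℕ → H) (ubar : H), WeakConv u ubar →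
    ∀ a < f ubar, ∀ᶠ n in atTop, a < f (u n)
  affine_lower_bound : ∃ (g : H →L[ℝ] ℝ) (c : ℝ), ∀ u, g u + c ≤ f u
  differentiable : Differentiable ℝ f
  continuous_fderiv : Continuous (fderiv ℝ f)
  completely_continuous : ∀ (u : ℕ → H) (ubar : H), WeakConv u ubar →
    Tendsto (fun n => gradient f (u n)) atTop (𝓝 (gradient f ubar))
  lipschitz_on_bounded : ∀ R : ℝ, ∃ M : ℝ≥0,
    LipschitzOnWith M (gradient f) (Metric.closedBall 0 R)

/-- The set `K` of admissible pairs: `|u(t,x)| ≤ w(x)` for a.a. `(t,x)`. -/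
def K {d : ℕ} (kind : Kind) (T : ℝ) (Ω : Set (E d)) (s : ℝ) : Set (U T Ω × L2 Ω) :=
  {a | a.2 ∈ W kind Ω s ∧ ∀ᵐ z ∂(cyl T Ω), |a.1 z| ≤ a.2 z.2}

/-- The smoothing `ψ_ε` of `t ↦ t^{p/2}` (continued linearly to `t < 0`). -/
def psi (p ε t : ℝ) : ℝ :=
  if t < ε ^ 2 then p / 2 * (t / ε ^ (2 - p)) + (1 - p / 2) * ε ^ p else t ^ (p / 2)

/-- The cost functional `φ_k(u, w)` of the subproblem at the current iterate `(u_k, w_k)`, with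
smoothing parameter `ε = ε_k` and step parameter `ℓ = L_k`. -/
def subCost {d : ℕ} (kind : Kind) (T : ℝ) (Ω : Set (E d)) (s p α β γ : ℝ) (f : U T Ω → ℝ)
    (ε ℓ : ℝ) (uk : U T Ω) (wk : L2 Ω) (a : U T Ω × L2 Ω) : ℝ :=
  fderiv ℝ f uk (a.1 - uk) + α / 2 * ‖a.1‖ ^ 2 + β / 2 * normW kind Ω s a.2 ^ 2
    + γ * (∫ x, deriv (psi p ε) ((wk x) ^ 2) * ((a.2 x) ^ 2 - (wk x) ^ 2) ∂(space Ω))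
    + ℓ / 2 * ‖a.1 - uk‖ ^ 2

/-- `a = (u, w)` solves the subproblem: it minimizes `φ_k` over `K`. -/
def SolvesSub {d : ℕ} (kind : Kind) (T : ℝ) (Ω : Set (E d)) (s p α β γ : ℝ) (f : U T Ω → ℝ)
    (ε ℓ : ℝ) (uk : U T Ω) (wk : L2 Ω) (a : U T Ω × L2 Ω) : Prop :=
  a ∈ K kind T Ω s ∧ IsMinOn (subCost kind T Ω s p α β γ f ε ℓ uk wk) (K kind T Ω s) a

/-- The descent condition
`f(u_{k+1}) ≤ f(u_k) + f'(u_k)(u_{k+1} - u_k) + L_k ‖u_{k+1} - u_k‖²`. -/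
def DescentCond {H : Type*} [NormedAddCommGroup H] [InnerProductSpace ℝ H]
    (f : H → ℝ) (ℓ : ℝ) (uk v : H) : Prop :=
  f v ≤ f uk + fderiv ℝ f uk (v - uk) + ℓ * ‖v - uk‖ ^ 2

/-- `(u_k, w_k, L_k)` is generated by the iterative scheme with parameters `b`, `L`, `(ε_k)` and
some starting point `(u_0, w_0) ∈ U × W`: `L_k` is the smallest number among `L b^l`, `l ≥ 0`,
for which the solution `(u_{k+1}, w_{k+1})` of the subproblem satisfies the descent condition. -/
structure IsGenerated {d : ℕ} (kind : Kind) (T : ℝ) (Ω : Set (E d)) (s p α β γ : ℝ)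
    (f : U T Ω → ℝ) (b L : ℝ) (ε : ℕ → ℝ)
    (u : ℕ → U T Ω) (w : ℕ → L2 Ω) (Lk : ℕ → ℝ) : Prop where
  one_lt_b : 1 < b
  L_pos : 0 < L
  eps_pos : ∀ k, 0 < ε k
  eps_antitone : Antitone ε
  eps_tendsto : Tendsto ε atTop (𝓝 0)
  start_mem : w 0 ∈ W kind Ω s
  step : ∀ k, ∃ l : ℕ, Lk k = L * b ^ l ∧
    SolvesSub kind T Ω s p α β γ f (ε k) (Lk k) (u k) (w k) (u (k + 1), w (k + 1)) ∧
    DescentCond f (Lk k) (u k) (u (k + 1)) ∧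
    ∀ l' < l, ∀ a : U T Ω × L2 Ω,
      SolvesSub kind T Ω s p α β γ f (ε k) (L * b ^ l') (u k) (w k) a →
        ¬ DescentCond f (L * b ^ l') (u k) a.1

/-- `(ū, w̄)` is a weak limit point of `(u_k, w_k)` in `U × W`: the weak limit of a subsequence. -/
def IsWeakLimitPoint {d : ℕ} (kind : Kind) (T : ℝ) (Ω : Set (E d)) (s : ℝ)
    (u : ℕ → U T Ω) (w : ℕ → L2 Ω) (ubar : U T Ω) (wbar : L2 Ω) : Prop :=
  ∃ φ : ℕ → ℕ, StrictMono φ ∧ WeakConv (fun n => u (φ n)) ubar ∧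
    WeakConvW kind Ω s (fun n => w (φ n)) wbar

end SparseControl

end

/-! Each iterate is tested against its own truncation. The optimality condition of the subproblem
that produced an iterate `(u, w)` is a variational inequality over `K`. As competitor take `min w M`
together with `u` clipped to `[-M, M]`, for a level `M ≥ 0`. This pair stays in `K` and its second
component lies below `w`. Hence the linearised sparsity term, whose weights are not controlled as
the smoothing parameter tends to zero, has a favourable sign and drops out. With `ζ = (w - M)⁺`
there remains, up to an error, `β ‖ζ‖_W² ≤ ∫ ‖f'(ū)(·, x)‖_{L¹(I)} ζ(x) dx`. The error vanishes
along the subsequence: the smoothed energy decreases, so successive controls approach each other;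
the step parameters stay bounded; and `f'` is completely continuous
(`IsGenerated.exists_limit_inequality`).

Hölder's inequality and the embedding into `L^q` turn this into a Stampacchia recursion for the
measure of `{w > M}`, with exponent `1 - 1/r - 1/q > 1/q`. Truncation is not weakly continuous, so
the recursion is kept at the level of the iterates and carries a vanishing error.
`stampacchia_vanishing_error` then yields one level `P` with the measure of `{w_n > P}` tending to
zero, and this is enough for the weak limits to be bounded by `P` (`ae_le_of_weakConv`).

Besides the embedding, only two properties of `W` enter: its squared norm is a lower semicontinuous
form on `L²` (`ClosedForm`), and `v = min w M` lies in `W` with `(v, w - v)_W ≥ 0`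
(`TruncatesForm`). For `H^s(Ω)` and `H̃^s(Ω)` these follow from Fatou's lemma and pointwise
monotonicity; for `H^s_0(Ω)`, smooth truncations of test functions give the membership. For the
spectral space, `μ^s` is a superposition of the functions `μ / (t + μ)`, and the inequality for each
`t` says that `t (t - Δ)⁻¹` preserves upper bounds `M ≥ 0`. The resolvent is built variationally,
and its compactness (a Rellich argument with grid averages) gives the eigenfunction expansion. -/

open MeasureTheory Filter Set Topology
open scoped ENNReal NNReal

noncomputable section

namespace SparseControl

section

/-! ### Closed quadratic forms on a Hilbert space -/

/-- `B` is a nonnegative symmetric bilinear form on the subspace `V` whose quadratic form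
(extended by `+∞` off `V`) is lower semicontinuous on `H`. -/
structure ClosedForm {H : Type*} [NormedAddCommGroup H] [InnerProductSpace ℝ H]
    (V : Set H) (B : H → H → ℝ) : Prop where
  zero_mem : (0 : H) ∈ V
  add_mem : ∀ u ∈ V, ∀ v ∈ V, u + v ∈ V
  smul_mem : ∀ (c : ℝ), ∀ u ∈ V, c • u ∈ V
  symm : ∀ u ∈ V, ∀ v ∈ V, B u v = B v u
  add_left : ∀ u ∈ V, ∀ v ∈ V, ∀ z ∈ V, B (u + v) z = B u z + B v z
  smul_left : ∀ (c : ℝ), ∀ u ∈ V, ∀ z ∈ V, B (c • u) z = c * B u z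
  nonneg : ∀ u ∈ V, 0 ≤ B u u
  lsc : ∀ (w : ℕ → H) (wbar : H) (c : ℝ), (∀ n, w n ∈ V) → (∀ n, B (w n) (w n) ≤ c) →
    Tendsto w atTop (𝓝 wbar) → wbar ∈ V ∧ B wbar wbar ≤ c

/-- A strongly midpoint-convex, lower semicontinuous function which is bounded below attains its
minimum. -/
theorem exists_isMinOn_of_strongly_convex {X : Type*} [NormedAddCommGroup X] [CompleteSpace X]
    {C : Set X} (hne : C.Nonempty) {J : X → ℝ} {m c : ℝ} (hc : 0 < c)
    (hbdd : ∀ x ∈ C, m ≤ J x)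
    (hmid : ∀ a ∈ C, ∀ b ∈ C, ∃ y ∈ C, J y + c * ‖a - b‖ ^ 2 ≤ (J a + J b) / 2)
    (hlsc : ∀ (x : ℕ → X) (x₀ : X) (M : ℝ), (∀ n, x n ∈ C) → Tendsto x atTop (𝓝 x₀) →
      Tendsto (fun n => J (x n)) atTop (𝓝 M) → x₀ ∈ C ∧ J x₀ ≤ M) :
    ∃ x ∈ C, IsMinOn J C x := by
  have hbd : BddBelow (J '' C) := ⟨m, by rintro _ ⟨x, hx, rfl⟩; exact hbdd x hx⟩
  have hle : ∀ x ∈ C, sInf (J '' C) ≤ J x := fun x hx => csInf_le hbd ⟨x, hx, rfl⟩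
  have hex : ∀ n : ℕ, ∃ x ∈ C, J x < sInf (J '' C) + 1 / ((n : ℝ) + 1) := by
    intro n
    obtain ⟨_, ⟨x, hx, rfl⟩, h⟩ := exists_lt_of_csInf_lt (hne.image J)
      (show sInf (J '' C) < sInf (J '' C) + 1 / ((n : ℝ) + 1) by
        have : (0 : ℝ) < 1 / ((n : ℝ) + 1) := by positivity
        linarith)
    exact ⟨x, hx, h⟩
  choose x hxC hx using hex
  -- Two almost minimal values and a midpoint value not below the infimum leave no room for a large
  -- distance, so the minimizing sequence is Cauchy.
  have hdist : ∀ n k, c * ‖x n - x k‖ ^ 2 ≤ (1 / ((n : ℝ) + 1) + 1 / ((k : ℝ) + 1)) / 2 := by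
    intro n k
    obtain ⟨y, hy, h⟩ := hmid _ (hxC n) _ (hxC k)
    linarith [hle y hy, hx n, hx k]
  have hcau : CauchySeq x := by
    rw [Metric.cauchySeq_iff']
    intro δ hδ
    obtain ⟨N, hN⟩ := exists_nat_one_div_lt (show 0 < c * δ ^ 2 by positivity)
    refine ⟨N, fun n hn => ?_⟩
    have h1 : 1 / ((n : ℝ) + 1) ≤ 1 / ((N : ℝ) + 1) := by gcongr
    have h2 := hdist n N
    have h3 : c * ‖x n - x N‖ ^ 2 < c * δ ^ 2 := by linarith
    rw [dist_eq_norm]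
    exact lt_of_pow_lt_pow_left₀ 2 hδ.le (lt_of_mul_lt_mul_left h3 hc.le)
  obtain ⟨x₀, hx₀⟩ := cauchySeq_tendsto_of_complete hcau
  have hJ : Tendsto (fun n => J (x n)) atTop (𝓝 (sInf (J '' C))) := by
    refine tendsto_of_tendsto_of_tendsto_of_le_of_le tendsto_const_nhds ?_
      (fun n => hle _ (hxC n)) (fun n => (hx n).le)
    simpa using tendsto_const_nhds.add (tendsto_one_div_add_atTop_nhds_zero_nat (𝕜 := ℝ))
  obtain ⟨h1, h2⟩ := hlsc x x₀ _ hxC hx₀ hJ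
  exact ⟨x₀, h1, fun y hy => h2.trans (hle y hy)⟩

namespace ClosedForm

variable {H : Type*} [NormedAddCommGroup H] [InnerProductSpace ℝ H] {V : Set H} {B : H → H → ℝ}

theorem neg_mem (h : ClosedForm V B) {u : H} (hu : u ∈ V) : -u ∈ V := by
  simpa using h.smul_mem (-1) u hu

theorem sub_mem (h : ClosedForm V B) {u v : H} (hu : u ∈ V) (hv : v ∈ V) : u - v ∈ V := by
  rw [sub_eq_add_neg]; exact h.add_mem _ hu _ (h.neg_mem hv)

theorem add_right (h : ClosedForm V B) {u v z : H} (hu : u ∈ V) (hv : v ∈ V) (hz : z ∈ V) :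
    B z (u + v) = B z u + B z v := by
  rw [h.symm _ hz _ (h.add_mem _ hu _ hv), h.add_left _ hu _ hv _ hz, h.symm _ hu _ hz,
    h.symm _ hv _ hz]

theorem smul_right (h : ClosedForm V B) (c : ℝ) {u z : H} (hu : u ∈ V) (hz : z ∈ V) :
    B z (c • u) = c * B z u := by
  rw [h.symm _ hz _ (h.smul_mem _ _ hu), h.smul_left _ _ hu _ hz, h.symm _ hu _ hz]

theorem add_smul_self (h : ClosedForm V B) (t : ℝ) {u v : H} (hu : u ∈ V) (hv : v ∈ V) :
    B (u + t • v) (u + t • v) = B u u + 2 * t * B u v + t ^ 2 * B v v := by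
  have htv := h.smul_mem t _ hv
  rw [h.add_left _ hu _ htv _ (h.add_mem _ hu _ htv), h.add_right hu htv hu,
    h.add_right hu htv htv, h.smul_right t hv hu, h.smul_left t _ hv _ hu,
    h.smul_left t _ hv _ htv, h.smul_right t hv hv, h.symm _ hv _ hu]
  ring

theorem sub_self (h : ClosedForm V B) {u v : H} (hu : u ∈ V) (hv : v ∈ V) :
    B (u - v) (u - v) = B u u - 2 * B u v + B v v := by
  have : u - v = u + (-1 : ℝ) • v := by module
  rw [this, h.add_smul_self _ hu hv]; ring

/-- The parallelogram law of the form, which is the source of all strong convexity below. -/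
theorem midpoint_self (h : ClosedForm V B) {u v : H} (hu : u ∈ V) (hv : v ∈ V) :
    B ((1 / 2 : ℝ) • (u + v)) ((1 / 2 : ℝ) • (u + v))
      = (B u u + B v v) / 2 - B (u - v) (u - v) / 4 := by
  have huv := h.add_mem _ hu _ hv
  rw [h.smul_left _ _ huv _ (h.smul_mem _ _ huv), h.smul_right _ huv huv, h.sub_self hu hv]
  have := h.add_smul_self 1 hu hv
  rw [one_smul] at this
  rw [this]; ring

theorem sub_self_le (h : ClosedForm V B) {u v : H} (hu : u ∈ V) (hv : v ∈ V) :
    B (u - v) (u - v) ≤ 2 * B u u + 2 * B v v := by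
  have h1 := h.nonneg _ (h.smul_mem (1 / 2) _ (h.add_mem _ hu _ hv))
  rw [h.midpoint_self hu hv] at h1
  linarith

/-- Subspaces that are closed with respect to the form inherit lower semicontinuity
(Mazur's argument). -/
theorem of_subspace (h : ClosedForm V B) {V₀ : Set H} (hsub : V₀ ⊆ V) (hzero : (0 : H) ∈ V₀)
    (hadd : ∀ u ∈ V₀, ∀ v ∈ V₀, u + v ∈ V₀) (hsmul : ∀ (c : ℝ), ∀ u ∈ V₀, c • u ∈ V₀)
    (hcl : ∀ w ∈ V, (∀ δ > 0, ∃ v ∈ V₀, B (w - v) (w - v) < δ) → w ∈ V₀) :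
    ClosedForm V₀ B where
  zero_mem := hzero
  add_mem := hadd
  smul_mem := hsmul
  symm u hu v hv := h.symm u (hsub hu) v (hsub hv)
  add_left u hu v hv z hz := h.add_left u (hsub hu) v (hsub hv) z (hsub hz)
  smul_left c u hu z hz := h.smul_left c u (hsub hu) z (hsub hz)
  nonneg u hu := h.nonneg u (hsub hu)
  lsc := by
    intro w wbar c hw hc hlim
    obtain ⟨hwV, hwc⟩ := h.lsc w wbar c (fun n => hsub (hw n)) hc hlim
    refine ⟨hcl _ hwV fun δ hδ => ?_, hwc⟩
    have hconv : Convex ℝ V₀ := fun x hx y hy a b _ _ _ =>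
      hadd _ (hsmul _ _ hx) _ (hsmul _ _ hy)
    -- Convex combinations of tails still converge to `wbar` in `H`. Choosing them almost minimal
    -- for `B` makes them converge in the form as well.
    set C : ℕ → Set H := fun N => convexHull ℝ (w '' Ici N) with hC
    have hCV : ∀ N, C N ⊆ V₀ := fun N => convexHull_min (by rintro _ ⟨n, -, rfl⟩; exact hw n) hconv
    have hwC : ∀ N, w N ∈ C N := fun N => subset_convexHull _ _ ⟨N, le_refl N, rfl⟩
    have hmono : ∀ N m, N ≤ m → C m ⊆ C N := fun N m hNm =>
      convexHull_mono (image_mono (Ici_subset_Ici.2 hNm))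
    set D : ℕ → Set ℝ := fun N => (fun v => B v v) '' C N with hD
    have hDb : ∀ N, BddBelow (D N) := fun N =>
      ⟨0, by rintro _ ⟨v, hv, rfl⟩; exact h.nonneg _ (hsub (hCV N hv))⟩
    have hDne : ∀ N, (D N).Nonempty := fun N => ⟨_, w N, hwC N, rfl⟩
    set d : ℕ → ℝ := fun N => sInf (D N) with hd
    have hdmono : Monotone d := fun N m hNm =>
      csInf_le_csInf (hDb N) (hDne m) (image_mono (hmono N m hNm))
    have hdle : ∀ N, ∀ v ∈ C N, d N ≤ B v v := fun N v hv => csInf_le (hDb N) ⟨v, hv, rfl⟩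
    have hdb : BddAbove (range d) :=
      ⟨c, by rintro _ ⟨N, rfl⟩; exact (hdle N _ (hwC N)).trans (hc N)⟩
    have hex : ∀ n : ℕ, ∃ v ∈ C n, B v v < d n + 1 / ((n : ℝ) + 1) := by
      intro n
      obtain ⟨_, ⟨x, hx, rfl⟩, h⟩ := exists_lt_of_csInf_lt (hDne n)
        (show d n < d n + 1 / ((n : ℝ) + 1) by
          have : (0 : ℝ) < 1 / ((n : ℝ) + 1) := by positivity
          linarith)
      exact ⟨x, hx, h⟩
    choose v hvC hv using hex
    have hvlim : Tendsto v atTop (𝓝 wbar) := by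
      rw [Metric.tendsto_atTop] at hlim ⊢
      intro η hη
      obtain ⟨N, hN⟩ := hlim η hη
      refine ⟨N, fun n hn => ?_⟩
      have : C n ⊆ Metric.ball wbar η :=
        convexHull_min (by rintro _ ⟨k, hk, rfl⟩; exact hN k (le_trans hn hk)) (convex_ball _ _)
      exact this (hvC n)
    -- The parallelogram law below gives `2 * e` from the gap of the infima and `4 * e` from the
    -- near-minimality of the two points, so a seventh makes the final bound strict.
    set e := δ / 7 with he
    have he0 : 0 < e := by positivity
    obtain ⟨N₁, hN₁⟩ := exists_lt_of_lt_ciSup (show iSup d - e < iSup d by linarith)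
    obtain ⟨N₂, hN₂⟩ := exists_nat_one_div_lt he0
    set N := max N₁ N₂
    have hdN : iSup d - e < d N := hN₁.trans_le (hdmono (le_max_left _ _))
    have hsmall : ∀ n, N ≤ n → 1 / ((n : ℝ) + 1) < e := fun n hn =>
      lt_of_le_of_lt (by
        have : (N₂ : ℝ) ≤ n := by exact_mod_cast (le_max_right N₁ N₂).trans hn
        gcongr) hN₂
    have key : ∀ k, B (v N - v (N + k)) (v N - v (N + k)) ≤ 6 * e := by
      intro k
      have hN0 := hCV N (hvC N)
      have hk0 := hCV _ (hvC (N + k))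
      have hm := h.midpoint_self (hsub hN0) (hsub hk0)
      have hmem : (1 / 2 : ℝ) • (v N + v (N + k)) ∈ C N := by
        rw [smul_add]
        exact (convex_convexHull ℝ _) (hvC N) (hmono N _ (Nat.le_add_right _ _) (hvC (N + k)))
          (by norm_num) (by norm_num) (by norm_num)
      have h1 := hdle N _ hmem
      have h2 := hv N
      have h3 := hv (N + k)
      have h4 := hsmall N le_rfl
      have h5 := hsmall (N + k) (Nat.le_add_right _ _)
      have h6 : d (N + k) ≤ iSup d := le_ciSup hdb _
      rw [hm] at h1
      push_cast at *
      linarith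
    -- With `N` fixed and `k → ∞`, lower semicontinuity turns the Cauchy estimate into a bound on
    -- the form distance from `v N` to `wbar`.
    have hlim2 : Tendsto (fun k => v N - v (N + k)) atTop (𝓝 (v N - wbar)) := by
      have h1 : Tendsto (fun k => N + k) atTop atTop := by
        simpa [add_comm] using tendsto_add_atTop_nat N
      exact tendsto_const_nhds.sub (hvlim.comp h1)
    have hfin := h.lsc _ _ _
      (fun k => h.sub_mem (hsub (hCV _ (hvC N))) (hsub (hCV _ (hvC (N + k))))) key hlim2
    refine ⟨v N, hCV _ (hvC N), ?_⟩
    have hvN := hsub (hCV _ (hvC N))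
    have e1 := h.sub_self hwV hvN
    have e2 := h.sub_self hvN hwV
    rw [h.symm _ hvN _ hwV] at e2
    have := hfin.2
    linarith

/-- Riesz representation in the Hilbert space `(V, B)` of functionals that are continuous on
`H`. -/
theorem exists_riesz [CompleteSpace H] (h : ClosedForm V B) {c : ℝ} (hc : 0 < c)
    (hcoer : ∀ v ∈ V, c * ‖v‖ ^ 2 ≤ B v v) (g : H) :
    ∃ z ∈ V, ∀ v ∈ V, B v z = inner ℝ v g := by
  obtain ⟨z, hz, hmin⟩ := exists_isMinOn_of_strongly_convex (C := V)
    (J := fun z => B z z - 2 * inner ℝ z g) (m := - (‖g‖ ^ 2 / c)) (c := c / 4) ⟨0, h.zero_mem⟩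
    (by positivity)
    (by
      intro v hv
      have h1 := hcoer v hv
      have h2 := real_inner_le_norm v g
      have h3 : 0 ≤ (c * ‖v‖ - ‖g‖) ^ 2 / c := by positivity
      have h4 : (c * ‖v‖ - ‖g‖) ^ 2 / c = c * ‖v‖ ^ 2 - 2 * (‖v‖ * ‖g‖) + ‖g‖ ^ 2 / c := by
        field_simp; ring
      linarith)
    (by
      intro a ha b hb
      refine ⟨(1 / 2 : ℝ) • (a + b), h.smul_mem _ _ (h.add_mem _ ha _ hb), ?_⟩
      have := hcoer _ (h.sub_mem ha hb)
      simp only [h.midpoint_self ha hb, real_inner_smul_left, inner_add_left]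
      linarith)
    (by
      intro x x₀ M hx hlim hJ
      have hin : Tendsto (fun n => 2 * inner ℝ (x n) g) atTop (𝓝 (2 * inner ℝ x₀ g)) :=
        (hlim.inner tendsto_const_nhds).const_mul _
      have hB : Tendsto (fun n => B (x n) (x n)) atTop (𝓝 (M + 2 * inner ℝ x₀ g)) := by
        simpa using hJ.add hin
      have : ∀ δ > 0, x₀ ∈ V ∧ B x₀ x₀ ≤ M + 2 * inner ℝ x₀ g + δ := by
        intro δ hδ
        obtain ⟨N, hN⟩ := (hB.eventually (ge_mem_nhds (show M + 2 * inner ℝ x₀ g <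
          M + 2 * inner ℝ x₀ g + δ by linarith))).exists_forall_of_atTop
        exact h.lsc (fun n => x (n + N)) x₀ _ (fun n => hx _)
          (fun n => hN _ (Nat.le_add_left _ _)) ((tendsto_add_atTop_iff_nat N).2 hlim)
      refine ⟨(this 1 one_pos).1, ?_⟩
      have := le_of_forall_pos_le_add (fun δ hδ => (this δ hδ).2)
      linarith)
  refine ⟨z, hz, fun v hv => ?_⟩
  -- Minimality along `z + t • v` for all real `t`: a nonnegative quadratic without constant term
  -- has no linear term, which is the Euler equation.
  have hq : ∀ t : ℝ, 0 ≤ B v v * (t * t) + (2 * (B z v - inner ℝ v g)) * t + 0 := by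
    intro t
    have := isMinOn_iff.1 hmin _ (h.add_mem _ hz _ (h.smul_mem t _ hv))
    simp only [h.add_smul_self t hz hv, inner_add_left, real_inner_smul_left] at this
    linarith
  have hd := discrim_le_zero hq
  rw [discrim] at hd
  have : (2 * (B z v - inner ℝ v g)) ^ 2 ≤ 0 := by linarith
  have := pow_eq_zero_iff (two_ne_zero) |>.1 (le_antisymm this (sq_nonneg _))
  rw [h.symm _ hv _ hz]
  linarith

end ClosedForm

end

section

/-! ### The smoothing `ψ_ε` -/

section Psi

variable {p ε : ℝ}

theorem psi_of_le {t : ℝ} (ht : ε ^ 2 ≤ t) : psi p ε t = t ^ (p / 2) := by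
  simp [psi, not_lt.2 ht]

theorem sq_rpow_half (hε : 0 < ε) (p : ℝ) : (ε ^ 2) ^ (p / 2) = ε ^ p := by
  rw [← Real.rpow_natCast ε 2, ← Real.rpow_mul hε.le]; congr 1; push_cast; ring

theorem sq_rpow_half_sub_one (hε : 0 < ε) (p : ℝ) :
    (ε ^ 2) ^ (p / 2 - 1) = (ε ^ (2 - p))⁻¹ := by
  rw [← Real.rpow_natCast ε 2, ← Real.rpow_mul hε.le, ← Real.rpow_neg hε.le]
  congr 1; push_cast; ring

/-- The two branches agree at `ε ^ 2`, so the linear formula extends to the closed half-line; this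
is needed for the one-sided derivatives at the junction. -/
theorem psi_of_le' (hε : 0 < ε) {t : ℝ} (ht : t ≤ ε ^ 2) :
    psi p ε t = p / 2 * (t / ε ^ (2 - p)) + (1 - p / 2) * ε ^ p := by
  rcases ht.lt_or_eq with h | h
  · simp [psi, h]
  · rw [psi_of_le h.ge, h, sq_rpow_half hε]
    have : ε ^ 2 = ε ^ (2 - p) * ε ^ p := by
      rw [← Real.rpow_add hε]; norm_num
    rw [this]
    field_simp
    ring

/-- The derivative of `ψ_ε`. -/
def psiDeriv (p ε t : ℝ) : ℝ := p / 2 * (max t (ε ^ 2)) ^ (p / 2 - 1)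

theorem hasDerivAt_psi (hε : 0 < ε) (t : ℝ) : HasDerivAt (psi p ε) (psiDeriv p ε t) t := by
  have hε2 : 0 < ε ^ 2 := by positivity
  have hlin : ∀ x : ℝ, HasDerivAt
      (fun t => p / 2 * (t / ε ^ (2 - p)) + (1 - p / 2) * ε ^ p)
      (p / 2 * (ε ^ 2) ^ (p / 2 - 1)) x := by
    intro x
    rw [sq_rpow_half_sub_one hε]
    have := (((hasDerivAt_id x).div_const (ε ^ (2 - p))).const_mul (p / 2)).add_const
      ((1 - p / 2) * ε ^ p)
    simpa [one_div] using this
  have hpow : ∀ x : ℝ, 0 < x → HasDerivAt (fun t : ℝ => t ^ (p / 2))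
      (p / 2 * x ^ (p / 2 - 1)) x := fun x hx => Real.hasDerivAt_rpow_const (Or.inl hx.ne')
  rcases lt_trichotomy t (ε ^ 2) with h | h | h
  · rw [psiDeriv, max_eq_right h.le]
    refine (hlin t).congr_of_eventuallyEq ?_
    filter_upwards [Iio_mem_nhds h] with x hx using psi_of_le' hε (le_of_lt hx)
  · rw [psiDeriv, h, max_self, ← hasDerivWithinAt_univ, ← Iic_union_Ici (a := ε ^ 2)]
    refine HasDerivWithinAt.union ?_ ?_
    · exact ((hlin _).hasDerivWithinAt).congr (fun x hx => psi_of_le' hε hx)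
        (psi_of_le' hε le_rfl)
    · exact ((hpow _ hε2).hasDerivWithinAt).congr (fun x hx => psi_of_le hx)
        (psi_of_le le_rfl)
  · rw [psiDeriv, max_eq_left h.le]
    refine (hpow t (hε2.trans h)).congr_of_eventuallyEq ?_
    filter_upwards [Ioi_mem_nhds h] with x hx using psi_of_le (le_of_lt hx)

theorem deriv_psi (hε : 0 < ε) (t : ℝ) : deriv (psi p ε) t = psiDeriv p ε t :=
  (hasDerivAt_psi hε t).deriv

theorem psiDeriv_nonneg (hp : 0 < p) (t : ℝ) : 0 ≤ psiDeriv p ε t := by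
  unfold psiDeriv
  have : 0 ≤ max t (ε ^ 2) := le_max_of_le_right (sq_nonneg _)
  positivity

theorem psiDeriv_antitone (hε : 0 < ε) (hp : 0 < p) (hp1 : p < 1) : Antitone (psiDeriv p ε) := by
  intro a b hab
  unfold psiDeriv
  have h0 : 0 < max a (ε ^ 2) := lt_max_of_lt_right (by positivity)
  refine mul_le_mul_of_nonneg_left ?_ (by positivity)
  exact Real.rpow_le_rpow_of_nonpos h0 (max_le_max hab le_rfl) (by linarith)

theorem psiDeriv_le (hε : 0 < ε) (hp : 0 < p) (hp1 : p < 1) (t : ℝ) :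
    psiDeriv p ε t ≤ psiDeriv p ε 0 := by
  refine (psiDeriv_antitone hε hp hp1 (min_le_left t 0)).trans ?_
  unfold psiDeriv
  have : min t 0 ≤ ε ^ 2 := (min_le_right _ _).trans (sq_nonneg _)
  rw [max_eq_right this, max_eq_right (sq_nonneg ε)]

theorem measurable_psiDeriv (p ε : ℝ) : Measurable (psiDeriv p ε) := by
  unfold psiDeriv; fun_prop

theorem concaveOn_psi (hε : 0 < ε) (hp : 0 < p) (hp1 : p < 1) :
    ConcaveOn ℝ univ (psi p ε) := by
  have hd : deriv (psi p ε) = psiDeriv p ε := funext (deriv_psi hε)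
  refine Antitone.concaveOn_univ_of_deriv (fun t => (hasDerivAt_psi hε t).differentiableAt) ?_
  rw [hd]; exact psiDeriv_antitone hε hp hp1

/-- By concavity the linearised term of the subproblem majorises the change of `ψ_ε`, so solving the
subproblem decreases the smoothed objective. -/
theorem psi_le_tangent (hε : 0 < ε) (hp : 0 < p) (hp1 : p < 1) (a t : ℝ) :
    psi p ε a ≤ psi p ε t + psiDeriv p ε t * (a - t) := by
  have hc := concaveOn_psi hε hp hp1
  have hd := hasDerivAt_psi (p := p) hε t
  rcases lt_trichotomy a t with h | h | h
  · have := hc.le_slope_of_hasDerivAt (mem_univ a) (mem_univ t) h hd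
    rw [slope_def_field, le_div_iff₀ (by linarith)] at this
    linarith
  · simp [h]
  · have := hc.slope_le_of_hasDerivAt (mem_univ t) (mem_univ a) h hd
    rw [slope_def_field, div_le_iff₀ (by linarith)] at this
    linarith

/-- Below `ε ^ 2` the function `ψ_ε` is the tangent at `ε ^ 2` of the concave function `ψ_ε'`; above
it the two coincide. Lowering the smoothing parameter therefore never raises the energy. -/
theorem psi_mono_eps {ε' : ℝ} (hε' : 0 < ε') (h : ε' ≤ ε) (hp : 0 < p) (hp1 : p < 1) (t : ℝ) :
    psi p ε' t ≤ psi p ε t := by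
  have hε : 0 < ε := hε'.trans_le h
  have hsq : ε' ^ 2 ≤ ε ^ 2 := by gcongr
  rcases le_total (ε ^ 2) t with ht | ht
  · rw [psi_of_le ht, psi_of_le (hsq.trans ht)]
  · refine (psi_le_tangent hε' hp hp1 t (ε ^ 2)).trans (le_of_eq ?_)
    have e1 : psi p ε' (ε ^ 2) = psi p ε (ε ^ 2) := by
      rw [psi_of_le le_rfl, psi_of_le hsq]
    rw [e1, psi_of_le' hε le_rfl, psi_of_le' hε ht, psiDeriv, max_eq_left hsq,
      sq_rpow_half_sub_one hε]
    field_simp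
    ring

theorem psi_nonneg (hε : 0 < ε) (hp : 0 < p) (hp1 : p < 1) {t : ℝ} (ht : 0 ≤ t) :
    0 ≤ psi p ε t := by
  unfold psi
  have : 0 ≤ 1 - p / 2 := by linarith
  split_ifs <;> positivity

theorem continuous_psi (hε : 0 < ε) : Continuous (psi p ε) :=
  continuous_iff_continuousAt.2 fun t => (hasDerivAt_psi hε t).continuousAt

end Psi

end

section

/-! ### Quadratic minimisation over convex sets -/

namespace ClosedForm

variable {H : Type*} [NormedAddCommGroup H] [InnerProductSpace ℝ H] {V : Set H} {B : H → H → ℝ}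

/-- Lower semicontinuity with convergent instead of constant bounds: pass to a tail and lose `δ`. -/
theorem le_of_tendsto (h : ClosedForm V B) {x : ℕ → H} {x₀ : H} {b : ℕ → ℝ} {M : ℝ}
    (hx : ∀ n, x n ∈ V) (hb : ∀ n, B (x n) (x n) ≤ b n)
    (hlim : Tendsto x atTop (𝓝 x₀)) (hB : Tendsto b atTop (𝓝 M)) : x₀ ∈ V ∧ B x₀ x₀ ≤ M := by
  have : ∀ δ > 0, x₀ ∈ V ∧ B x₀ x₀ ≤ M + δ := by
    intro δ hδ
    obtain ⟨N, hN⟩ := (hB.eventually (ge_mem_nhds (show M < M + δ by linarith))).exists_forall_of_atTop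
    exact h.lsc (fun n => x (n + N)) x₀ _ (fun n => hx _)
      (fun n => (hb _).trans (hN _ (Nat.le_add_left _ _))) ((tendsto_add_atTop_iff_nat N).2 hlim)
  exact ⟨(this 1 one_pos).1, le_of_forall_pos_le_add (fun δ hδ => (this δ hδ).2)⟩

/-- Adding a bounded nonnegative quadratic form to a multiple of a closed form. -/
theorem smul_add_bounded (h : ClosedForm V B) {β γ : ℝ} (hβ : 0 < β) (hγ : 0 ≤ γ)
    (A : H →L[ℝ] H) (hA : ∀ u v, inner ℝ (A u) v = inner ℝ (A v) u)
    (hA0 : ∀ u, 0 ≤ inner ℝ (A u) u) :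
    ClosedForm V (fun u v => β * B u v + γ * inner ℝ (A u) v) where
  zero_mem := h.zero_mem
  add_mem := h.add_mem
  smul_mem := h.smul_mem
  symm u hu v hv := by rw [h.symm u hu v hv, hA]
  add_left u hu v hv z hz := by
    rw [h.add_left u hu v hv z hz, map_add, inner_add_left]; ring
  smul_left c u hu z hz := by
    rw [h.smul_left c u hu z hz, map_smul, real_inner_smul_left]; ring
  nonneg u hu := add_nonneg (mul_nonneg hβ.le (h.nonneg u hu)) (mul_nonneg hγ (hA0 u))
  lsc w wbar c hw hc hlim := by
    have hN : Tendsto (fun n => (c - γ * inner ℝ (A (w n)) (w n)) / β) atTop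
        (𝓝 ((c - γ * inner ℝ (A wbar) wbar) / β)) :=
      (tendsto_const_nhds.sub ((((A.continuous.tendsto _).comp hlim).inner hlim).const_mul γ)).div_const β
    obtain ⟨h1, h2⟩ := h.le_of_tendsto hw
      (fun n => by rw [le_div_iff₀ hβ]; linarith [hc n]) hlim hN
    rw [le_div_iff₀ hβ] at h2
    exact ⟨h1, by linarith⟩

variable {G : Type*} [NormedAddCommGroup G] [InnerProductSpace ℝ G]

/-- Closedness of `C` is only asked for limits whose second component lies in `V`. That membership
comes from lower semicontinuity of `B`, not from convergence in `H`. -/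
theorem exists_isMinOn_quadratic [CompleteSpace H] [CompleteSpace G]
    (h : ClosedForm V B) {c : ℝ} (hc : 0 < c)
    (hcoer : ∀ v ∈ V, c * ‖v‖ ^ 2 ≤ B v v) {C : Set (G × H)} (hCV : ∀ a ∈ C, a.2 ∈ V)
    (hconv : Convex ℝ C) (hne : C.Nonempty)
    (hclosed : ∀ (x : ℕ → G × H) (x₀ : G × H), (∀ n, x n ∈ C) → Tendsto x atTop (𝓝 x₀) →
      x₀.2 ∈ V → x₀ ∈ C)
    (l : G →L[ℝ] ℝ) (g : G) {α ℓ : ℝ} (hα : 0 < α) (hℓ : 0 ≤ ℓ) :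
    ∃ a ∈ C, IsMinOn (fun a : G × H =>
      l (a.1 - g) + α / 2 * ‖a.1‖ ^ 2 + B a.2 a.2 + ℓ / 2 * ‖a.1 - g‖ ^ 2) C a := by
  -- The midpoint gain is `α / 8` in the first variable and `c / 4` in the second; the minimum is
  -- forced by the maximum norm on the product. The lower bound comes from completing the square.
  have hcm : 0 < min (α / 8) (c / 4) := lt_min (by positivity) (by positivity)
  refine exists_isMinOn_of_strongly_convex (C := C) hne (c := min (α / 8) (c / 4))
    (m := - (‖l‖ ^ 2 / (2 * α)) - l g) hcm ?_ ?_ ?_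
  · intro a ha
    have h1 := h.nonneg _ (hCV a ha)
    have h2 : - (‖l‖ * ‖a.1‖) ≤ l a.1 := neg_le_of_abs_le (l.le_opNorm a.1)
    have h3 : 0 ≤ (α * ‖a.1‖ - ‖l‖) ^ 2 / (2 * α) := by positivity
    have h4 : (α * ‖a.1‖ - ‖l‖) ^ 2 / (2 * α)
        = α / 2 * ‖a.1‖ ^ 2 - ‖l‖ * ‖a.1‖ + ‖l‖ ^ 2 / (2 * α) := by
      field_simp; ring
    have h5 : 0 ≤ ℓ / 2 * ‖a.1 - g‖ ^ 2 := by positivity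
    rw [map_sub]
    linarith
  · intro a ha b hb
    have hmem : (1 / 2 : ℝ) • (a + b) ∈ C := by
      rw [smul_add]
      exact hconv ha hb (by norm_num) (by norm_num) (by norm_num)
    refine ⟨_, hmem, ?_⟩
    have hB := h.midpoint_self (hCV a ha) (hCV b hb)
    have hBc := hcoer _ (h.sub_mem (hCV a ha) (hCV b hb))
    have par : ∀ x y : G, ‖(1 / 2 : ℝ) • (x + y)‖ ^ 2
        = (‖x‖ ^ 2 + ‖y‖ ^ 2) / 2 - ‖x - y‖ ^ 2 / 4 := by
      intro x y
      rw [norm_smul, mul_pow, norm_add_sq_real, norm_sub_sq_real]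
      norm_num; ring
    have e1 := par a.1 b.1
    have e2 := par (a.1 - g) (b.1 - g)
    have e3 : (1 / 2 : ℝ) • (a.1 - g + (b.1 - g)) = (1 / 2 : ℝ) • (a.1 + b.1) - g := by
      module
    have e4 : a.1 - g - (b.1 - g) = a.1 - b.1 := by abel
    rw [e3, e4] at e2
    have e5 : l ((1 / 2 : ℝ) • (a.1 + b.1) - g) = (l (a.1 - g) + l (b.1 - g)) / 2 := by
      simp only [map_sub, map_smul, map_add, smul_eq_mul]; ring
    have hpos : 0 ≤ ℓ / 2 * (‖a.1 - b.1‖ ^ 2 / 4) := by positivity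
    have hn : min (α / 8) (c / 4) * ‖a - b‖ ^ 2 ≤ α / 8 * ‖a.1 - b.1‖ ^ 2 + c / 4 * ‖a.2 - b.2‖ ^ 2 := by
      have hp1 : 0 ≤ α / 8 * ‖a.1 - b.1‖ ^ 2 := by positivity
      have hp2 : 0 ≤ c / 4 * ‖a.2 - b.2‖ ^ 2 := by positivity
      rcases max_cases ‖(a - b).1‖ ‖(a - b).2‖ with ⟨h1, -⟩ | ⟨h1, -⟩
      · rw [Prod.norm_def, h1]
        have := mul_le_mul_of_nonneg_right (min_le_left (α / 8) (c / 4)) (sq_nonneg ‖a.1 - b.1‖)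
        simp only [Prod.fst_sub]; linarith
      · rw [Prod.norm_def, h1]
        have := mul_le_mul_of_nonneg_right (min_le_right (α / 8) (c / 4)) (sq_nonneg ‖a.2 - b.2‖)
        simp only [Prod.snd_sub]; linarith
    simp only [Prod.smul_fst, Prod.fst_add, Prod.smul_snd, Prod.snd_add]
    rw [e5, e1, e2, hB]
    linarith
  · intro x x₀ M hx hlim hJ
    have l1 : Tendsto (fun n => (x n).1) atTop (𝓝 x₀.1) := (continuous_fst.tendsto _).comp hlim
    have l2 : Tendsto (fun n => (x n).2) atTop (𝓝 x₀.2) := (continuous_snd.tendsto _).comp hlim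
    have hrest : Tendsto (fun n => l ((x n).1 - g) + α / 2 * ‖(x n).1‖ ^ 2
        + ℓ / 2 * ‖(x n).1 - g‖ ^ 2) atTop
        (𝓝 (l (x₀.1 - g) + α / 2 * ‖x₀.1‖ ^ 2 + ℓ / 2 * ‖x₀.1 - g‖ ^ 2)) := by
      have hcont : Continuous fun y : G => l (y - g) + α / 2 * ‖y‖ ^ 2 + ℓ / 2 * ‖y - g‖ ^ 2 := by
        fun_prop
      exact (hcont.tendsto _).comp l1
    obtain ⟨h1, h2⟩ := h.le_of_tendsto (fun n => hCV _ (hx n)) (fun n => le_rfl) l2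
      (b := fun n => B (x n).2 (x n).2)
      (M := M - (l (x₀.1 - g) + α / 2 * ‖x₀.1‖ ^ 2 + ℓ / 2 * ‖x₀.1 - g‖ ^ 2))
      ((hJ.sub hrest).congr fun n => by ring)
    exact ⟨hclosed x x₀ hx hlim h1, by linarith⟩

/-- A quadratic function that is nonnegative on `[0, 1]` and vanishes at `0` has nonnegative
derivative at `0`. -/
theorem _root_.SparseControl.nonneg_of_forall_quadratic {D Q : ℝ}
    (h : ∀ t : ℝ, 0 < t → t ≤ 1 → 0 ≤ t * D + t ^ 2 * Q) : 0 ≤ D := by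
  by_contra! hD
  have hQ : 0 < |Q| + 1 := by positivity
  -- So small that the quadratic part cannot compensate more than half of the negative slope.
  set t := min 1 (-D / (2 * (|Q| + 1))) with ht
  have ht0 : 0 < t := lt_min one_pos (div_pos (by linarith) (by positivity))
  have h1 := h t ht0 (min_le_left _ _)
  have h2 : t * (2 * (|Q| + 1)) ≤ -D := by
    rw [← le_div_iff₀ (by positivity)]; exact min_le_right _ _
  have h3 : 0 ≤ t * (D + t * Q) := by linarith
  have h4 : 0 ≤ D + t * Q := nonneg_of_mul_nonneg_right h3 ht0
  have h5 : t * Q ≤ t * (|Q| + 1) := by gcongr; linarith [le_abs_self Q]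
  linarith

/-- Minimality on the segment from `a` to `b` gives a quadratic in `t` whose slope at `0` is the
right-hand side. The factor `2` appears because `B` enters the functional without a half. -/
theorem variational_inequality (h : ClosedForm V B) {C : Set (G × H)} (hCV : ∀ a ∈ C, a.2 ∈ V)
    (hconv : Convex ℝ C) (l : G →L[ℝ] ℝ) (g : G) {α ℓ : ℝ} {a b : G × H} (ha : a ∈ C) (hb : b ∈ C)
    (hmin : IsMinOn (fun a : G × H =>
      l (a.1 - g) + α / 2 * ‖a.1‖ ^ 2 + B a.2 a.2 + ℓ / 2 * ‖a.1 - g‖ ^ 2) C a) :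
    0 ≤ l (b.1 - a.1) + α * inner ℝ a.1 (b.1 - a.1) + 2 * B a.2 (b.2 - a.2)
      + ℓ * inner ℝ (a.1 - g) (b.1 - a.1) := by
  refine nonneg_of_forall_quadratic (Q := α / 2 * ‖b.1 - a.1‖ ^ 2 + B (b.2 - a.2) (b.2 - a.2)
    + ℓ / 2 * ‖b.1 - a.1‖ ^ 2) fun t ht0 ht1 => ?_
  have hmem : a + t • (b - a) ∈ C := hconv.add_smul_sub_mem ha hb ⟨ht0.le, ht1⟩
  have := isMinOn_iff.1 hmin _ hmem
  simp only [Prod.fst_add, Prod.smul_fst, Prod.fst_sub, Prod.snd_add, Prod.smul_snd,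
    Prod.snd_sub] at this
  rw [h.add_smul_self t (hCV a ha) (h.sub_mem (hCV b hb) (hCV a ha))] at this
  have sq : ∀ x y : G, ‖x + t • y‖ ^ 2 = ‖x‖ ^ 2 + 2 * t * inner ℝ x y + t ^ 2 * ‖y‖ ^ 2 := by
    intro x y
    rw [norm_add_sq_real, real_inner_smul_right, norm_smul, mul_pow, Real.norm_eq_abs, sq_abs]
    ring
  have e1 : a.1 + t • (b.1 - a.1) - g = (a.1 - g) + t • (b.1 - a.1) := by abel
  rw [e1, sq, sq, map_add, map_smul, smul_eq_mul] at this
  linarith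

end ClosedForm

/-! ### Bounded multiplication operators -/

section Mul

variable {X : Type*} [MeasurableSpace X] {m : Measure X}

theorem memLp_bdd_mul {ω : X → ℝ} (hω : AEStronglyMeasurable ω m) {C : ℝ}
    (hC : ∀ x, |ω x| ≤ C) {g : X → ℝ} (hg : MemLp g 2 m) : MemLp (fun x => ω x * g x) 2 m := by
  refine (hg.const_mul C).mono (hω.mul hg.1) (Eventually.of_forall fun x => ?_)
  simp only [norm_mul, Real.norm_eq_abs]
  exact mul_le_mul_of_nonneg_right ((hC x).trans (le_abs_self C)) (abs_nonneg _)

theorem exists_mulCLM {ω : X → ℝ} (hω : AEStronglyMeasurable ω m) {C : ℝ}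
    (hC : ∀ x, |ω x| ≤ C) :
    ∃ A : Lp ℝ 2 m →L[ℝ] Lp ℝ 2 m, ∀ u v : Lp ℝ 2 m,
      inner ℝ (A u) v = ∫ x, ω x * (u x * v x) ∂m := by
  have hmem : ∀ u : Lp ℝ 2 m, MemLp (fun x => ω x * u x) 2 m := fun u =>
    memLp_bdd_mul hω hC (Lp.memLp u)
  let A₀ : Lp ℝ 2 m →ₗ[ℝ] Lp ℝ 2 m :=
    { toFun := fun u => (hmem u).toLp
      map_add' := fun u v => by
        rw [← MemLp.toLp_add, MemLp.toLp_eq_toLp_iff]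
        filter_upwards [Lp.coeFn_add u v] with x hx
        simp only [hx, Pi.add_apply]; ring
      map_smul' := fun c u => by
        rw [RingHom.id_apply, ← MemLp.toLp_const_smul, MemLp.toLp_eq_toLp_iff]
        filter_upwards [Lp.coeFn_smul c u] with x hx
        simp only [hx, Pi.smul_apply, smul_eq_mul]; ring }
  refine ⟨A₀.mkContinuous |C| fun u => ?_, fun u v => ?_⟩
  · refine Lp.norm_le_mul_norm_of_ae_le_mul ?_
    filter_upwards [(hmem u).coeFn_toLp] with x hx
    rw [show (A₀ u) x = _ from hx, norm_mul]
    exact mul_le_mul_of_nonneg_right ((hC x).trans (le_abs_self C)) (norm_nonneg _)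
  · rw [L2.inner_def]
    refine integral_congr_ae ?_
    filter_upwards [(hmem u).coeFn_toLp] with x hx
    rw [show (A₀.mkContinuous |C| _ u) x = _ from hx]
    simp; ring

end Mul

end

section

/-! ### The subproblem -/

theorem exists_subseq_tendsto_ae {X : Type*} [MeasurableSpace X] {m : Measure X}
    {u : ℕ → Lp ℝ 2 m} {u₀ : Lp ℝ 2 m} (h : Tendsto u atTop (𝓝 u₀)) :
    ∃ φ : ℕ → ℕ, StrictMono φ ∧ ∀ᵐ x ∂m, Tendsto (fun n => u (φ n) x) atTop (𝓝 (u₀ x)) :=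
  (tendstoInMeasure_of_tendsto_Lp h).exists_seq_tendsto_ae

variable {d : ℕ} {Ω : Set (E d)} {T s p α β γ : ℝ} {kind : Kind}

theorem ae_cyl_of_ae {P : E d → Prop} (h : ∀ᵐ x ∂(space Ω), P x) : ∀ᵐ z ∂(cyl T Ω), P z.2 :=
  Measure.quasiMeasurePreserving_snd.ae h

theorem K_convex (h : ClosedForm (W kind Ω s) (innerW kind Ω s)) : Convex ℝ (K kind T Ω s) := by
  rintro ⟨u₁, w₁⟩ ⟨h1, h2⟩ ⟨u₂, w₂⟩ ⟨h3, h4⟩ a b ha hb -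
  refine ⟨h.add_mem _ (h.smul_mem _ _ h1) _ (h.smul_mem _ _ h3), ?_⟩
  filter_upwards [h2, h4, Lp.coeFn_add (a • u₁) (b • u₂), Lp.coeFn_smul a u₁, Lp.coeFn_smul b u₂,
    ae_cyl_of_ae (Lp.coeFn_add (a • w₁) (b • w₂)), ae_cyl_of_ae (Lp.coeFn_smul a w₁),
    ae_cyl_of_ae (Lp.coeFn_smul b w₂)] with z k1 k2 k3 k4 k5 k6 k7 k8
  simp only [Prod.mk_add_mk, Prod.smul_mk] at *
  rw [k3, k6, Pi.add_apply, Pi.add_apply, k4, k5, k7, k8]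
  simp only [Pi.smul_apply, smul_eq_mul]
  refine (abs_add_le _ _).trans ?_
  rw [abs_mul, abs_mul, abs_of_nonneg ha, abs_of_nonneg hb]
  gcongr

/-- Norm convergence gives convergence almost everywhere along nested subsequences, and the
pointwise constraint survives. Membership in `W` does not follow from `L²` convergence and is
assumed. -/
theorem K_closed (x : ℕ → U T Ω × L2 Ω) (x₀ : U T Ω × L2 Ω) (hx : ∀ n, x n ∈ K kind T Ω s)
    (hlim : Tendsto x atTop (𝓝 x₀)) (hW : x₀.2 ∈ W kind Ω s) : x₀ ∈ K kind T Ω s := by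
  refine ⟨hW, ?_⟩
  obtain ⟨φ, hφ, h1⟩ := exists_subseq_tendsto_ae ((continuous_fst.tendsto _).comp hlim)
  obtain ⟨χ, hχ, h2⟩ := exists_subseq_tendsto_ae
    (((continuous_snd.tendsto _).comp hlim).comp hφ.tendsto_atTop)
  filter_upwards [h1, ae_cyl_of_ae h2, ae_all_iff.2 (fun n => (hx n).2)] with z k1 k2 k3
  exact le_of_tendsto_of_tendsto' (k1.comp hχ.tendsto_atTop).abs k2 (fun n => k3 _)

theorem K_zero (h : ClosedForm (W kind Ω s) (innerW kind Ω s)) :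
    ((0 : U T Ω), (0 : L2 Ω)) ∈ K kind T Ω s := by
  refine ⟨h.zero_mem, ?_⟩
  filter_upwards [Lp.coeFn_zero ℝ 2 (cyl T Ω), ae_cyl_of_ae (Lp.coeFn_zero ℝ 2 (space Ω))]
    with z h1 h2
  rw [h1, h2]
  simp

/-- The weight `ψ_ε'(w²)` of the linearised sparsity term. -/
def weight (p ε : ℝ) (w : L2 Ω) (x : E d) : ℝ := psiDeriv p ε ((w x) ^ 2)

theorem aestronglyMeasurable_weight (p ε : ℝ) (w : L2 Ω) :
    AEStronglyMeasurable (weight p ε w) (space Ω) :=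
  ((measurable_psiDeriv p ε).comp_aemeasurable
    ((Lp.aestronglyMeasurable w).aemeasurable.pow_const 2)).aestronglyMeasurable

theorem weight_nonneg (hp : 0 < p) {ε : ℝ} (w : L2 Ω) (x : E d) : 0 ≤ weight p ε w x :=
  psiDeriv_nonneg hp _

theorem abs_weight_le (hp : p ∈ Ioo (0 : ℝ) 1) {ε : ℝ} (hε : 0 < ε) (w : L2 Ω) (x : E d) :
    |weight p ε w x| ≤ psiDeriv p ε 0 := by
  rw [abs_of_nonneg (weight_nonneg hp.1 w x)]
  exact psiDeriv_le hε hp.1 hp.2 _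

theorem integrable_weight_mul (hp : p ∈ Ioo (0 : ℝ) 1) {ε : ℝ} (hε : 0 < ε) (w u v : L2 Ω) :
    Integrable (fun x => weight p ε w x * (u x * v x)) (space Ω) := by
  have := (memLp_bdd_mul (aestronglyMeasurable_weight p ε w) (abs_weight_le hp hε w)
    (Lp.memLp u)).integrable_mul (Lp.memLp v)
  refine this.congr (Eventually.of_forall fun x => ?_)
  simp; ring

section Sub

variable {ε ℓ : ℝ} (f : U T Ω → ℝ) (uk : U T Ω) (wk : L2 Ω)

theorem normW_sq (h : ClosedForm (W kind Ω s) (innerW kind Ω s)) {w : L2 Ω}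
    (hw : w ∈ W kind Ω s) : normW kind Ω s w ^ 2 = innerW kind Ω s w w :=
  Real.sq_sqrt (h.nonneg w hw)

/-- On `K` the cost of the subproblem is a closed quadratic form plus lower order terms. -/
theorem exists_subCost_form (hβ : 0 < β) (hγ : 0 < γ)
    (h : ClosedForm (W kind Ω s) (innerW kind Ω s)) (hp : p ∈ Ioo (0 : ℝ) 1) (hε : 0 < ε) :
    ∃ (Q : L2 Ω → L2 Ω → ℝ) (k : ℝ), ClosedForm (W kind Ω s) Q ∧
      (∀ u v, Q u v = β / 2 * innerW kind Ω s u v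
        + γ * ∫ x, weight p ε wk x * (u x * v x) ∂(space Ω)) ∧
      ∀ a ∈ K kind T Ω s, subCost kind T Ω s p α β γ f ε ℓ uk wk a =
        fderiv ℝ f uk (a.1 - uk) + α / 2 * ‖a.1‖ ^ 2 + Q a.2 a.2 + ℓ / 2 * ‖a.1 - uk‖ ^ 2 + k := by
  obtain ⟨A, hA⟩ := exists_mulCLM (aestronglyMeasurable_weight p ε wk) (abs_weight_le hp hε wk)
  refine ⟨fun u v => β / 2 * innerW kind Ω s u v + γ * inner ℝ (A u) v,
    - (γ * ∫ x, weight p ε wk x * (wk x * wk x) ∂(space Ω)),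
    h.smul_add_bounded (by positivity) hγ.le A ?_ ?_, fun u v => by simp only [hA], fun a ha => ?_⟩
  · intro u v; rw [hA, hA]; simp only [mul_comm (u _) (v _)]
  · intro u; rw [hA]
    exact integral_nonneg fun x => mul_nonneg (weight_nonneg hp.1 wk x) (mul_self_nonneg _)
  · unfold subCost
    rw [normW_sq h ha.1]
    simp only [hA]
    have : ∫ x, deriv (psi p ε) ((wk x) ^ 2) * ((a.2 x) ^ 2 - (wk x) ^ 2) ∂(space Ω)
        = (∫ x, weight p ε wk x * (a.2 x * a.2 x) ∂(space Ω))
          - ∫ x, weight p ε wk x * (wk x * wk x) ∂(space Ω) := by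
      rw [← integral_sub (integrable_weight_mul hp hε _ _ _) (integrable_weight_mul hp hε _ _ _)]
      congr 1; ext x
      rw [deriv_psi hε, weight]; ring
    rw [this]; ring

/-- The rule selecting `L_k` speaks about every solution for a smaller parameter, and would say
nothing if there were none. Existence is what makes it bound `L_k`. -/
theorem exists_solvesSub (hα : 0 < α) (hβ : 0 < β) (hγ : 0 < γ)
    (h : ClosedForm (W kind Ω s) (innerW kind Ω s)) {c : ℝ} (hc : 0 < c)
    (hcoer : ∀ v ∈ W kind Ω s, c * ‖v‖ ^ 2 ≤ innerW kind Ω s v v)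
    (hp : p ∈ Ioo (0 : ℝ) 1) (hε : 0 < ε) (hℓ : 0 ≤ ℓ) :
    ∃ a, SolvesSub kind T Ω s p α β γ f ε ℓ uk wk a := by
  obtain ⟨Q, k, hQ, hQB, hcost⟩ := exists_subCost_form (α := α) (ℓ := ℓ) f uk wk hβ hγ h hp hε
  obtain ⟨a, ha, hmin⟩ := hQ.exists_isMinOn_quadratic (c := β / 2 * c) (by positivity) (by
      intro v hv
      rw [hQB]
      have h1 : 0 ≤ ∫ x, weight p ε wk x * (v x * v x) ∂(space Ω) :=
        integral_nonneg fun x => mul_nonneg (weight_nonneg hp.1 wk x) (mul_self_nonneg _)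
      have h2 := mul_le_mul_of_nonneg_left (hcoer v hv) (show 0 ≤ β / 2 by positivity)
      have h3 := mul_nonneg hγ.le h1
      linarith)
    (C := K kind T Ω s) (fun a ha => ha.1) (K_convex h) ⟨_, K_zero h⟩ K_closed
    (fderiv ℝ f uk) uk hα hℓ
  refine ⟨a, ha, isMinOn_iff.2 fun b hb => ?_⟩
  have := isMinOn_iff.1 hmin b hb
  rw [hcost a ha, hcost b hb]
  linarith

theorem SolvesSub.variational_inequality (hβ : 0 < β) (hγ : 0 < γ)
    (h : ClosedForm (W kind Ω s) (innerW kind Ω s)) (hp : p ∈ Ioo (0 : ℝ) 1) (hε : 0 < ε)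
    {f : U T Ω → ℝ} {uk : U T Ω} {wk : L2 Ω} {a b : U T Ω × L2 Ω}
    (ha : SolvesSub kind T Ω s p α β γ f ε ℓ uk wk a) (hb : b ∈ K kind T Ω s) :
    0 ≤ fderiv ℝ f uk (b.1 - a.1) + α * inner ℝ a.1 (b.1 - a.1)
      + β * innerW kind Ω s a.2 (b.2 - a.2)
      + 2 * γ * (∫ x, weight p ε wk x * (a.2 x * (b.2 - a.2) x) ∂(space Ω))
      + ℓ * inner ℝ (a.1 - uk) (b.1 - a.1) := by
  obtain ⟨Q, k, hQ, hQB, hcost⟩ := exists_subCost_form (α := α) (ℓ := ℓ) f uk wk hβ hγ h hp hε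
  have := hQ.variational_inequality (C := K kind T Ω s) (fun a ha => ha.1) (K_convex h)
    (fderiv ℝ f uk) uk (α := α) (ℓ := ℓ) ha.1 hb (isMinOn_iff.2 fun b hb => by
      have := isMinOn_iff.1 ha.2 b hb
      rw [hcost a ha.1, hcost b hb] at this
      linarith)
  rw [hQB] at this
  linarith

end Sub

/-! ### Descent and boundedness along the scheme -/

theorem integrable_psi_sq [IsFiniteMeasure (space Ω)] (hp : p ∈ Ioo (0 : ℝ) 1) {ε : ℝ}
    (hε : 0 < ε) (w : L2 Ω) : Integrable (fun x => psi p ε ((w x) ^ 2)) (space Ω) := by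
  have h1 : Integrable (fun x => (w x) ^ 2) (space Ω) := (Lp.memLp w).integrable_sq
  refine ((integrable_const (psi p ε 0)).add (h1.const_mul (psiDeriv p ε 0))).mono'
    ((continuous_psi hε).comp_aestronglyMeasurable h1.1) (Eventually.of_forall fun x => ?_)
  rw [Real.norm_eq_abs, abs_of_nonneg (psi_nonneg hε hp.1 hp.2 (sq_nonneg _))]
  simpa using psi_le_tangent hε hp.1 hp.2 ((w x) ^ 2) 0

/-- The smoothed objective. -/
def energy (kind : Kind) (T : ℝ) (Ω : Set (E d)) (s p α β γ : ℝ) (f : U T Ω → ℝ) (ε : ℝ)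
    (u : U T Ω) (w : L2 Ω) : ℝ :=
  f u + α / 2 * ‖u‖ ^ 2 + β / 2 * innerW kind Ω s w w + γ * ∫ x, psi p ε ((w x) ^ 2) ∂(space Ω)

/-- The variational inequality is tested with the previous iterate. Its proximal term is exactly `-ℓ
‖u - uk‖²` and cancels the quadratic term of the descent condition. The remainder `α / 2 * ‖u - uk‖
^ 2` is the strong convexity of the control cost. -/
theorem energy_step [IsFiniteMeasure (space Ω)] (hβ : 0 < β) (hγ : 0 < γ)
    (h : ClosedForm (W kind Ω s) (innerW kind Ω s)) (hp : p ∈ Ioo (0 : ℝ) 1) {ε ε' ℓ : ℝ}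
    (hε' : 0 < ε') (hεε : ε' ≤ ε) {f : U T Ω → ℝ} {uk u : U T Ω} {wk w : L2 Ω}
    (hk : (uk, wk) ∈ K kind T Ω s)
    (ha : SolvesSub kind T Ω s p α β γ f ε ℓ uk wk (u, w)) (hdesc : DescentCond f ℓ uk u) :
    energy kind T Ω s p α β γ f ε' u w + α / 2 * ‖u - uk‖ ^ 2
      ≤ energy kind T Ω s p α β γ f ε uk wk := by
  have hε := hε'.trans_le hεε
  have hvi := ha.variational_inequality hβ hγ h hp hε hk
  simp only at hvi
  have hw := ha.1.1
  have hwk := hk.1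
  have i1 : ‖uk‖ ^ 2 = ‖u‖ ^ 2 + 2 * inner ℝ u (uk - u) + ‖u - uk‖ ^ 2 := by
    rw [norm_sub_rev u uk, ← norm_add_sq_real]; congr 2; abel
  have i2 : innerW kind Ω s wk wk = innerW kind Ω s w w + 2 * innerW kind Ω s w (wk - w)
      + innerW kind Ω s (wk - w) (wk - w) := by
    have := h.add_smul_self 1 hw (h.sub_mem hwk hw)
    rw [one_smul, add_sub_cancel] at this
    linarith
  have i3 : inner ℝ (u - uk) (uk - u) = - ‖u - uk‖ ^ 2 := by
    rw [← neg_sub u uk, inner_neg_right, real_inner_self_eq_norm_sq]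
  have i4 : fderiv ℝ f uk (uk - u) = - fderiv ℝ f uk (u - uk) := by
    rw [← neg_sub u uk, map_neg]
  have i5 : 0 ≤ β / 2 * innerW kind Ω s (wk - w) (wk - w) :=
    mul_nonneg (by positivity) (h.nonneg _ (h.sub_mem hwk hw))
  have i6 : (∫ x, psi p ε' ((w x) ^ 2) ∂(space Ω)) ≤ (∫ x, psi p ε ((wk x) ^ 2) ∂(space Ω))
      - 2 * ∫ x, weight p ε wk x * (w x * (wk - w) x) ∂(space Ω) := by
    rw [← integral_const_mul, ← integral_sub (integrable_psi_sq hp hε wk)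
      ((integrable_weight_mul hp hε _ _ _).const_mul 2)]
    refine integral_mono_ae (integrable_psi_sq hp hε' w) ((integrable_psi_sq hp hε wk).sub
      ((integrable_weight_mul hp hε _ _ _).const_mul 2)) ?_
    filter_upwards [Lp.coeFn_sub wk w] with x hx
    have e1 := psi_mono_eps hε' hεε hp.1 hp.2 ((w x) ^ 2)
    have e2 := psi_le_tangent hε hp.1 hp.2 ((w x) ^ 2) ((wk x) ^ 2)
    have e3 : psiDeriv p ε ((wk x) ^ 2) * ((w x) ^ 2 - (wk x) ^ 2)
        ≤ - (2 * (psiDeriv p ε ((wk x) ^ 2) * (w x * (wk x - w x)))) := by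
      have := mul_nonneg (psiDeriv_nonneg (ε := ε) hp.1 ((wk x) ^ 2)) (sq_nonneg (wk x - w x))
      linarith
    simp only [weight, hx, Pi.sub_apply]
    linarith
  have i7 := mul_le_mul_of_nonneg_left i6 hγ.le
  have i8 := hdesc
  unfold DescentCond at i8
  rw [i3, i4] at hvi
  unfold energy
  rw [i1, i2]
  linarith

/-- By Young's inequality the affine minorant of `f` costs at most half of the control cost. -/
theorem le_energy (hα : 0 < α) (hγ : 0 < γ) (hp : p ∈ Ioo (0 : ℝ) 1) {ε : ℝ} (hε : 0 < ε)
    {f : U T Ω → ℝ} {g : U T Ω →L[ℝ] ℝ} {c : ℝ} (hg : ∀ u, g u + c ≤ f u)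
    (u : U T Ω) (w : L2 Ω) :
    α / 4 * ‖u‖ ^ 2 + β / 2 * innerW kind Ω s w w + (c - ‖g‖ ^ 2 / α)
      ≤ energy kind T Ω s p α β γ f ε u w := by
  have h1 : 0 ≤ γ * ∫ x, psi p ε ((w x) ^ 2) ∂(space Ω) :=
    mul_nonneg hγ.le (integral_nonneg fun x => psi_nonneg hε hp.1 hp.2 (sq_nonneg _))
  have h2 : - (‖g‖ * ‖u‖) ≤ g u := neg_le_of_abs_le (g.le_opNorm u)
  have h3 : 0 ≤ (α / 2 * ‖u‖ - ‖g‖) ^ 2 / α := by positivity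
  have h4 : (α / 2 * ‖u‖ - ‖g‖) ^ 2 / α = α / 4 * ‖u‖ ^ 2 - ‖g‖ * ‖u‖ + ‖g‖ ^ 2 / α := by
    field_simp; ring
  have h5 := hg u
  unfold energy
  linarith

section Scheme

variable {f : U T Ω → ℝ} {b L : ℝ} {ε : ℕ → ℝ} {u : ℕ → U T Ω} {w : ℕ → L2 Ω} {Lk : ℕ → ℝ}

theorem IsGenerated.mem_K (hgen : IsGenerated kind T Ω s p α β γ f b L ε u w Lk) (k : ℕ) :
    (u (k + 1), w (k + 1)) ∈ K kind T Ω s := by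
  obtain ⟨l, -, h, -⟩ := hgen.step k
  exact h.1

/-- The energy is nonincreasing and coercive, so iterates stay bounded; it converges, so its
decrements, which dominate `‖u (k + 1) - u k‖ ^ 2`, vanish. -/
theorem IsGenerated.bounded [IsFiniteMeasure (space Ω)] (hα : 0 < α) (hβ : 0 < β) (hγ : 0 < γ)
    (h : ClosedForm (W kind Ω s) (innerW kind Ω s)) (hp : p ∈ Ioo (0 : ℝ) 1)
    (hf : ObjectiveAssumptions f)
    (hgen : IsGenerated kind T Ω s p α β γ f b L ε u w Lk) :
    ∃ R : ℝ, (∀ k, ‖u k‖ ≤ R) ∧ (∀ k, innerW kind Ω s (w k) (w k) ≤ R) ∧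
      Tendsto (fun k => ‖u (k + 1) - u k‖) atTop (𝓝 0) := by
  obtain ⟨g, c, hg⟩ := hf.affine_lower_bound
  -- The energies start at index one, because the starting pair need not lie in `K` and so is no
  -- admissible competitor.
  set Φ : ℕ → ℝ := fun k => energy kind T Ω s p α β γ f (ε (k + 1)) (u (k + 1)) (w (k + 1))
    with hΦ
  have hstep : ∀ k, Φ (k + 1) + α / 2 * ‖u (k + 2) - u (k + 1)‖ ^ 2 ≤ Φ k := by
    intro k
    obtain ⟨l, -, h1, h2, -⟩ := hgen.step (k + 1)
    exact energy_step hβ hγ h hp (hgen.eps_pos _) (hgen.eps_antitone (Nat.le_succ _))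
      (hgen.mem_K k) h1 h2
  have hanti : Antitone Φ := antitone_nat_of_succ_le fun k => by
    have : 0 ≤ α / 2 * ‖u (k + 2) - u (k + 1)‖ ^ 2 := by positivity
    linarith [hstep k]
  have hlow : ∀ k, α / 4 * ‖u (k + 1)‖ ^ 2 + β / 2 * innerW kind Ω s (w (k + 1)) (w (k + 1))
      + (c - ‖g‖ ^ 2 / α) ≤ Φ k := fun k => le_energy hα hγ hp (hgen.eps_pos _) hg _ _
  have hB : ∀ k, 0 ≤ β / 2 * innerW kind Ω s (w (k + 1)) (w (k + 1)) := fun k =>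
    mul_nonneg (by positivity) (h.nonneg _ (hgen.mem_K k).1)
  set M := Φ 0 - (c - ‖g‖ ^ 2 / α) with hM
  have hM1 : ∀ k, α / 4 * ‖u (k + 1)‖ ^ 2 ≤ M := fun k => by
    linarith [hlow k, hB k, hanti (Nat.zero_le k)]
  have hM2 : ∀ k, β / 2 * innerW kind Ω s (w (k + 1)) (w (k + 1)) ≤ M := fun k => by
    have : 0 ≤ α / 4 * ‖u (k + 1)‖ ^ 2 := by positivity
    linarith [hlow k, hanti (Nat.zero_le k)]
  have hconv : Tendsto Φ atTop (𝓝 (⨅ k, Φ k)) := by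
    refine tendsto_atTop_ciInf hanti ⟨c - ‖g‖ ^ 2 / α, ?_⟩
    rintro _ ⟨k, rfl⟩
    have : 0 ≤ α / 4 * ‖u (k + 1)‖ ^ 2 := by positivity
    linarith [hlow k, hB k]
  have hdiff : Tendsto (fun k => 2 / α * (Φ k - Φ (k + 1))) atTop (𝓝 0) := by
    simpa using (hconv.sub (hconv.comp (tendsto_add_atTop_nat 1))).const_mul (2 / α)
  have hsq : Tendsto (fun k => ‖u (k + 2) - u (k + 1)‖ ^ 2) atTop (𝓝 0) := by
    refine squeeze_zero (fun k => sq_nonneg _) (fun k => ?_) hdiff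
    rw [div_mul_eq_mul_div, le_div_iff₀ hα]
    linarith [hstep k]
  have hnorm : Tendsto (fun k => ‖u (k + 2) - u (k + 1)‖) atTop (𝓝 0) := by
    have := hsq.sqrt
    simpa [Real.sqrt_sq (norm_nonneg _)] using this
  refine ⟨max (max ‖u 0‖ (√(M * 4 / α))) (max (innerW kind Ω s (w 0) (w 0)) (M * 2 / β)),
    ?_, ?_, (tendsto_add_atTop_iff_nat 1).1 hnorm⟩
  · rintro (_ | k)
    · exact (le_max_left _ _).trans (le_max_left _ _)
    · refine le_trans (Real.le_sqrt_of_sq_le ?_) ((le_max_right _ _).trans (le_max_left _ _))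
      rw [le_div_iff₀ hα]; linarith [hM1 k]
  · rintro (_ | k)
    · exact (le_max_left _ _).trans (le_max_right _ _)
    · refine le_trans ?_ ((le_max_right _ _).trans (le_max_right _ _))
      rw [le_div_iff₀ hβ]; linarith [hM2 k]

end Scheme

end

section

/-! ### Boundedness of the step parameters -/

section Gradient

variable {H : Type*} [NormedAddCommGroup H] [InnerProductSpace ℝ H] [CompleteSpace H]

theorem fderiv_eq_inner_gradient (f : H → ℝ) (x v : H) :
    fderiv ℝ f x v = inner ℝ (gradient f x) v := by
  rw [gradient, InnerProductSpace.toDual_symm_apply]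

theorem norm_fderiv_sub_eq (f : H → ℝ) (x y : H) :
    ‖fderiv ℝ f x - fderiv ℝ f y‖ = ‖gradient f x - gradient f y‖ := by
  rw [gradient, gradient, ← map_sub, LinearIsometryEquiv.norm_map]

/-- Mean value inequality on the segment. The crude constant `M`, without the factor one half of
Taylor's formula, suffices because the descent condition carries `ℓ` and not `ℓ / 2`. -/
theorem descentCond_of_lipschitzOn {f : H → ℝ} (hf : Differentiable ℝ f) {R : ℝ} {M : ℝ≥0}
    (hM : LipschitzOnWith M (gradient f) (Metric.closedBall 0 R)) {u v : H} (hu : ‖u‖ ≤ R)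
    (hv : ‖v‖ ≤ R) {ℓ : ℝ} (hℓ : M ≤ ℓ) : DescentCond f ℓ u v := by
  have hu' : u ∈ Metric.closedBall (0 : H) R := by simpa using hu
  have hv' : v ∈ Metric.closedBall (0 : H) R := by simpa using hv
  have hseg : segment ℝ u v ⊆ Metric.closedBall 0 R :=
    (convex_closedBall 0 R).segment_subset hu' hv'
  have := (convex_segment (𝕜 := ℝ) u v).norm_image_sub_le_of_norm_fderiv_le' (f := f)
    (φ := fderiv ℝ f u) (C := M * ‖v - u‖) (fun x _ => hf x) (fun x hx => by
      rw [norm_fderiv_sub_eq, ← dist_eq_norm]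
      refine (hM.dist_le_mul x (hseg hx) u hu').trans ?_
      rw [dist_eq_norm]
      gcongr
      simpa [norm_sub_rev] using norm_sub_le_of_mem_segment hx)
    (left_mem_segment ℝ u v) (right_mem_segment ℝ u v)
  have h2 := (le_abs_self _).trans (Real.norm_eq_abs _ ▸ this)
  have h3 : (M : ℝ) * ‖v - u‖ * ‖v - u‖ ≤ ℓ * ‖v - u‖ ^ 2 := by
    rw [mul_assoc, ← sq]; gcongr
  unfold DescentCond
  linarith

end Gradient

variable {d : ℕ} {Ω : Set (E d)} {T s p α β γ : ℝ} {kind : Kind} {f : U T Ω → ℝ} {b L : ℝ}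
  {ε : ℕ → ℝ} {u : ℕ → U T Ω} {w : ℕ → L2 Ω} {Lk : ℕ → ℝ}

/-- Tested with `(0, 0)`. If `‖a.1‖ ≥ ‖uk‖`, the proximal term has a good sign whatever `ℓ` is. The
bound is therefore independent of the parameter that it serves to control. -/
theorem SolvesSub.norm_le (hα : 0 < α) (hβ : 0 < β) (hγ : 0 < γ)
    (h : ClosedForm (W kind Ω s) (innerW kind Ω s)) (hp : p ∈ Ioo (0 : ℝ) 1) {ε ℓ : ℝ}
    (hε : 0 < ε) (hℓ : 0 ≤ ℓ) {uk : U T Ω} {wk : L2 Ω} {a : U T Ω × L2 Ω}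
    (ha : SolvesSub kind T Ω s p α β γ f ε ℓ uk wk a) {R D : ℝ} (hR : ‖uk‖ ≤ R)
    (hD : ‖gradient f uk‖ ≤ D) : ‖a.1‖ ≤ max R (D / α) := by
  by_contra! hcon
  obtain ⟨h1, h2⟩ := max_lt_iff.1 hcon
  have hvi := ha.variational_inequality hβ hγ h hp hε (K_zero h)
  simp only [zero_sub] at hvi
  have hneg : innerW kind Ω s a.2 (-a.2) = - innerW kind Ω s a.2 a.2 := by
    have := h.smul_right (-1) ha.1.1 ha.1.1
    rwa [neg_one_smul, neg_one_mul] at this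
  have hint : (∫ x, weight p ε wk x * (a.2 x * (-a.2) x) ∂(space Ω)) ≤ 0 := by
    refine integral_nonpos_of_ae ?_
    filter_upwards [Lp.coeFn_neg a.2] with x hx
    rw [hx, Pi.neg_apply, mul_neg, mul_neg]
    exact neg_nonpos.2 (mul_nonneg (weight_nonneg hp.1 wk x) (mul_self_nonneg _))
  rw [hneg, inner_neg_right, inner_neg_right, inner_sub_left, real_inner_self_eq_norm_sq,
    fderiv_eq_inner_gradient, inner_neg_right] at hvi
  have e1 := mul_nonneg hβ.le (h.nonneg _ ha.1.1)
  have e2 : 2 * γ * (∫ x, weight p ε wk x * (a.2 x * (-a.2) x) ∂(space Ω)) ≤ 0 :=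
    mul_nonpos_of_nonneg_of_nonpos (by positivity) hint
  have e3 := (abs_le.1 (abs_real_inner_le_norm (gradient f uk) a.1)).1
  have e4 : inner ℝ uk a.1 ≤ ‖a.1‖ ^ 2 := by
    refine (real_inner_le_norm _ _).trans ?_
    rw [sq]; gcongr; exact hR.trans h1.le
  have e5 := mul_nonneg hℓ (sub_nonneg.2 e4)
  have hpos : 0 < ‖a.1‖ := (norm_nonneg uk).trans_lt (hR.trans_lt h1)
  have e6 : ‖gradient f uk‖ * ‖a.1‖ ≤ D * ‖a.1‖ := by gcongr
  have e7 : D < ‖a.1‖ * α := (div_lt_iff₀ hα).1 h2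
  have e8 : D * ‖a.1‖ < ‖a.1‖ * α * ‖a.1‖ := by gcongr
  nlinarith

theorem IsGenerated.exists_Lk_le (hα : 0 < α) (hβ : 0 < β) (hγ : 0 < γ)
    (h : ClosedForm (W kind Ω s) (innerW kind Ω s)) {c : ℝ} (hc : 0 < c)
    (hcoer : ∀ v ∈ W kind Ω s, c * ‖v‖ ^ 2 ≤ innerW kind Ω s v v)
    (hp : p ∈ Ioo (0 : ℝ) 1) (hf : ObjectiveAssumptions f)
    (hgen : IsGenerated kind T Ω s p α β γ f b L ε u w Lk) {R : ℝ} (hR : ∀ k, ‖u k‖ ≤ R) :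
    ∃ M, ∀ k, 0 ≤ Lk k ∧ Lk k ≤ M := by
  have hR0 : 0 ≤ R := (norm_nonneg _).trans (hR 0)
  have hb : 0 < b := one_pos.trans hgen.one_lt_b
  obtain ⟨M₀, hM₀⟩ := hf.lipschitz_on_bounded R
  set D : ℝ := M₀ * R + ‖gradient f 0‖ with hD
  have hDle : ∀ k, ‖gradient f (u k)‖ ≤ D := by
    intro k
    have h1 := hM₀.norm_sub_le (x := u k) (y := 0) (by simpa using hR k) (by simpa using hR0)
    rw [sub_zero] at h1
    have h2 : ‖gradient f (u k)‖ ≤ ‖gradient f (u k) - gradient f 0‖ + ‖gradient f 0‖ := by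
      simpa using norm_add_le (gradient f (u k) - gradient f 0) (gradient f 0)
    have h3 : (M₀ : ℝ) * ‖u k‖ ≤ M₀ * R := by gcongr; exact hR k
    linarith
  -- This ball contains all iterates and all trial solutions, for every step parameter.
  obtain ⟨M, hM⟩ := hf.lipschitz_on_bounded (max R (D / α))
  refine ⟨max L (b * M), fun k => ?_⟩
  obtain ⟨l, hl, -, -, hmin⟩ := hgen.step k
  refine ⟨hl ▸ mul_nonneg hgen.L_pos.le (pow_nonneg hb.le _), ?_⟩
  rcases l with _ | l
  · simp [hl]
  -- The preceding trial parameter was rejected, hence lies below `M`; the accepted one is `b` times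
  -- larger.
  · refine le_trans ?_ (le_max_right _ _)
    have hℓ : 0 ≤ L * b ^ l := mul_nonneg hgen.L_pos.le (pow_nonneg hb.le _)
    obtain ⟨a, ha⟩ := exists_solvesSub (α := α) f (u k) (w k) hα hβ hγ h hc hcoer hp
      (hgen.eps_pos k) hℓ
    have hnot := hmin l (Nat.lt_succ_self l) a ha
    have hlt : L * b ^ l < M := by
      by_contra! hcon
      exact hnot (descentCond_of_lipschitzOn hf.differentiable hM
        ((hR k).trans (le_max_left _ _))
        (ha.norm_le hα hβ hγ h hp (hgen.eps_pos k) hℓ (hR k) (hDle k)) hcon)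
    rw [hl, pow_succ]
    calc L * (b ^ l * b) = b * (L * b ^ l) := by ring
      _ ≤ b * M := by gcongr

/-! ### The limiting inequality -/

/-- One good time slice suffices, and it exists because the time interval has positive measure. -/
theorem ae_nonneg_of_mem_K (hT : 0 < T) {a : U T Ω × L2 Ω} (ha : a ∈ K kind T Ω s) :
    ∀ᵐ x ∂(space Ω), 0 ≤ a.2 x := by
  have h1 := Measure.ae_ae_of_ae_prod ha.2
  have : NeBot (ae (volume.restrict (Ioo 0 T))) := by
    rw [ae_neBot, Ne, Measure.restrict_eq_zero]; simp [Real.volume_Ioo, hT]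
  obtain ⟨t, ht⟩ := h1.exists
  filter_upwards [ht] with x hx using (abs_nonneg _).trans hx

/-- The optimality conditions of the iterates along a weakly convergent subsequence, tested with
pairs `(v, z)` such that `z ≤ w`. -/
theorem IsGenerated.exists_limit_inequality [IsFiniteMeasure (space Ω)] (hT : 0 < T)
    (hα : 0 < α) (hβ : 0 < β) (hγ : 0 < γ)
    (h : ClosedForm (W kind Ω s) (innerW kind Ω s)) {c : ℝ} (hc : 0 < c)
    (hcoer : ∀ v ∈ W kind Ω s, c * ‖v‖ ^ 2 ≤ innerW kind Ω s v v)
    (hp : p ∈ Ioo (0 : ℝ) 1) (hf : ObjectiveAssumptions f)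
    (hgen : IsGenerated kind T Ω s p α β γ f b L ε u w Lk) {ubar : U T Ω} {wbar : L2 Ω}
    (hlim : IsWeakLimitPoint kind T Ω s u w ubar wbar) :
    ∃ (R : ℝ) (v : ℕ → U T Ω) (z : ℕ → L2 Ω) (e : ℕ → U T Ω), WeakConv v ubar ∧
      WeakConvW kind Ω s z wbar ∧ (∀ n, (v n, z n) ∈ K kind T Ω s) ∧ (∀ n, ‖v n‖ ≤ R) ∧
      (∀ n, innerW kind Ω s (z n) (z n) ≤ R) ∧ Tendsto (fun n => ‖e n‖) atTop (𝓝 0) ∧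
      ∀ n, ∀ a ∈ K kind T Ω s, (∀ᵐ x ∂(space Ω), a.2 x ≤ z n x) →
        0 ≤ inner ℝ (gradient f ubar) (a.1 - v n) + inner ℝ (e n) (a.1 - v n)
          + α * inner ℝ (v n) (a.1 - v n) + β * innerW kind Ω s (z n) (a.2 - z n) := by
  obtain ⟨R, hR1, hR2, hdiff⟩ := hgen.bounded hα hβ hγ h hp hf
  obtain ⟨M, hM⟩ := hgen.exists_Lk_le hα hβ hγ h hc hcoer hp hf hR1
  obtain ⟨φ, hφ, hu, hw⟩ := hlim
  -- The index of the predecessor. Starting from `φ (n + 1)`, which is at least one, ensures that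
  -- the pair considered was produced by a step of the scheme.
  set κ : ℕ → ℕ := fun n => φ (n + 1) - 1 with hκ
  have hκφ : ∀ n, κ n + 1 = φ (n + 1) := fun n =>
    Nat.sub_add_cancel ((Nat.succ_le_succ (Nat.zero_le n)).trans (hφ.id_le (n + 1)))
  have hκt : Tendsto κ atTop atTop := by
    refine tendsto_atTop_mono (fun n => ?_) tendsto_id
    have := hφ.id_le (n + 1)
    have := hκφ n
    simp only [id] at *
    omega
  have hdiff' : Tendsto (fun n => ‖u (κ n + 1) - u (κ n)‖) atTop (𝓝 0) := hdiff.comp hκt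
  have hweak1 : WeakConv (fun n => u (κ n + 1)) ubar := by
    intro v
    simp only [hκφ]
    exact (hu v).comp (tendsto_add_atTop_nat 1)
  -- The subproblem contains the gradient at the predecessor, which has the same weak limit since
  -- consecutive controls approach each other; complete continuity then applies.
  have hweak0 : WeakConv (fun n => u (κ n)) ubar := by
    intro v
    have h1 : Tendsto (fun n => inner ℝ (u (κ n + 1) - u (κ n)) v) atTop (𝓝 0) := by
      refine squeeze_zero_norm (fun n => ?_) (by simpa using hdiff'.mul_const ‖v‖)
      exact abs_real_inner_le_norm _ _
    have h2 := (hweak1 v).sub h1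
    rw [sub_zero] at h2
    refine h2.congr fun n => ?_
    rw [← inner_sub_left, sub_sub_cancel]
  have hgrad := hf.completely_continuous _ _ hweak0
  -- The gradient error and the proximal term together; the latter vanishes because the step
  -- parameters are bounded.
  set e : ℕ → U T Ω := fun n => (gradient f (u (κ n)) - gradient f ubar)
    + Lk (κ n) • (u (κ n + 1) - u (κ n)) with he
  refine ⟨R, fun n => u (κ n + 1), fun n => w (κ n + 1), e, hweak1, ?_, fun n => hgen.mem_K _,
    fun n => hR1 _, fun n => hR2 _, ?_, ?_⟩
  · refine ⟨fun n => (hgen.mem_K _).1, hw.2.1, fun z hz => ?_⟩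
    simp only [hκφ]
    exact (hw.2.2 z hz).comp (tendsto_add_atTop_nat 1)
  · have h1 : Tendsto (fun n => ‖gradient f (u (κ n)) - gradient f ubar‖) atTop (𝓝 0) := by
      simpa using (hgrad.sub_const (gradient f ubar)).norm
    have h2 : Tendsto (fun n => ‖gradient f (u (κ n)) - gradient f ubar‖
        + M * ‖u (κ n + 1) - u (κ n)‖) atTop (𝓝 0) := by
      simpa using h1.add (hdiff'.const_mul M)
    refine squeeze_zero (fun n => norm_nonneg _) (fun n => ?_) h2
    refine (norm_add_le _ _).trans ?_
    rw [norm_smul, Real.norm_eq_abs, abs_of_nonneg (hM _).1]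
    gcongr
    exact (hM _).2
  · intro n a ha hle
    obtain ⟨l, -, hsol, -, -⟩ := hgen.step (κ n)
    have hvi := hsol.variational_inequality hβ hγ h hp (hgen.eps_pos _) ha
    simp only at hvi
    -- Weight and `w` are nonnegative and the competitor lies below `w`, so the term is discarded
    -- without any bound on the weights as the smoothing parameter tends to zero.
    have hint : (∫ x, weight p (ε (κ n)) (w (κ n)) x *
        (w (κ n + 1) x * (a.2 - w (κ n + 1)) x) ∂(space Ω)) ≤ 0 := by
      refine integral_nonpos_of_ae ?_
      filter_upwards [Lp.coeFn_sub a.2 (w (κ n + 1)), hle, ae_nonneg_of_mem_K hT hsol.1]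
        with x hx h1 h2
      rw [hx, Pi.sub_apply]
      exact mul_nonpos_of_nonneg_of_nonpos (weight_nonneg hp.1 _ x)
        (mul_nonpos_of_nonneg_of_nonpos h2 (by linarith))
    have e2 := mul_nonpos_of_nonneg_of_nonpos (show 0 ≤ 2 * γ by positivity) hint
    rw [fderiv_eq_inner_gradient] at hvi
    simp only [he, inner_add_left, inner_sub_left, real_inner_smul_left] at hvi ⊢
    linarith

end

section

/-! ### Stampacchia's lemma with a vanishing error -/

/-- Stampacchia's iteration on the levels `P * (1 - 2^(-j))`. Each fixed `j` involves finitely many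
steps, so for large `n` the error is absorbed and `a n` has decayed geometrically up to level `j`.
As `j` is arbitrary and `a n` is antitone, `a n P` tends to zero, although it need not vanish. -/
theorem stampacchia_vanishing_error {a : ℕ → ℝ → ℝ} {η : ℕ → ℝ} {A C σ κ : ℝ} (hσ : 0 < σ)
    (hκ : σ < κ) (hC : 0 ≤ C) (ha0 : ∀ n M, 0 ≤ a n M) (haA : ∀ n M, a n M ≤ A)
    (hanti : ∀ n, Antitone (a n)) (hη : Tendsto η atTop (𝓝 0))
    (hrec : ∀ n M N, 0 ≤ M → M < N → (N - M) * a n N ^ σ ≤ C * a n M ^ κ + η n) :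
    ∃ P, 0 ≤ P ∧ Tendsto (fun n => a n P) atTop (𝓝 0) := by
  set A' := max A 1 with hA'
  have hA1 : 0 < A' := one_pos.trans_le (le_max_right _ _)
  -- Chosen with `ρ ^ (κ - σ) = 1 / 2`: the superlinear gain then compensates the halving of the
  -- level increments.
  set ρ : ℝ := (1 / 2 : ℝ) ^ (1 / (κ - σ)) with hρ
  have hρ0 : 0 < ρ := by positivity
  have hρ1 : ρ < 1 := Real.rpow_lt_one (by norm_num) (by norm_num)
    (one_div_pos.2 (by linarith))
  have hρκ : ∀ j : ℕ, (ρ ^ j) ^ κ = (ρ ^ j) ^ σ * (1 / 2) ^ j := by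
    intro j
    have : ((1 / 2 : ℝ)) ^ j = (ρ ^ j) ^ (κ - σ) := by
      rw [← Real.rpow_natCast ρ j, ← Real.rpow_mul hρ0.le, mul_comm (j : ℝ),
        Real.rpow_mul hρ0.le, hρ, ← Real.rpow_mul (by norm_num : (0 : ℝ) ≤ 1 / 2),
        one_div_mul_cancel (by linarith), Real.rpow_one, Real.rpow_natCast]
    rw [this, ← Real.rpow_add (by positivity)]; congr 1; ring
  -- Makes the induction step an equality (see `h6`). The extra `1` in `C + 1` pays for `η n`, which
  -- is eventually below `(A' * ρ ^ j) ^ κ`.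
  set P := 2 * (C + 1) * A' ^ (κ - σ) / ρ ^ σ with hP
  have hP0 : 0 < P := by positivity
  set M : ℕ → ℝ := fun j => P * (1 - (1 / 2) ^ j) with hM
  have hM0 : ∀ j, 0 ≤ M j := fun j =>
    mul_nonneg hP0.le (sub_nonneg.2 (pow_le_one₀ (by norm_num) (by norm_num)))
  have hMP : ∀ j, M j ≤ P := fun j => by
    have : 0 ≤ P * (1 / 2) ^ j := by positivity
    simp only [hM]; linarith
  have hMs : ∀ j, M (j + 1) - M j = P * (1 / 2) ^ j / 2 := fun j => by
    simp only [hM, pow_succ]; ring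
  have claim : ∀ j, ∀ᶠ n in atTop, a n (M j) ≤ A' * ρ ^ j := by
    intro j
    induction j with
    | zero =>
      refine Eventually.of_forall fun n => ?_
      rw [pow_zero, mul_one]
      exact (haA n _).trans (le_max_left _ _)
    | succ j ih =>
      have hδ : 0 < (A' * ρ ^ j) ^ κ := by positivity
      filter_upwards [ih, hη.eventually (ge_mem_nhds hδ)] with n h1 h2
      have hlt : M j < M (j + 1) := by
        have : 0 < P * (1 / 2) ^ j / 2 := by positivity
        linarith [hMs j]
      have h3 := hrec n (M j) (M (j + 1)) (hM0 j) hlt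
      rw [hMs] at h3
      have h4 : a n (M j) ^ κ ≤ (A' * ρ ^ j) ^ κ :=
        Real.rpow_le_rpow (ha0 _ _) h1 (by linarith)
      have h5 : P * (1 / 2) ^ j / 2 * a n (M (j + 1)) ^ σ ≤ (C + 1) * (A' * ρ ^ j) ^ κ := by
        have := mul_le_mul_of_nonneg_left h4 hC
        linarith
      have h6 : (C + 1) * (A' * ρ ^ j) ^ κ
          = P * (1 / 2) ^ j / 2 * (A' * ρ ^ (j + 1)) ^ σ := by
        rw [Real.mul_rpow hA1.le (by positivity), hρκ, Real.mul_rpow hA1.le (by positivity),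
          pow_succ, Real.mul_rpow (by positivity) hρ0.le, hP,
          show A' ^ κ = A' ^ (κ - σ) * A' ^ σ by rw [← Real.rpow_add hA1]; congr 1; ring]
        have : ρ ^ σ ≠ 0 := by positivity
        field_simp
      rw [h6] at h5
      have h7 := le_of_mul_le_mul_left h5 (by positivity)
      exact (Real.rpow_le_rpow_iff (ha0 _ _) (by positivity) hσ).1 h7
  refine ⟨P, hP0.le, ?_⟩
  rw [tendsto_order]
  refine ⟨fun x hx => Eventually.of_forall fun n => hx.trans_le (ha0 _ _), fun x hx => ?_⟩
  have hlim : Tendsto (fun j : ℕ => A' * ρ ^ j) atTop (𝓝 0) := by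
    simpa using (tendsto_pow_atTop_nhds_zero_of_lt_one hρ0.le hρ1).const_mul A'
  obtain ⟨j, hj⟩ := (hlim.eventually (gt_mem_nhds hx)).exists
  filter_upwards [claim j] with n hn
  exact ((hanti n (hMP j)).trans hn).trans_lt hj

/-- An upper bound that holds up to sets of vanishing measure passes to weak limits. -/
theorem ae_le_of_weakConv {X : Type*} [MeasurableSpace X] {m : Measure X} [IsFiniteMeasure m]
    {v : ℕ → Lp ℝ 2 m} {v₀ : Lp ℝ 2 m} (hv : WeakConv v v₀) {R M : ℝ} (hM : 0 ≤ M)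
    (hR : ∀ n, ‖v n‖ ≤ R) (hmeas : Tendsto (fun n => m.real {x | M < v n x}) atTop (𝓝 0)) :
    ∀ᵐ x ∂m, v₀ x ≤ M := by
  have hmS : ∀ g : Lp ℝ 2 m, MeasurableSet {x | M < g x} := fun g =>
    measurableSet_lt measurable_const (Lp.stronglyMeasurable g).measurable
  have hind : ∀ (S : Set X) (hS : MeasurableSet S) (g : Lp ℝ 2 m),
      inner ℝ g (indicatorConstLp 2 hS (measure_ne_top m S) (1 : ℝ)) = ∫ x in S, g x ∂m := by
    intro S hS g
    rw [real_inner_comm, L2.inner_indicatorConstLp_one]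
  -- Weak convergence is tested with the indicator of the set that is to be null.
  set S := {x | M < v₀ x} with hSdef
  have hS := hmS v₀
  have h1 : Tendsto (fun n => ∫ x in S, v n x ∂m) atTop (𝓝 (∫ x in S, v₀ x ∂m)) := by
    simpa only [hind] using hv (indicatorConstLp 2 hS (measure_ne_top m S) (1 : ℝ))
  have hint : ∀ g : Lp ℝ 2 m, Integrable g m := fun g => (Lp.memLp g).integrable (by norm_num)
  -- Split at the level `M`: the excess is carried by `{M < v n}`, where Cauchy–Schwarz trades the
  -- small measure against the norm bound.
  have h2 : ∀ n, ∫ x in S, v n x ∂m ≤ M * m.real S + R * √(m.real {x | M < v n x}) := by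
    intro n
    set F := {x | M < v n x}
    have hF := hmS (v n)
    have e1 : ∫ x in F, |v n x| ∂m ≤ R * √(m.real F) := by
      have e0 : ∫ x in F, |v n x| ∂m
          = inner ℝ |v n| (indicatorConstLp 2 hF (measure_ne_top m F) (1 : ℝ)) := by
        rw [hind]
        refine setIntegral_congr_ae hF ?_
        filter_upwards [Lp.coeFn_abs (v n)] with x hx _ using hx.symm
      rw [e0]
      refine (real_inner_le_norm _ _).trans ?_
      rw [norm_indicatorConstLp (by norm_num) (by norm_num), norm_abs_eq_norm]
      simp only [norm_one, one_mul, ENNReal.toReal_ofNat]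
      rw [Real.sqrt_eq_rpow]
      gcongr
      exact hR n
    have e2 : ∫ x in S, v n x ∂m ≤ ∫ x in S, (M + F.indicator (fun x => |v n x|) x) ∂m := by
      refine setIntegral_mono (hint _).integrableOn
        ((integrable_const _).add ((hint _).abs.indicator hF)).integrableOn fun x => ?_
      by_cases hx : x ∈ F
      · simp only [indicator_of_mem hx]; linarith [le_abs_self (v n x)]
      · simp only [indicator_of_notMem hx, add_zero]; exact not_lt.1 hx
    have e3 : ∫ x in S, F.indicator (fun x => |v n x|) x ∂m ≤ ∫ x in F, |v n x| ∂m := by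
      rw [← integral_indicator hF]
      refine setIntegral_le_integral ((hint _).abs.indicator hF) (Eventually.of_forall fun x => ?_)
      exact indicator_nonneg (fun _ _ => abs_nonneg _) x
    rw [integral_add (integrable_const _) ((hint _).abs.indicator hF).integrableOn] at e2
    simp only [integral_const, measureReal_restrict_apply_univ, smul_eq_mul] at e2
    linarith
  have h3 : ∫ x in S, v₀ x ∂m ≤ M * m.real S := by
    have := tendsto_const_nhds (x := M * m.real S) |>.add (hmeas.sqrt.const_mul R)
    simp only [Real.sqrt_zero, mul_zero, add_zero] at this
    exact le_of_tendsto_of_tendsto' h1 this h2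
  have h4 : ∫ x in S, (v₀ x - M) ∂m ≤ 0 := by
    rw [integral_sub (hint _).integrableOn (integrable_const _)]
    simp only [integral_const, measureReal_restrict_apply_univ, smul_eq_mul]
    linarith
  have h5 : ∫ x in S, (v₀ x - M) ∂m = 0 := le_antisymm h4
    (setIntegral_nonneg hS fun x hx => sub_nonneg.2 (le_of_lt hx))
  rw [setIntegral_eq_zero_iff_of_nonneg_ae
    ((ae_restrict_iff' hS).2 (Eventually.of_forall fun x hx => sub_nonneg.2 (le_of_lt hx)))
    ((hint _).sub (integrable_const _)).integrableOn] at h5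
  have h6 := (ae_restrict_iff' hS).1 h5
  filter_upwards [h6] with x hx
  by_contra! hcon
  have := hx hcon
  simp only [Pi.zero_apply] at this
  linarith

end

section

/-! ### Measure-theoretic estimates for truncations -/

section Estimates

variable {X : Type*} [MeasurableSpace X] {m : Measure X}

/-- Hölder with `r` and its conjugate, then Hölder on `S` from the conjugate exponent up to `q`; the
former is at most `q` because `1 / r + 1 / q < 1`. -/
theorem integral_abs_mul_le_of_support [IsFiniteMeasure m] {G ζ : X → ℝ} {r q : ℝ} (hr : 1 < r) (hq : 2 < q)
    (hrq : 1 / r + 2 / q < 1) (hG : MemLp G (ENNReal.ofReal r) m)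
    (hζ : MemLp ζ (ENNReal.ofReal q) m) {S : Set X}
    (hsupp : ∀ x ∉ S, ζ x = 0) :
    ∫ x, |G x * ζ x| ∂m ≤ (eLpNorm G (ENNReal.ofReal r) m).toReal
      * (eLpNorm ζ (ENNReal.ofReal q) m).toReal * m.real S ^ (1 - 1 / r - 1 / q) := by
  have hr0 : 0 < r := by linarith
  have hq0 : 0 < q := by linarith
  set r' := r / (r - 1) with hr'
  have hconj : r.HolderConjugate r' := Real.HolderConjugate.conjExponent hr
  have hr'0 : 0 < r' := hconj.symm.pos
  have hinv : 1 / r' = 1 - 1 / r := by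
    have := hconj.inv_add_inv_eq_one
    simp only [one_div]; linarith
  have hle : r' ≤ q := by
    rw [← one_div_le_one_div hq0 hr'0, hinv]
    have : 1 / q ≤ 2 / q := by gcongr; norm_num
    linarith
  have hT : ENNReal.HolderTriple (ENNReal.ofReal r) (ENNReal.ofReal r') 1 :=
    ⟨by
      rw [← ENNReal.ofReal_inv_of_pos hr0, ← ENNReal.ofReal_inv_of_pos hr'0,
        ← ENNReal.ofReal_add (by positivity) (by positivity), hconj.inv_add_inv_eq_one]
      simp⟩
  have h1 : eLpNorm (G • ζ) 1 (m.restrict S) ≤ eLpNorm G (ENNReal.ofReal r) m *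
      (eLpNorm ζ (ENNReal.ofReal q) m * m S ^ (1 - 1 / r - 1 / q)) := by
    refine (eLpNorm_smul_le_mul_eLpNorm (hpqr := hT) hζ.1.restrict hG.1.restrict).trans ?_
    refine mul_le_mul' (eLpNorm_mono_measure _ Measure.restrict_le_self) ?_
    have := eLpNorm_le_eLpNorm_mul_rpow_measure_univ (ENNReal.ofReal_le_ofReal hle)
      (hζ.1.restrict (s := S))
    rw [ENNReal.toReal_ofReal hr'0.le, ENNReal.toReal_ofReal hq0.le, hinv,
      Measure.restrict_apply_univ] at this
    exact this.trans (mul_le_mul' (eLpNorm_mono_measure _ Measure.restrict_le_self) le_rfl)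
  have hrhs : eLpNorm G (ENNReal.ofReal r) m *
      (eLpNorm ζ (ENNReal.ofReal q) m * m S ^ (1 - 1 / r - 1 / q)) ≠ ⊤ := by
    refine ENNReal.mul_ne_top hG.eLpNorm_ne_top (ENNReal.mul_ne_top hζ.eLpNorm_ne_top ?_)
    refine ENNReal.rpow_ne_top_of_nonneg ?_ (measure_ne_top m S)
    have : 1 / q ≤ 2 / q := by gcongr; norm_num
    linarith
  have h2 : ∫ x, |G x * ζ x| ∂m = (eLpNorm (G • ζ) 1 (m.restrict S)).toReal := by
    have e1 : ∫ x, |G x * ζ x| ∂m = ∫ x in S, ‖(G • ζ) x‖ ∂m := by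
      rw [setIntegral_eq_integral_of_forall_compl_eq_zero fun x hx => by simp [hsupp x hx]]
      rfl
    rw [e1, integral_norm_eq_lintegral_enorm (hG.1.smul hζ.1).restrict,
      eLpNorm_one_eq_lintegral_enorm]
  rw [h2]
  refine (ENNReal.toReal_mono hrhs h1).trans (le_of_eq ?_)
  rw [ENNReal.toReal_mul, ENNReal.toReal_mul, ← ENNReal.toReal_rpow, mul_assoc]
  rfl

/-- Chebyshev's inequality in `L^q`. -/
theorem mul_measureReal_rpow_le {ζ : X → ℝ} {q : ℝ} (hq : 0 < q)
    (hζ : MemLp ζ (ENNReal.ofReal q) m) {F : Set X} (hF : MeasurableSet F) {c : ℝ} (hc : 0 ≤ c)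
    (hle : ∀ᵐ x ∂m, x ∈ F → c ≤ |ζ x|) :
    c * m.real F ^ (1 / q) ≤ (eLpNorm ζ (ENNReal.ofReal q) m).toReal := by
  have h1 : eLpNorm (F.indicator fun _ => c) (ENNReal.ofReal q) m
      ≤ eLpNorm ζ (ENNReal.ofReal q) m := by
    refine eLpNorm_mono_ae ?_
    filter_upwards [hle] with x hx
    by_cases hxF : x ∈ F
    · simpa [hxF, abs_of_nonneg hc] using hx hxF
    · simp [hxF]
  rw [eLpNorm_indicator_const hF (by simpa using hq) (by simp)] at h1
  have h2 := ENNReal.toReal_mono hζ.eLpNorm_ne_top h1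
  rw [ENNReal.toReal_mul, ← ENNReal.toReal_rpow, ENNReal.toReal_ofReal hq.le] at h2
  simpa [abs_of_nonneg hc, Measure.real] using h2

end Estimates

variable {d : ℕ} {Ω : Set (E d)} {T s p α β γ : ℝ} {kind : Kind} {f : U T Ω → ℝ} {b L : ℝ}
  {ε : ℕ → ℝ} {u : ℕ → U T Ω} {w : ℕ → L2 Ω} {Lk : ℕ → ℝ}

/-- On a finite measure space `L^q` embeds into `L²`, so the assumed embedding yields coercivity for
all four spaces at once, with no separate Poincaré inequality. -/
theorem EmbedsInLq.exists_coercive [IsFiniteMeasure (space Ω)] {q : ℝ} (hq : 2 < q)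
    (h : ClosedForm (W kind Ω s) (innerW kind Ω s)) (hemb : EmbedsInLq kind Ω s q) :
    ∃ c > 0, ∀ v ∈ W kind Ω s, c * ‖v‖ ^ 2 ≤ innerW kind Ω s v v := by
  obtain ⟨C, hC⟩ := hemb
  have hq0 : 0 < q := by linarith
  set κ := (space Ω univ ^ (1 / (2 : ℝ≥0∞).toReal - 1 / (ENNReal.ofReal q).toReal)) with hκ
  have hκt : κ ≠ ⊤ := by
    refine ENNReal.rpow_ne_top_of_nonneg ?_ (measure_ne_top _ _)
    rw [ENNReal.toReal_ofReal hq0.le, ENNReal.toReal_ofNat, sub_nonneg]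
    exact one_div_le_one_div_of_le (by norm_num) hq.le
  set D := |C| * κ.toReal with hD
  refine ⟨1 / (D ^ 2 + 1), by positivity, fun v hv => ?_⟩
  have h1 : eLpNorm v 2 (space Ω) ≤ ENNReal.ofReal (|C| * normW kind Ω s v) * κ := by
    have h2q : (2 : ℝ≥0∞) ≤ ENNReal.ofReal q := by
      rw [← ENNReal.ofReal_ofNat 2]; exact ENNReal.ofReal_le_ofReal hq.le
    refine (eLpNorm_le_eLpNorm_mul_rpow_measure_univ h2q (Lp.aestronglyMeasurable v)).trans ?_
    refine mul_le_mul' ((hC v hv).trans (ENNReal.ofReal_le_ofReal ?_)) le_rfl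
    exact mul_le_mul_of_nonneg_right (le_abs_self C) (Real.sqrt_nonneg _)
  have h2 : ‖v‖ ≤ D * normW kind Ω s v := by
    rw [Lp.norm_def]
    refine (ENNReal.toReal_mono (ENNReal.mul_ne_top ENNReal.ofReal_ne_top hκt) h1).trans ?_
    rw [ENNReal.toReal_mul, ENNReal.toReal_ofReal
      (mul_nonneg (abs_nonneg _) (show 0 ≤ normW kind Ω s v from Real.sqrt_nonneg _)), hD]
    linarith
  have h3 : ‖v‖ ^ 2 ≤ D ^ 2 * innerW kind Ω s v v := by
    rw [← normW_sq h hv, ← mul_pow]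
    gcongr
  have h4 := h.nonneg v hv
  rw [one_div, inv_mul_le_iff₀ (by positivity)]
  linarith

/-- Truncation at nonnegative levels operates on the form domain. -/
def TruncatesForm (Ω : Set (E d)) (V : Set (L2 Ω)) (B : L2 Ω → L2 Ω → ℝ) : Prop :=
  ∀ w ∈ V, ∀ M : ℝ, 0 ≤ M → ∃ v ∈ V, (∀ᵐ x ∂(space Ω), v x = min (w x) M) ∧ 0 ≤ B v (w - v)

/-- The bound on `v` does not depend on time, so Fubini leaves only the `L¹` norm of `g` in time.
This is why the regularity assumption has its form. -/
theorem integral_cyl_abs_mul_le {g : U T Ω} {ζ : L2 Ω} {v : U T Ω}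
    (hv : ∀ᵐ z ∂(cyl T Ω), |v z| ≤ ζ z.2) :
    |inner ℝ g v| ≤ ∫ x, |(∫ t in Ioo 0 T, |g (t, x)|) * ζ x| ∂(space Ω) := by
  have hζ : MemLp (fun z : ℝ × E d => ζ z.2) 2 (cyl T Ω) := (Lp.memLp ζ).comp_snd _
  have hint : Integrable (fun z : ℝ × E d => |g z| * |ζ z.2|) (cyl T Ω) :=
    (Lp.memLp g).abs.integrable_mul hζ.abs
  have h1 : |inner ℝ g v| ≤ ∫ z, |g z| * |ζ z.2| ∂(cyl T Ω) := by
    rw [L2.inner_def, ← Real.norm_eq_abs]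
    refine (norm_integral_le_integral_norm _).trans ?_
    refine integral_mono_ae (L2.integrable_inner g v).norm hint ?_
    filter_upwards [hv] with z hz
    simp only [RCLike.inner_apply, conj_trivial, norm_mul, Real.norm_eq_abs]
    rw [mul_comm]
    exact mul_le_mul_of_nonneg_left (hz.trans (le_abs_self _)) (abs_nonneg _)
  refine h1.trans (le_of_eq ?_)
  rw [integral_prod_symm _ hint]
  congr 1; ext x
  simp only
  rw [integral_mul_const, abs_mul, abs_of_nonneg (integral_nonneg fun t => abs_nonneg _)]

/-- The truncated iterates. -/
theorem exists_truncation_mem_K {M : ℝ} (hM : 0 ≤ M) {u : U T Ω} {w v : L2 Ω}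
    (huw : (u, w) ∈ K kind T Ω s) (hv : v ∈ W kind Ω s)
    (hvw : ∀ᵐ x ∂(space Ω), v x = min (w x) M) :
    ∃ u' : U T Ω, (u', v) ∈ K kind T Ω s ∧ inner ℝ u (u' - u) ≤ 0 ∧ ‖u' - u‖ ≤ ‖u‖ ∧
      ∀ᵐ z ∂(cyl T Ω), |(u' - u) z| ≤ (w - v) z.2 := by
  have hmem : MemLp (fun z => max (-M) (min (u z) M)) 2 (cyl T Ω) := by
    refine (Lp.memLp u).mono ?_ (Eventually.of_forall fun z => ?_)
    · exact aestronglyMeasurable_const.sup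
        ((Lp.aestronglyMeasurable u).inf aestronglyMeasurable_const)
    · simp only [Real.norm_eq_abs]
      rcases le_total 0 (u z) with h | h
      · rw [abs_of_nonneg h, max_eq_right (by linarith [le_min h hM]),
          abs_of_nonneg (le_min h hM)]
        exact min_le_left _ _
      · rw [abs_of_nonpos h, min_eq_left (h.trans hM), abs_of_nonpos (max_le (by linarith) h)]
        exact neg_le_neg (le_max_right _ _)
  set u' := hmem.toLp with hu'
  have hcoe : ∀ᵐ z ∂(cyl T Ω), u' z = max (-M) (min (u z) M) := hmem.coeFn_toLp
  have hdiff : ∀ᵐ z ∂(cyl T Ω), (u' - u) z = max (-M) (min (u z) M) - u z := by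
    filter_upwards [hcoe, Lp.coeFn_sub u' u] with z h1 h2
    rw [h2, Pi.sub_apply, h1]
  -- The last identity says that clipping removes `(|a| - M)⁺`, which is monotone in `|a|`; hence
  -- `|u| ≤ w` bounds the removed part of `u` by that of `w`.
  have hpt : ∀ a : ℝ, a * (max (-M) (min a M) - a) ≤ 0 ∧ |max (-M) (min a M) - a| ≤ |a| ∧
      |max (-M) (min a M)| ≤ min |a| M ∧ |max (-M) (min a M) - a| = |a| - min |a| M := by
    intro a
    rcases le_total a M with h1 | h1 <;> rcases le_total (-M) a with h2 | h2
    · have : |a| ≤ M := abs_le.2 ⟨h2, h1⟩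
      simp [h1, h2, this]
    · rw [min_eq_left h1, max_eq_left h2, abs_of_nonpos (show a ≤ 0 by linarith),
        min_eq_right (by linarith), abs_neg, abs_of_nonneg hM,
        abs_of_nonneg (show 0 ≤ -M - a by linarith)]
      exact ⟨mul_nonpos_of_nonpos_of_nonneg (by linarith) (by linarith), by linarith, le_rfl,
        by ring⟩
    · rw [min_eq_right h1, max_eq_right (by linarith), abs_of_nonneg (show 0 ≤ a by linarith),
        min_eq_right h1, abs_of_nonneg hM, abs_of_nonpos (show M - a ≤ 0 by linarith)]
      exact ⟨mul_nonpos_of_nonneg_of_nonpos (by linarith) (by linarith), by linarith, le_rfl,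
        by ring⟩
    · have : a = M := by linarith
      have : M = 0 := by linarith
      simp_all
  refine ⟨u', ⟨hv, ?_⟩, ?_, ?_, ?_⟩
  · filter_upwards [hcoe, ae_cyl_of_ae hvw, huw.2] with z h1 h2 h3
    rw [h1, h2]
    exact (hpt (u z)).2.2.1.trans (min_le_min h3 le_rfl)
  · rw [L2.inner_def]
    refine integral_nonpos_of_ae ?_
    filter_upwards [hdiff] with z hz
    simp only [RCLike.inner_apply, conj_trivial, hz, Pi.zero_apply]
    rw [mul_comm]
    exact (hpt (u z)).1
  · refine Lp.norm_le_norm_of_ae_le ?_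
    filter_upwards [hdiff] with z hz
    rw [hz]
    exact (hpt (u z)).2.1
  · filter_upwards [hdiff, ae_cyl_of_ae hvw, ae_cyl_of_ae (Lp.coeFn_sub w v), huw.2]
      with z h1 h2 h3 h4
    rw [h1, h3, Pi.sub_apply, h2, (hpt (u z)).2.2.2]
    rcases le_total |u z| M with h5 | h5
    · rw [min_eq_left h5, sub_self]
      exact sub_nonneg.2 (min_le_left _ _)
    · rw [min_eq_right h5, min_eq_right (h5.trans h4)]
      linarith

theorem le_of_sq_le_add {S a θ : ℝ} (ha : 0 ≤ a) (hθ : 0 ≤ θ) (h : S ^ 2 ≤ a * S + θ) :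
    S ≤ a + √θ := by
  have h1 := Real.sq_sqrt hθ
  have h2 := Real.sqrt_nonneg θ
  by_contra! hcon
  nlinarith

/-- Boundedness of weak limit points, given the structure of the form of `W`. -/
theorem memLp_top_of_truncatesForm [IsFiniteMeasure (space Ω)] (hT : 0 < T)
    (hα : 0 < α) (hβ : 0 < β) (hγ : 0 < γ)
    (h : ClosedForm (W kind Ω s) (innerW kind Ω s))
    (htr : TruncatesForm Ω (W kind Ω s) (innerW kind Ω s))
    (hp : p ∈ Ioo (0 : ℝ) 1) (hf : ObjectiveAssumptions f)
    (hgen : IsGenerated kind T Ω s p α β γ f b L ε u w Lk) {ubar : U T Ω} {wbar : L2 Ω}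
    (hlim : IsWeakLimitPoint kind T Ω s u w ubar wbar)
    {r q : ℝ} (hr : 1 < r) (hq : 2 < q) (hrq : 1 / r + 2 / q < 1)
    (hemb : EmbedsInLq kind Ω s q)
    (hreg : MemLp (fun x => ∫ t in Ioo 0 T, |(gradient f ubar) (t, x)|)
      (ENNReal.ofReal r) (space Ω)) :
    MemLp wbar ⊤ (space Ω) ∧ MemLp ubar ⊤ (cyl T Ω) := by
  obtain ⟨c, hc, hcoer⟩ := hemb.exists_coercive hq h
  obtain ⟨R, v, z, e, hv, hz, hK, hvR, hzR, he, hineq⟩ :=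
    hgen.exists_limit_inequality hT hα hβ hγ h hc hcoer hp hf hlim
  obtain ⟨C₀, hC₀⟩ := hemb
  set C := |C₀| with hC
  have hC0 : 0 ≤ C := abs_nonneg _
  set G : E d → ℝ := fun x => ∫ t in Ioo 0 T, |(gradient f ubar) (t, x)| with hG
  set Γ := (eLpNorm G (ENNReal.ofReal r) (space Ω)).toReal with hΓ
  have hΓ0 : 0 ≤ Γ := ENNReal.toReal_nonneg
  have hR0 : 0 ≤ R := (norm_nonneg _).trans (hvR 0)
  have hq0 : 0 < q := by linarith
  set κ := 1 - 1 / r - 1 / q with hκ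
  -- The only place where the full strength of `1 / r + 2 / q < 1` is needed: it makes the recursion
  -- superlinear.
  have hκq : 1 / q < κ := by
    have : 2 / q = 1 / q + 1 / q := by ring
    linarith
  set a : ℕ → ℝ → ℝ := fun n M => (space Ω).real {x | M < z n x} with ha
  have hmeas : ∀ n M, MeasurableSet {x | M < z n x} := fun n M =>
    measurableSet_lt measurable_const (Lp.stronglyMeasurable (z n)).measurable
  have hrec : ∀ n M N, 0 ≤ M → M < N → (N - M) * a n N ^ (1 / q)
      ≤ C * (Γ * C / β) * a n M ^ κ + C * √(‖e n‖ * R / β) := by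
    intro n M N hM hMN
    obtain ⟨t, ht, htw, htB⟩ := htr (z n) (hz.1 n) M hM
    obtain ⟨u', hu'K, hu'1, hu'2, hu'3⟩ := exists_truncation_mem_K hM (hK n) ht htw
    have hle : ∀ᵐ x ∂(space Ω), t x ≤ z n x := by
      filter_upwards [htw] with x hx
      rw [hx]; exact min_le_left _ _
    have h1 := hineq n (u', t) hu'K hle
    simp only at h1
    set ζ := z n - t with hζ
    have hζW : ζ ∈ W kind Ω s := h.sub_mem (hz.1 n) ht
    have hζx : ∀ᵐ x ∂(space Ω), ζ x = z n x - min (z n x) M := by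
      filter_upwards [htw, Lp.coeFn_sub (z n) t] with x h1 h2
      rw [h2, Pi.sub_apply, h1]
    -- Write `z n = t + ζ`; the cross term has the sign supplied by `TruncatesForm`.
    have hB : innerW kind Ω s (z n) (t - z n) ≤ - innerW kind Ω s ζ ζ := by
      have e1 : t - z n = (-1 : ℝ) • ζ := by rw [hζ]; module
      have e2 : z n = t + ζ := by rw [hζ]; abel
      rw [e1, h.smul_right _ hζW (hz.1 n)]
      nth_rewrite 1 [e2]
      rw [h.add_left _ ht _ hζW _ hζW]
      linarith
    set S := normW kind Ω s ζ with hS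
    have hS0 : 0 ≤ S := Real.sqrt_nonneg _
    have hSsq : S ^ 2 = innerW kind Ω s ζ ζ := normW_sq h hζW
    have hζq : eLpNorm ζ (ENNReal.ofReal q) (space Ω) ≤ ENNReal.ofReal (C * S) :=
      (hC₀ ζ hζW).trans (ENNReal.ofReal_le_ofReal
        (mul_le_mul_of_nonneg_right (le_abs_self _) hS0))
    have hζL : MemLp ζ (ENNReal.ofReal q) (space Ω) :=
      ⟨Lp.aestronglyMeasurable ζ, hζq.trans_lt ENNReal.ofReal_lt_top⟩
    have hζr : (eLpNorm ζ (ENNReal.ofReal q) (space Ω)).toReal ≤ C * S := by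
      have := ENNReal.toReal_mono ENNReal.ofReal_ne_top hζq
      rwa [ENNReal.toReal_ofReal (mul_nonneg hC0 hS0)] at this
    have h2 : inner ℝ (gradient f ubar) (u' - v n) ≤ Γ * (C * S) * a n M ^ κ := by
      refine (le_abs_self _).trans ((integral_cyl_abs_mul_le hu'3).trans ?_)
      -- A representative vanishing at every point outside `{M < z n}`, as the support hypothesis of
      -- the Hölder estimate requires.
      set ζ' : E d → ℝ := fun x => z n x - min (z n x) M with hζ'
      have hae : ⇑ζ =ᵐ[space Ω] ζ' := hζx
      have e1 : ∫ x, |(∫ t in Ioo 0 T, |(gradient f ubar) (t, x)|) * ζ x| ∂(space Ω)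
          = ∫ x, |G x * ζ' x| ∂(space Ω) := by
        refine integral_congr_ae ?_
        filter_upwards [hae] with x hx
        rw [hx]
      rw [e1]
      refine (integral_abs_mul_le_of_support hr hq hrq hreg (hζL.ae_eq hae)
        (S := {x | M < z n x}) (fun x hx => ?_)).trans ?_
      · have hx' : z n x ≤ M := not_lt.1 hx
        simp [hζ', min_eq_left hx']
      · rw [← eLpNorm_congr_ae hae]
        refine mul_le_mul_of_nonneg_right (mul_le_mul_of_nonneg_left hζr hΓ0) ?_
        exact Real.rpow_nonneg measureReal_nonneg _
    have h3 : inner ℝ (e n) (u' - v n) ≤ ‖e n‖ * R :=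
      (real_inner_le_norm _ _).trans
        (mul_le_mul_of_nonneg_left (hu'2.trans (hvR n)) (norm_nonneg _))
    have h4 : S ^ 2 ≤ (Γ * C / β * a n M ^ κ) * S + ‖e n‖ * R / β := by
      have h5 := mul_nonpos_of_nonneg_of_nonpos hα.le hu'1
      have h6 := mul_le_mul_of_nonneg_left hB hβ.le
      have h7 : β * S ^ 2 ≤ Γ * (C * S) * a n M ^ κ + ‖e n‖ * R := by
        rw [hSsq]; linarith
      have h8 : (Γ * C / β * a n M ^ κ) * S + ‖e n‖ * R / β
          = (Γ * (C * S) * a n M ^ κ + ‖e n‖ * R) / β := by field_simp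
      rw [h8, le_div_iff₀ hβ]; linarith
    have hanM : 0 ≤ a n M ^ κ := Real.rpow_nonneg measureReal_nonneg _
    have h5 := le_of_sq_le_add (mul_nonneg (by positivity) hanM) (by positivity) h4
    have h6 : (N - M) * a n N ^ (1 / q) ≤ C * S := by
      refine le_trans ?_ hζr
      refine mul_measureReal_rpow_le hq0 hζL (hmeas n N) (by linarith) ?_
      filter_upwards [hζx] with x hx hxN
      rw [hx]
      have hxN' : N < z n x := hxN
      rw [min_eq_right (by linarith)]
      exact (by linarith : N - M ≤ z n x - M).trans (le_abs_self _)
    refine h6.trans ((mul_le_mul_of_nonneg_left h5 hC0).trans (le_of_eq ?_))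
    ring
  have hη : Tendsto (fun n => C * √(‖e n‖ * R / β)) atTop (𝓝 0) := by
    have := (((he.mul_const R).div_const β).sqrt).const_mul C
    simpa using this
  obtain ⟨P, hP0, hP⟩ := stampacchia_vanishing_error (a := a) (A := (space Ω).real univ)
    (σ := 1 / q) (κ := κ) (C := C * (Γ * C / β)) (by positivity) hκq (by positivity)
    (fun n M => measureReal_nonneg) (fun n M => measureReal_mono (subset_univ _))
    (fun n M N hMN => measureReal_mono fun x hx => lt_of_le_of_lt hMN hx) hη hrec
  -- Weak convergence is given against the inner product of `W`; Riesz representation of `L²`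
  -- functionals converts it into weak convergence in `L²`.
  have hzw : WeakConv z wbar := by
    intro g
    obtain ⟨y, hy, hyg⟩ := h.exists_riesz hc hcoer g
    have := hz.2.2 y hy
    rw [hyg _ hz.2.1] at this
    exact this.congr fun n => hyg _ (hz.1 n)
  have hznorm : ∀ n, ‖z n‖ ≤ √(R / c) := fun n => by
    refine Real.le_sqrt_of_sq_le ?_
    rw [le_div_iff₀ hc]
    linarith [hcoer _ (hz.1 n), hzR n]
  have hw_le : ∀ᵐ x ∂(space Ω), wbar x ≤ P := ae_le_of_weakConv hzw hP0 hznorm hP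
  have hw_ge : ∀ᵐ x ∂(space Ω), -wbar x ≤ 0 := by
    have hneg : WeakConv (fun n => -z n) (-wbar) := fun g => by
      simpa only [inner_neg_left] using (hzw g).neg
    have := ae_le_of_weakConv hneg le_rfl (R := √(R / c)) (fun n => by simpa using hznorm n)
      (by
        refine tendsto_const_nhds.congr fun n => ?_
        symm
        rw [measureReal_eq_zero_iff]
        refine (ae_iff (p := fun x => ¬ 0 < (-z n) x)).1 ?_ |> fun h => by simpa using h
        filter_upwards [ae_nonneg_of_mem_K hT (hK n), Lp.coeFn_neg (z n)] with x h1 h2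
        rw [h2, Pi.neg_apply]; linarith)
    filter_upwards [this, Lp.coeFn_neg wbar] with x h1 h2
    rwa [h2, Pi.neg_apply] at h1
  -- Where a control exceeds `P`, so does `z n` at the same point of `Ω`; the exceptional set lies
  -- over `{P < z n}` and costs only the factor `T`.
  have hcyl : ∀ v' : ℕ → U T Ω, (∀ n, ∀ᵐ y ∂(cyl T Ω), v' n y ≤ z n y.2) →
      Tendsto (fun n => (cyl T Ω).real {y | P < v' n y}) atTop (𝓝 0) := by
    intro v' hv'
    refine squeeze_zero (fun n => measureReal_nonneg) (fun n => ?_)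
      (by simpa using hP.const_mul T)
    have h1 : (cyl T Ω) {y | P < v' n y} ≤ (cyl T Ω) (univ ×ˢ {x | P < z n x}) := by
      refine measure_mono_ae ?_
      filter_upwards [hv' n] with y hy hlt
      exact ⟨mem_univ _, lt_of_lt_of_le hlt hy⟩
    have h2 := ENNReal.toReal_mono (measure_ne_top _ _) h1
    refine h2.trans (le_of_eq ?_)
    rw [Measure.prod_prod, ENNReal.toReal_mul]
    simp [hT.le, ha, Measure.real]
  have hu_le : ∀ᵐ y ∂(cyl T Ω), ubar y ≤ P :=
    ae_le_of_weakConv hv hP0 hvR (hcyl v fun n => by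
      filter_upwards [(hK n).2] with y hy using (le_abs_self _).trans hy)
  have hu_ge : ∀ᵐ y ∂(cyl T Ω), -ubar y ≤ P := by
    have hneg : WeakConv (fun n => -v n) (-ubar) := fun g => by
      simpa only [inner_neg_left] using (hv g).neg
    have := ae_le_of_weakConv hneg hP0 (fun n => by simpa using hvR n) (hcyl _ fun n => by
      filter_upwards [(hK n).2, Lp.coeFn_neg (v n)] with y hy h2
      rw [h2, Pi.neg_apply]
      exact (neg_le_abs _).trans hy)
    filter_upwards [this, Lp.coeFn_neg ubar] with x h1 h2
    rwa [h2, Pi.neg_apply] at h1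
  constructor
  · refine memLp_top_of_bound (Lp.aestronglyMeasurable wbar) P ?_
    filter_upwards [hw_le, hw_ge] with x h1 h2
    rw [Real.norm_eq_abs, abs_of_nonneg (by linarith)]; exact h1
  · refine memLp_top_of_bound (Lp.aestronglyMeasurable ubar) P ?_
    filter_upwards [hu_le, hu_ge] with x h1 h2
    rw [Real.norm_eq_abs]; exact abs_le.2 ⟨by linarith, h1⟩

end

section

/-! ### The Sobolev–Slobodeckij form -/

theorem fracConst_pos (d : ℕ) {s : ℝ} (hs : s ∈ Ioo (0 : ℝ) 1) : 0 < fracConst d s := by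
  have h0 := hs.1
  have h1 : 0 < 1 - s := by linarith [hs.2]
  have h2 : 0 < s + d / 2 := by positivity
  have := Real.Gamma_pos_of_pos h1
  have := Real.Gamma_pos_of_pos h2
  unfold fracConst
  positivity

/-- Pulling back a closed form along a continuous linear map. -/
theorem ClosedForm.comap {H H' : Type*} [NormedAddCommGroup H] [InnerProductSpace ℝ H]
    [NormedAddCommGroup H'] [InnerProductSpace ℝ H'] {V : Set H'} {B : H' → H' → ℝ}
    (h : ClosedForm V B) (J : H →L[ℝ] H') : ClosedForm (J ⁻¹' V) (fun u v => B (J u) (J v)) where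
  zero_mem := by simpa using h.zero_mem
  add_mem u hu v hv := by simpa using h.add_mem _ hu _ hv
  smul_mem c u hu := by simpa using h.smul_mem c _ hu
  symm u hu v hv := h.symm _ hu _ hv
  add_left u hu v hv z hz := by simpa using h.add_left _ hu _ hv _ hz
  smul_left c u hu z hz := by simpa using h.smul_left c _ hu _ hz
  nonneg u hu := h.nonneg _ hu
  lsc w wbar c hw hc hlim := h.lsc _ _ c hw hc ((J.continuous.tendsto _).comp hlim)

section Truncation

variable {X : Type*} [MeasurableSpace X] {m : Measure X}

theorem exists_trunc (w : Lp ℝ 2 m) {M : ℝ} (hM : 0 ≤ M) :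
    ∃ v : Lp ℝ 2 m, ∀ᵐ x ∂m, v x = min (w x) M := by
  have : MemLp (fun x => min (w x) M) 2 m := by
    refine (Lp.memLp w).mono ((Lp.aestronglyMeasurable w).inf aestronglyMeasurable_const)
      (Eventually.of_forall fun x => ?_)
    simp only [Real.norm_eq_abs]
    rcases le_total (w x) M with h | h
    · rw [min_eq_left h]
    · rw [min_eq_right h, abs_of_nonneg hM]; exact h.trans (le_abs_self _)
  exact ⟨this.toLp, this.coeFn_toLp⟩

end Truncation

variable {d : ℕ} {D : Set (E d)} {s : ℝ}

/-- The weighted difference quotient of the Sobolev–Slobodeckij seminorm. -/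
def diffQuot (s : ℝ) (w : E d → ℝ) (z : E d × E d) : ℝ :=
  (w z.1 - w z.2) / ‖z.1 - z.2‖ ^ ((d : ℝ) / 2 + s)

/-- Lebesgue measure on `D × D`. -/
abbrev pairs (D : Set (E d)) : Measure (E d × E d) := (space D).prod (space D)

theorem ae_pairs_fst {P : E d → Prop} (h : ∀ᵐ x ∂(space D), P x) : ∀ᵐ z ∂(pairs D), P z.1 :=
  Measure.quasiMeasurePreserving_fst.ae h

theorem ae_pairs_snd {P : E d → Prop} (h : ∀ᵐ x ∂(space D), P x) : ∀ᵐ z ∂(pairs D), P z.2 :=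
  Measure.quasiMeasurePreserving_snd.ae h

theorem diffQuot_congr {u w : E d → ℝ} (h : u =ᵐ[space D] w) :
    diffQuot s u =ᵐ[pairs D] diffQuot s w := by
  filter_upwards [ae_pairs_fst h, ae_pairs_snd h] with z h1 h2
  simp [diffQuot, h1, h2]

theorem aestronglyMeasurable_diffQuot {w : E d → ℝ} (hw : AEStronglyMeasurable w (space D)) :
    AEStronglyMeasurable (diffQuot s w) (pairs D) := by
  have h : Measurable fun z : E d × E d => ‖z.1 - z.2‖ ^ ((d : ℝ) / 2 + s) := by fun_prop
  exact ((hw.comp_fst.sub hw.comp_snd).aemeasurable.div h.aemeasurable).aestronglyMeasurable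

theorem memHs_iff {w : E d → ℝ} :
    MemHs D s w ↔ MemLp w 2 (space D) ∧ MemLp (diffQuot s w) 2 (pairs D) := by
  refine and_congr_right fun hw => ?_
  have hm := aestronglyMeasurable_diffQuot (s := s) hw.1
  have hm' : AEStronglyMeasurable
      (fun z : E d × E d => |w z.1 - w z.2| / ‖z.1 - z.2‖ ^ ((d : ℝ) / 2 + s)) (pairs D) := by
    refine hm.norm.congr (Eventually.of_forall fun z => ?_)
    simp only [diffQuot, norm_div, Real.norm_eq_abs]
    rw [abs_of_nonneg (Real.rpow_nonneg (norm_nonneg _) _)]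
  refine memLp_congr_norm hm' hm (Eventually.of_forall fun z => ?_)
  simp only [diffQuot, norm_div, Real.norm_eq_abs, abs_abs]

/-- The kernel is the square of the weight in `diffQuot`, so the double integral is an `L²` pairing
of difference quotients. -/
theorem hsInner_eq (u w : E d → ℝ) :
    hsInner D s u w = (∫ x, u x * w x ∂(space D)) +
      fracConst d s / 2 * ∫ z, diffQuot s u z * diffQuot s w z ∂(pairs D) := by
  unfold hsInner
  congr 2
  refine integral_congr_ae (Eventually.of_forall fun z => ?_)
  have : ‖z.1 - z.2‖ ^ ((d : ℝ) + 2 * s) = (‖z.1 - z.2‖ ^ ((d : ℝ) / 2 + s)) ^ 2 := by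
    rw [← Real.rpow_mul_natCast (norm_nonneg _)]; congr 1; push_cast; ring
  simp only [diffQuot, this]
  rw [div_mul_div_comm, sq]

theorem memHs_congr {u w : E d → ℝ} (h : u =ᵐ[space D] w) : MemHs D s u ↔ MemHs D s w := by
  rw [memHs_iff, memHs_iff, memLp_congr_ae h, memLp_congr_ae (diffQuot_congr h)]

theorem hsInner_congr {u u' w w' : E d → ℝ} (hu : u =ᵐ[space D] u') (hw : w =ᵐ[space D] w') :
    hsInner D s u w = hsInner D s u' w' := by
  rw [hsInner_eq, hsInner_eq]
  congr 1
  · exact integral_congr_ae (hu.mul hw)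
  · congr 1
    exact integral_congr_ae ((diffQuot_congr hu).mul (diffQuot_congr hw))

theorem diffQuot_add (u w : E d → ℝ) : diffQuot s (u + w) = diffQuot s u + diffQuot s w := by
  ext z; simp only [diffQuot, Pi.add_apply]; ring

theorem diffQuot_smul (c : ℝ) (w : E d → ℝ) : diffQuot s (c • w) = c • diffQuot s w := by
  ext z; simp only [diffQuot, Pi.smul_apply, smul_eq_mul]; ring

theorem MemHs.add {u w : E d → ℝ} (hu : MemHs D s u) (hw : MemHs D s w) : MemHs D s (u + w) := by
  rw [memHs_iff] at *
  exact ⟨hu.1.add hw.1, diffQuot_add (s := s) u w ▸ hu.2.add hw.2⟩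

theorem MemHs.const_smul {w : E d → ℝ} (hw : MemHs D s w) (c : ℝ) : MemHs D s (c • w) := by
  rw [memHs_iff] at *
  exact ⟨hw.1.const_smul c, diffQuot_smul (s := s) c w ▸ hw.2.const_smul c⟩

theorem MemHs.hsInner_self_nonneg (hs : s ∈ Ioo (0 : ℝ) 1) (w : E d → ℝ) :
    0 ≤ hsInner D s w w := by
  rw [hsInner_eq]
  have := fracConst_pos d hs
  exact add_nonneg (integral_nonneg fun x => mul_self_nonneg _)
    (mul_nonneg (by positivity) (integral_nonneg fun x => mul_self_nonneg _))

/-- Contractions operate on `H^s`. -/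
theorem MemHs.of_contraction {u w : E d → ℝ} (hw : MemHs D s w)
    (hu : AEStronglyMeasurable u (space D)) (h1 : ∀ᵐ x ∂(space D), |u x| ≤ |w x|)
    (h2 : ∀ᵐ z ∂(pairs D), |u z.1 - u z.2| ≤ |w z.1 - w z.2|) : MemHs D s u := by
  rw [memHs_iff] at *
  refine ⟨hw.1.mono hu h1, hw.2.mono (aestronglyMeasurable_diffQuot hu) ?_⟩
  filter_upwards [h2] with z hz
  simp only [diffQuot, norm_div, Real.norm_eq_abs]
  gcongr

theorem MemHs.hsInner_le_of_contraction (hs : s ∈ Ioo (0 : ℝ) 1) {u w : E d → ℝ}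
    (hw : MemHs D s w)
    (hu : AEStronglyMeasurable u (space D)) (h1 : ∀ᵐ x ∂(space D), |u x| ≤ |w x|)
    (h2 : ∀ᵐ z ∂(pairs D), |u z.1 - u z.2| ≤ |w z.1 - w z.2|) :
    hsInner D s u u ≤ hsInner D s w w := by
  have hu' := memHs_iff.1 (hw.of_contraction hu h1 h2)
  have hw' := memHs_iff.1 hw
  have := fracConst_pos d hs
  rw [hsInner_eq, hsInner_eq]
  refine add_le_add (integral_mono_ae (hu'.1.integrable_mul hu'.1) (hw'.1.integrable_mul hw'.1) ?_)
    (mul_le_mul_of_nonneg_left (integral_mono_ae (hu'.2.integrable_mul hu'.2)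
      (hw'.2.integrable_mul hw'.2) ?_) (by positivity))
  · filter_upwards [h1] with x hx
    exact abs_le_iff_mul_self_le.1 hx
  · filter_upwards [h2] with z hz
    have : |diffQuot s u z| ≤ |diffQuot s w z| := by
      simp only [diffQuot, abs_div]; gcongr
    exact abs_le_iff_mul_self_le.1 this

/-- `H^s(D)` as a subset of `L²(D)`. -/
def hsDomain (D : Set (E d)) (s : ℝ) : Set (Lp ℝ 2 (space D)) := {w | MemHs D s w}

/-- For lower semicontinuity, the `L²` part converges and is moved to the other side. Fatou's lemma
along an almost everywhere convergent subsequence handles the difference quotients. -/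
theorem closedForm_hs (hs : s ∈ Ioo (0 : ℝ) 1) :
    ClosedForm (hsDomain D s) (fun u w => hsInner D s u w) where
  zero_mem := by
    have h0 : MemHs D s (0 : E d → ℝ) := by
      rw [memHs_iff]
      refine ⟨MemLp.zero, ?_⟩
      have : diffQuot s (0 : E d → ℝ) = 0 := by ext z; simp [diffQuot]
      rw [this]; exact MemLp.zero
    exact (memHs_congr (Lp.coeFn_zero ℝ 2 (space D))).2 h0
  add_mem u hu v hv := (memHs_congr (Lp.coeFn_add u v)).2 (MemHs.add hu hv)
  smul_mem c u hu := (memHs_congr (Lp.coeFn_smul c u)).2 (MemHs.const_smul hu c)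
  symm u _ v _ := by simp only [hsInner_eq, mul_comm]
  add_left u hu v hv z hz := by
    have hu' := memHs_iff.1 hu
    have hv' := memHs_iff.1 hv
    have hz' := memHs_iff.1 hz
    rw [hsInner_congr (Lp.coeFn_add u v) (ae_eq_refl (z : E d → ℝ)), hsInner_eq, hsInner_eq, hsInner_eq,
      diffQuot_add]
    simp only [Pi.add_apply, add_mul]
    have e1 : ∫ x, (u x * z x + v x * z x) ∂(space D) = _ :=
      integral_add (hu'.1.integrable_mul hz'.1) (hv'.1.integrable_mul hz'.1)
    have e2 : ∫ y, (diffQuot s u y * diffQuot s z y + diffQuot s v y * diffQuot s z y) ∂(pairs D)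
        = _ := integral_add (hu'.2.integrable_mul hz'.2) (hv'.2.integrable_mul hz'.2)
    rw [e1, e2]
    ring
  smul_left c u hu z hz := by
    rw [hsInner_congr (Lp.coeFn_smul c u) (ae_eq_refl (z : E d → ℝ)), hsInner_eq, hsInner_eq, diffQuot_smul]
    simp only [Pi.smul_apply, smul_eq_mul, mul_assoc, integral_const_mul]
    ring
  nonneg u _ := MemHs.hsInner_self_nonneg hs _
  lsc w wbar c hw hc hlim := by
    have hk : 0 < fracConst d s / 2 := half_pos (fracConst_pos d hs)
    obtain ⟨φ, hφ, hae⟩ := exists_subseq_tendsto_ae hlim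
    have hsq : ∀ v : Lp ℝ 2 (space D), ∫ x, v x * v x ∂(space D) = ‖v‖ ^ 2 := fun v => by
      rw [← real_inner_self_eq_norm_sq, L2.inner_def]; rfl
    set b : ℕ → ℝ := fun n => (c - ‖w (φ n)‖ ^ 2) / (fracConst d s / 2) with hb
    have hbn : ∀ n, ∫ z, diffQuot s (w (φ n)) z * diffQuot s (w (φ n)) z ∂(pairs D) ≤ b n := by
      intro n
      have := hc (φ n)
      rw [hsInner_eq, hsq] at this
      rw [hb, le_div_iff₀ hk]; linarith
    have hblim : Tendsto b atTop (𝓝 ((c - ‖wbar‖ ^ 2) / (fracConst d s / 2))) :=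
      (tendsto_const_nhds.sub ((hlim.comp hφ.tendsto_atTop).norm.pow 2)).div_const _
    have hb0 : 0 ≤ (c - ‖wbar‖ ^ 2) / (fracConst d s / 2) :=
      ge_of_tendsto' hblim fun n => (integral_nonneg fun z => mul_self_nonneg _).trans (hbn n)
    have hdq : ∀ᵐ z ∂(pairs D), Tendsto (fun n => diffQuot s (w (φ n)) z) atTop
        (𝓝 (diffQuot s wbar z)) := by
      filter_upwards [ae_pairs_fst hae, ae_pairs_snd hae] with z h1 h2
      exact (h1.sub h2).div_const _
    have hwn := fun n => memHs_iff.1 (hw (φ n))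
    have hm := aestronglyMeasurable_diffQuot (s := s) (Lp.aestronglyMeasurable wbar)
    have hfatou : ∫⁻ z, ENNReal.ofReal (diffQuot s wbar z * diffQuot s wbar z) ∂(pairs D)
        ≤ ENNReal.ofReal ((c - ‖wbar‖ ^ 2) / (fracConst d s / 2)) := by
      have e1 : ∫⁻ z, ENNReal.ofReal (diffQuot s wbar z * diffQuot s wbar z) ∂(pairs D)
          = ∫⁻ z, liminf (fun n => ENNReal.ofReal
            (diffQuot s (w (φ n)) z * diffQuot s (w (φ n)) z)) atTop ∂(pairs D) := by
        refine lintegral_congr_ae ?_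
        filter_upwards [hdq] with z hz
        exact ((ENNReal.continuous_ofReal.tendsto _).comp (hz.mul hz)).liminf_eq.symm
      rw [e1]
      refine (lintegral_liminf_le' fun n =>
        ((hwn n).2.1.mul (hwn n).2.1).aemeasurable.ennreal_ofReal).trans ?_
      have e2 : Tendsto (fun n => ENNReal.ofReal (b n)) atTop
          (𝓝 (ENNReal.ofReal ((c - ‖wbar‖ ^ 2) / (fracConst d s / 2)))) :=
        (ENNReal.continuous_ofReal.tendsto _).comp hblim
      rw [← e2.liminf_eq]
      refine liminf_le_liminf (Eventually.of_forall fun n => ?_)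
      change _ ≤ ENNReal.ofReal (b n)
      rw [← ofReal_integral_eq_lintegral_ofReal ((hwn n).2.integrable_mul (hwn n).2)
        (Eventually.of_forall fun z => mul_self_nonneg _)]
      exact ENNReal.ofReal_le_ofReal (hbn n)
    have hint : Integrable (fun z => diffQuot s wbar z * diffQuot s wbar z) (pairs D) := by
      refine ⟨hm.mul hm, ?_⟩
      rw [hasFiniteIntegral_iff_ofReal (Eventually.of_forall fun z => mul_self_nonneg _)]
      exact hfatou.trans_lt ENNReal.ofReal_lt_top
    have hmem : MemHs D s wbar := by
      rw [memHs_iff]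
      refine ⟨Lp.memLp wbar, (memLp_two_iff_integrable_sq hm).2 ?_⟩
      simpa only [sq] using hint
    refine ⟨hmem, ?_⟩
    rw [← ofReal_integral_eq_lintegral_ofReal hint
      (Eventually.of_forall fun z => mul_self_nonneg _), ENNReal.ofReal_le_ofReal_iff hb0,
      le_div_iff₀ hk] at hfatou
    rw [hsInner_eq, hsq]
    linarith

theorem abs_min_sub_min_le (a b M : ℝ) : |min a M - min b M| ≤ |a - b| := by
  simpa using abs_min_sub_min_le_max a M b M

/-- Truncation in `H^s(D)`. -/
theorem hs_truncation (hs : s ∈ Ioo (0 : ℝ) 1) {w v : Lp ℝ 2 (space D)} (hw : w ∈ hsDomain D s)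
    {M : ℝ} (hM : 0 ≤ M) (hv : ∀ᵐ x ∂(space D), v x = min (w x) M) :
    v ∈ hsDomain D s ∧ 0 ≤ hsInner D s v (w - v : Lp ℝ 2 (space D)) := by
  have hvm : v ∈ hsDomain D s := by
    refine MemHs.of_contraction hw (Lp.aestronglyMeasurable v) ?_ ?_
    · filter_upwards [hv] with x hx
      rw [hx]
      simpa [min_eq_left hM] using abs_min_sub_min_le (w x) 0 M
    · filter_upwards [ae_pairs_fst hv, ae_pairs_snd hv] with z h1 h2
      rw [h1, h2]; exact abs_min_sub_min_le _ _ _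
  refine ⟨hvm, ?_⟩
  have hc := fracConst_pos d hs
  have hd : ∀ᵐ x ∂(space D), (w - v : Lp ℝ 2 (space D)) x = w x - min (w x) M := by
    filter_upwards [hv, Lp.coeFn_sub w v] with x h1 h2
    rw [h2, Pi.sub_apply, h1]
  rw [hsInner_eq]
  refine add_nonneg (integral_nonneg_of_ae ?_)
    (mul_nonneg (by positivity) (integral_nonneg_of_ae ?_))
  · filter_upwards [hv, hd] with x h1 h2
    rw [Pi.zero_apply, h1, h2]
    rcases le_total (w x) M with h | h
    · simp [min_eq_left h]
    · rw [min_eq_right h]; exact mul_nonneg hM (sub_nonneg.2 h)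
  · filter_upwards [ae_pairs_fst hv, ae_pairs_snd hv, ae_pairs_fst hd, ae_pairs_snd hd]
      with z h1 h2 h3 h4
    rw [Pi.zero_apply, diffQuot, diffQuot, h1, h2, h3, h4, div_mul_div_comm]
    refine div_nonneg ?_ (mul_self_nonneg _)
    -- Both `min · M` and its complement are nondecreasing, so their increments between two points
    -- have the same sign.
    rcases le_total (w z.1) M with h | h <;> rcases le_total (w z.2) M with h' | h'
    · simp [min_eq_left h, min_eq_left h']
    · rw [min_eq_left h, min_eq_right h']
      exact mul_nonneg_of_nonpos_of_nonpos (by linarith) (by linarith)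
    · rw [min_eq_right h, min_eq_left h']
      exact mul_nonneg (by linarith) (by linarith)
    · simp [min_eq_right h, min_eq_right h']

/-! ### Extension by zero -/

variable {Ω : Set (E d)}

theorem space_univ : space (univ : Set (E d)) = volume := Measure.restrict_univ

theorem exists_extendByZero (hΩ : MeasurableSet Ω) :
    ∃ J : L2 Ω →L[ℝ] Lp ℝ 2 (space (univ : Set (E d))),
      ∀ w, J w =ᵐ[space univ] Ω.indicator w := by
  have hmem : ∀ w : L2 Ω, MemLp (Ω.indicator w) 2 (space (univ : Set (E d))) := fun w => by
    rw [space_univ, memLp_indicator_iff_restrict hΩ]; exact Lp.memLp w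
  have hind : ∀ {u v : E d → ℝ}, u =ᵐ[space Ω] v →
      Ω.indicator u =ᵐ[space (univ : Set (E d))] Ω.indicator v := fun h => by
    rw [space_univ]
    exact (ae_eq_restrict_iff_indicator_ae_eq hΩ).1 h
  let J₀ : L2 Ω →ₗ[ℝ] Lp ℝ 2 (space (univ : Set (E d))) :=
    { toFun := fun w => (hmem w).toLp
      map_add' := fun u v => by
        rw [← MemLp.toLp_add, MemLp.toLp_eq_toLp_iff]
        refine (hind (Lp.coeFn_add u v)).trans ?_
        rw [indicator_add']
      map_smul' := fun c u => by
        rw [RingHom.id_apply, ← MemLp.toLp_const_smul, MemLp.toLp_eq_toLp_iff]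
        refine (hind (Lp.coeFn_smul c u)).trans ?_
        exact (ae_of_all _ fun x => indicator_const_smul_apply Ω c u x) }
  refine ⟨J₀.mkContinuous 1 fun w => ?_, fun w => (hmem w).coeFn_toLp⟩
  rw [one_mul]
  change ‖(hmem w).toLp‖ ≤ ‖w‖
  rw [Lp.norm_toLp, Lp.norm_def, space_univ,
    eLpNorm_indicator_eq_eLpNorm_restrict hΩ]

theorem closedForm_sobolev (hs : s ∈ Ioo (0 : ℝ) 1) :
    ClosedForm (W .sobolev Ω s) (innerW .sobolev Ω s) := closedForm_hs hs

theorem truncatesForm_sobolev (hs : s ∈ Ioo (0 : ℝ) 1) :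
    TruncatesForm Ω (W .sobolev Ω s) (innerW .sobolev Ω s) := by
  intro w hw M hM
  obtain ⟨v, hv⟩ := exists_trunc w hM
  have := hs_truncation hs hw hM hv
  exact ⟨v, this.1, hv, this.2⟩

/-- Pulled back along extension by zero from the form on the whole space. -/
theorem closedForm_tilde (hΩ : MeasurableSet Ω) (hs : s ∈ Ioo (0 : ℝ) 1) :
    ClosedForm (W .tilde Ω s) (innerW .tilde Ω s) := by
  obtain ⟨J, hJ⟩ := exists_extendByZero hΩ
  have h := (closedForm_hs (D := (univ : Set (E d))) hs).comap J
  have e1 : J ⁻¹' hsDomain univ s = W .tilde Ω s := by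
    ext w; exact memHs_congr (hJ w)
  have e2 : (fun u v => hsInner univ s (J u) (J v)) = innerW .tilde Ω s := by
    ext u v; exact hsInner_congr (hJ u) (hJ v)
  rwa [e1, e2] at h

/-- Truncation commutes with extension by zero since `min 0 M = 0` for `M ≥ 0`. -/
theorem truncatesForm_tilde (hΩ : MeasurableSet Ω) (hs : s ∈ Ioo (0 : ℝ) 1) :
    TruncatesForm Ω (W .tilde Ω s) (innerW .tilde Ω s) := by
  obtain ⟨J, hJ⟩ := exists_extendByZero hΩ
  intro w hw M hM
  obtain ⟨v, hv⟩ := exists_trunc w hM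
  have hJv : ∀ᵐ x ∂(space (univ : Set (E d))), J v x = min (J w x) M := by
    have h1 : Ω.indicator v =ᵐ[space (univ : Set (E d))] Ω.indicator (fun x => min (w x) M) := by
      rw [space_univ]
      exact (ae_eq_restrict_iff_indicator_ae_eq hΩ).1 hv
    filter_upwards [hJ v, hJ w, h1] with x h2 h3 h4
    rw [h2, h3, h4]
    by_cases hx : x ∈ Ω
    · simp [hx]
    · simp [hx, hM]
  have := hs_truncation hs (w := J w) (v := J v) ((memHs_congr (hJ w)).2 hw) hM hJv
  refine ⟨v, (memHs_congr (hJ v)).1 this.1, hv, this.2.trans_eq ?_⟩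
  rw [← map_sub]
  exact hsInner_congr (hJ v) (hJ (w - v))

end

section

/-! ### Smooth truncations -/

/-- `η` is a smooth substitute for `x ↦ min x M`, up to an error `δ`. -/
structure IsSmoothTruncation (η : ℝ → ℝ) (M δ : ℝ) : Prop where
  smooth : ContDiff ℝ ((⊤ : ℕ∞) : WithTop ℕ∞) η
  deriv_nonneg : ∀ x, 0 ≤ deriv η x
  deriv_le_one : ∀ x, deriv η x ≤ 1
  eq_self : ∀ x ≤ M, η x = x
  le_of_le : ∀ x, M ≤ x → M ≤ η x
  le_self : ∀ x, η x ≤ x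
  le_add : ∀ x, η x ≤ M + δ

theorem exists_isSmoothTruncation {M δ : ℝ} (hM : 0 ≤ M) (hδ : 0 < δ) :
    ∃ η, IsSmoothTruncation η M δ := by
  -- The derivative of the truncation: `1` up to `M`, `0` from `M + δ` on, so its primitive from `0`
  -- has all required properties.
  set g : ℝ → ℝ := fun t => 1 - Real.smoothTransition ((t - M) / δ) with hg
  have hgs : ContDiff ℝ ((⊤ : ℕ∞) : WithTop ℕ∞) g := by
    refine contDiff_const.sub (Real.smoothTransition.contDiff.comp ?_)
    exact (contDiff_id.sub contDiff_const).div_const δ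
  have hgc : Continuous g := hgs.continuous
  have hg0 : ∀ x, 0 ≤ g x := fun x => sub_nonneg.2 (Real.smoothTransition.le_one _)
  have hg1 : ∀ x, g x ≤ 1 := fun x => by
    have := Real.smoothTransition.nonneg ((x - M) / δ)
    simp only [hg]; linarith
  have hgM : ∀ x ≤ M, g x = 1 := fun x hx => by
    simp only [hg]
    rw [Real.smoothTransition.zero_of_nonpos (div_nonpos_of_nonpos_of_nonneg (by linarith) hδ.le),
      sub_zero]
  have hgδ : ∀ x, M + δ ≤ x → g x = 0 := fun x hx => by
    simp only [hg]
    rw [Real.smoothTransition.one_of_one_le ((one_le_div hδ).2 (by linarith)), sub_self]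
  set η : ℝ → ℝ := fun x => ∫ t in (0 : ℝ)..x, g t with hη
  have hd : ∀ x, HasDerivAt η (g x) x := fun x => (hgc.integral_hasStrictDerivAt 0 x).hasDerivAt
  have hdiff : Differentiable ℝ η := fun x => (hd x).differentiableAt
  have hderiv : deriv η = g := funext fun x => (hd x).deriv
  have hmono : Monotone η := monotone_of_deriv_nonneg hdiff fun x => by rw [hderiv]; exact hg0 x
  have hmono' : Monotone fun x => x - η x := by
    refine monotone_of_deriv_nonneg (differentiable_id.sub hdiff) fun x => ?_
    have := ((hasDerivAt_id x).sub (hd x)).deriv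
    rw [show deriv (fun x => x - η x) x = 1 - g x from this]
    linarith [hg1 x]
  have heq : ∀ x ≤ M, η x = x := by
    intro x hx
    have : ∫ t in (0 : ℝ)..x, g t = ∫ _ in (0 : ℝ)..x, (1 : ℝ) := by
      refine intervalIntegral.integral_congr fun t ht => ?_
      exact hgM t (ht.2.trans (max_le hM hx))
    simp [hη, this]
  have hle : ∀ x, η x ≤ x := by
    intro x
    rcases le_total x M with h | h
    · exact (heq x h).le
    · have := hmono' h
      simp only [heq M le_rfl] at this
      linarith
  refine ⟨η, contDiff_infty_iff_deriv.2 ⟨hdiff, hderiv ▸ hgs⟩, fun x => hderiv ▸ hg0 x,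
    fun x => hderiv ▸ hg1 x, heq, fun x hx => (heq M le_rfl).symm.le.trans (hmono hx), hle,
    fun x => ?_⟩
  rcases le_total x (M + δ) with h | h
  · exact (hle x).trans h
  · have h1 : η x - η (M + δ) = 0 := by
      rw [hη]
      simp only
      rw [intervalIntegral.integral_interval_sub_left (hgc.intervalIntegrable _ _)
        (hgc.intervalIntegrable _ _)]
      rw [intervalIntegral.integral_congr (g := fun _ => (0 : ℝ))]
      · simp
      · intro t ht
        rw [uIcc_of_le h] at ht
        exact hgδ t ht.1
    linarith [hle (M + δ)]

namespace IsSmoothTruncation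

variable {η : ℝ → ℝ} {M δ : ℝ}

theorem abs_sub_le (h : IsSmoothTruncation η M δ) (x y : ℝ) : |η x - η y| ≤ |x - y| := by
  have hd : Differentiable ℝ η := h.smooth.differentiable (by simp)
  have := (convex_univ (𝕜 := ℝ) (E := ℝ)).norm_image_sub_le_of_norm_deriv_le (f := η) (C := 1)
    (fun x _ => hd x) (fun x _ => by
      rw [Real.norm_eq_abs, abs_of_nonneg (h.deriv_nonneg x)]; exact h.deriv_le_one x)
    (mem_univ y) (mem_univ x)
  simpa using this

theorem abs_sub_min_le (h : IsSmoothTruncation η M δ) (hδ : 0 ≤ δ) (x : ℝ) :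
    |η x - min x M| ≤ δ := by
  rcases le_total x M with hx | hx
  · rw [h.eq_self x hx, min_eq_left hx]; simpa using hδ
  · rw [min_eq_right hx, abs_of_nonneg (sub_nonneg.2 (h.le_of_le x hx))]
    linarith [h.le_add x]

theorem map_zero (h : IsSmoothTruncation η M δ) (hM : 0 ≤ M) : η 0 = 0 := h.eq_self 0 hM

end IsSmoothTruncation

/-! ### Test functions -/

variable {d : ℕ} {Ω : Set (E d)} {s : ℝ}

namespace IsTestFunction

variable {φ ψ : E d → ℝ}

theorem zero : IsTestFunction Ω (0 : E d → ℝ) where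
  smooth := contDiff_const
  hasCompactSupport := HasCompactSupport.zero
  tsupport_subset := by simp

theorem add (hφ : IsTestFunction Ω φ) (hψ : IsTestFunction Ω ψ) : IsTestFunction Ω (φ + ψ) where
  smooth := hφ.smooth.add hψ.smooth
  hasCompactSupport := hφ.hasCompactSupport.add hψ.hasCompactSupport
  tsupport_subset := (tsupport_add φ ψ).trans (union_subset hφ.tsupport_subset hψ.tsupport_subset)

theorem const_smul (hφ : IsTestFunction Ω φ) (c : ℝ) : IsTestFunction Ω (c • φ) where
  smooth := contDiff_const.smul hφ.smooth
  hasCompactSupport := hφ.hasCompactSupport.smul_left (f := fun _ => c)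
  tsupport_subset := (tsupport_smul_subset_right (fun _ => c) φ).trans hφ.tsupport_subset

theorem comp {η : ℝ → ℝ} (hη : ContDiff ℝ ((⊤ : ℕ∞) : WithTop ℕ∞) η) (h0 : η 0 = 0)
    (hφ : IsTestFunction Ω φ) : IsTestFunction Ω (η ∘ φ) where
  smooth := hη.comp hφ.smooth
  hasCompactSupport := hφ.hasCompactSupport.comp_left h0
  tsupport_subset := (tsupport_comp_subset h0 φ).trans hφ.tsupport_subset

theorem memLp (hφ : IsTestFunction Ω φ) (p : ℝ≥0∞) (D : Set (E d)) : MemLp φ p (space D) :=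
  (hφ.smooth.continuous.memLp_of_hasCompactSupport hφ.hasCompactSupport).restrict D

end IsTestFunction

theorem integrableOn_norm_rpow_ball (hd : 1 ≤ d) {a R : ℝ} (ha : -(d : ℝ) < a) (hR : 0 < R) :
    IntegrableOn (fun x : E d => ‖x‖ ^ a) (Metric.ball 0 R) := by
  have : Nontrivial (E d) := by
    have : Nonempty (Fin d) := ⟨⟨0, hd⟩⟩
    infer_instance
  rw [integrableOn_fun_norm_addHaar (volume : Measure (E d)) (f := fun t => t ^ a)]
  have h1 : IntegrableOn (fun t : ℝ => t ^ ((d : ℝ) - 1 + a)) (Ioo 0 R) :=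
    (intervalIntegral.integrableOn_Ioo_rpow_iff hR).2 (by linarith)
  refine h1.congr_fun (fun t ht => ?_) measurableSet_Ioo
  simp only [finrank_euclideanSpace_fin, smul_eq_mul]
  rw [Real.rpow_add ht.1, ← Real.rpow_natCast, Nat.cast_sub hd, Nat.cast_one]

/-- Test functions belong to `H^s(Ω)` for bounded `Ω`. -/
theorem IsTestFunction.memHs (hd : 1 ≤ d) (hs : s ∈ Ioo (0 : ℝ) 1) (hΩ : MeasurableSet Ω)
    (hb : Bornology.IsBounded Ω) {φ : E d → ℝ} (hφ : IsTestFunction Ω φ) : MemHs Ω s φ := by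
  have hφL := hφ.memLp 2 Ω
  rw [memHs_iff]
  refine ⟨hφL, ?_⟩
  have hm := aestronglyMeasurable_diffQuot (s := s) hφL.1
  rw [memLp_two_iff_integrable_sq hm]
  obtain ⟨C, hC⟩ := ContDiff.lipschitzWith_of_hasCompactSupport hφ.hasCompactSupport hφ.smooth
    (by simp)
  obtain ⟨R, hR0, hR⟩ := hb.exists_pos_norm_le
  -- The power left when the Lipschitz bound `‖x - y‖ ^ 2` is divided by `‖x - y‖ ^ (d + 2 * s)`; it
  -- exceeds `-d` because `s < 1`.
  set a : ℝ := 2 - 2 * s - d with ha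
  set k : E d → ℝ := (Metric.ball 0 (2 * R + 1)).indicator fun x => ‖x‖ ^ a with hk
  have hkint : Integrable k := by
    rw [hk, integrable_indicator_iff Metric.isOpen_ball.measurableSet]
    exact integrableOn_norm_rpow_ball hd (by linarith [hs.2]) (by linarith)
  have h1int : Integrable (Ω.indicator fun _ : E d => (1 : ℝ)) := by
    rw [integrable_indicator_iff hΩ]
    exact integrableOn_const hb.measure_lt_top.ne
  -- The dominating function on pairs is the integrand of a convolution of two integrable functions;
  -- the ball of radius `2 * R + 1` contains all differences of points of `Ω`.
  have hconv := h1int.convolution_integrand (ContinuousLinearMap.mul ℝ ℝ) hkint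
  have hres : Integrable (fun z : E d × E d => (C : ℝ) ^ 2 *
      (Ω.indicator (fun _ : E d => (1 : ℝ)) z.2 * k (z.1 - z.2))) (pairs Ω) := by
    rw [pairs, Measure.prod_restrict]
    exact (Integrable.restrict hconv).const_mul _
  refine hres.mono' (hm.pow 2) ?_
  rw [pairs, Measure.prod_restrict, ae_restrict_iff' (hΩ.prod hΩ)]
  refine Eventually.of_forall fun z hz => ?_
  have hz1 : z.1 ∈ Ω := hz.1
  have hz2 : z.2 ∈ Ω := hz.2
  have hball : z.1 - z.2 ∈ Metric.ball (0 : E d) (2 * R + 1) := by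
    rw [mem_ball_zero_iff]
    have := norm_sub_le z.1 z.2
    linarith [hR _ hz1, hR _ hz2]
  rw [indicator_of_mem hz2, hk, indicator_of_mem hball, one_mul, Real.norm_eq_abs, abs_sq]
  rcases eq_or_ne (z.1 - z.2) 0 with h0 | h0
  · rw [diffQuot, sub_eq_zero.1 h0, sub_self, zero_div, zero_pow two_ne_zero]
    positivity
  · have hn : 0 < ‖z.1 - z.2‖ := norm_pos_iff.2 h0
    rw [diffQuot, div_pow, ← Real.rpow_mul_natCast hn.le, div_le_iff₀ (by positivity), mul_assoc,
      ← Real.rpow_add hn]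
    have e1 : a + ((d : ℝ) / 2 + s) * ((2 : ℕ) : ℝ) = (2 : ℕ) := by push_cast; rw [ha]; ring
    rw [e1, Real.rpow_natCast, ← mul_pow, ← sq_abs]
    have := hC.dist_le_mul z.1 z.2
    rw [Real.dist_eq, dist_eq_norm] at this
    gcongr

/-! ### The space `H_0^s` -/

/-- The closure of a subspace with respect to a closed form. -/
theorem ClosedForm.closure {H : Type*} [NormedAddCommGroup H] [InnerProductSpace ℝ H]
    {V : Set H} {B : H → H → ℝ} (h : ClosedForm V B) {T : Set H} (hT : T ⊆ V)
    (hzero : (0 : H) ∈ T) (hadd : ∀ u ∈ T, ∀ v ∈ T, u + v ∈ T)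
    (hsmul : ∀ (c : ℝ), ∀ u ∈ T, c • u ∈ T) :
    ClosedForm {w | w ∈ V ∧ ∀ δ > 0, ∃ v ∈ T, B (w - v) (w - v) < δ} B := by
  have hsum : ∀ a ∈ V, ∀ b ∈ V, B (a + b) (a + b) ≤ 2 * B a a + 2 * B b b := by
    intro a ha b hb
    have h1 := h.sub_self_le ha (h.neg_mem hb)
    have h2 : B (-b) (-b) = B b b := by
      have := h.smul_left (-1) _ hb _ (h.neg_mem hb)
      have h3 := h.smul_right (-1) hb hb
      simp only [neg_one_smul, neg_one_mul] at this h3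
      rw [this, h3, neg_neg]
    rwa [h2, sub_neg_eq_add] at h1
  refine h.of_subspace (fun w hw => hw.1) ⟨h.zero_mem, fun δ hδ => ⟨0, hzero, ?_⟩⟩ ?_ ?_ ?_
  · have := h.smul_left 0 _ h.zero_mem _ h.zero_mem
    rw [zero_smul, zero_mul] at this
    rwa [sub_zero, this]
  · rintro u ⟨hu, hu'⟩ v ⟨hv, hv'⟩
    refine ⟨h.add_mem _ hu _ hv, fun δ hδ => ?_⟩
    obtain ⟨a, ha, ha'⟩ := hu' (δ / 4) (by positivity)
    obtain ⟨b, hb, hb'⟩ := hv' (δ / 4) (by positivity)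
    refine ⟨a + b, hadd _ ha _ hb, ?_⟩
    have := hsum _ (h.sub_mem hu (hT ha)) _ (h.sub_mem hv (hT hb))
    rw [show u + v - (a + b) = (u - a) + (v - b) by abel]
    linarith
  · rintro c u ⟨hu, hu'⟩
    refine ⟨h.smul_mem _ _ hu, fun δ hδ => ?_⟩
    obtain ⟨a, ha, ha'⟩ := hu' (δ / (c ^ 2 + 1)) (by positivity)
    refine ⟨c • a, hsmul _ _ ha, ?_⟩
    have hua := h.sub_mem hu (hT ha)
    rw [← smul_sub, h.smul_left _ _ hua _ (h.smul_mem _ _ hua), h.smul_right _ hua hua]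
    rw [lt_div_iff₀ (by positivity)] at ha'
    linarith [h.nonneg _ hua]
  · intro w hw hcl
    refine ⟨hw, fun δ hδ => ?_⟩
    obtain ⟨v, ⟨hv, hv'⟩, hwv⟩ := hcl (δ / 4) (by positivity)
    obtain ⟨a, ha, ha'⟩ := hv' (δ / 4) (by positivity)
    refine ⟨a, ha, ?_⟩
    have := hsum _ (h.sub_mem hw hv) _ (h.sub_mem hv (hT ha))
    rw [sub_add_sub_cancel] at this
    linarith

/-- The classes of test functions in `L²(Ω)`. -/
def testClasses (Ω : Set (E d)) : Set (L2 Ω) :=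
  {v | ∃ φ : E d → ℝ, IsTestFunction Ω φ ∧ v =ᵐ[space Ω] φ}

theorem W_sobolevZero_eq :
    W .sobolevZero Ω s = {w | w ∈ hsDomain Ω s ∧ ∀ δ > 0, ∃ v ∈ testClasses Ω,
      hsInner Ω s (w - v : L2 Ω) (w - v : L2 Ω) < δ} := by
  have key : ∀ (w v : L2 Ω) (φ : E d → ℝ), v =ᵐ[space Ω] φ →
      hsInner Ω s (w - v : L2 Ω) (w - v : L2 Ω)
        = hsInner Ω s (fun x => w x - φ x) (fun x => w x - φ x) := by
    intro w v φ hv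
    have : ⇑(w - v : L2 Ω) =ᵐ[space Ω] fun x => w x - φ x := by
      filter_upwards [hv, Lp.coeFn_sub w v] with x h1 h2
      rw [h2, Pi.sub_apply, h1]
    exact hsInner_congr this this
  ext w
  refine and_congr_right fun hw => forall₂_congr fun δ hδ => ⟨?_, ?_⟩
  · rintro ⟨φ, hφ, h⟩
    refine ⟨(hφ.memLp 2 Ω).toLp, ⟨φ, hφ, (hφ.memLp 2 Ω).coeFn_toLp⟩, ?_⟩
    rwa [key w _ φ (hφ.memLp 2 Ω).coeFn_toLp]
  · rintro ⟨v, ⟨φ, hφ, hv⟩, h⟩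
    exact ⟨φ, hφ, by rwa [← key w v φ hv]⟩

theorem testClasses_subset (hd : 1 ≤ d) (hs : s ∈ Ioo (0 : ℝ) 1) (hΩ : MeasurableSet Ω)
    (hb : Bornology.IsBounded Ω) : testClasses Ω ⊆ hsDomain Ω s := by
  rintro v ⟨φ, hφ, hv⟩
  exact (memHs_congr hv).2 (hφ.memHs hd hs hΩ hb)

theorem closedForm_sobolevZero (hd : 1 ≤ d) (hs : s ∈ Ioo (0 : ℝ) 1) (hΩ : MeasurableSet Ω)
    (hb : Bornology.IsBounded Ω) :
    ClosedForm (W .sobolevZero Ω s) (innerW .sobolevZero Ω s) := by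
  rw [W_sobolevZero_eq]
  refine (closedForm_hs (D := Ω) hs).closure (testClasses_subset hd hs hΩ hb) ?_ ?_ ?_
  · exact ⟨0, IsTestFunction.zero, Lp.coeFn_zero ℝ 2 (space Ω)⟩
  · rintro u ⟨φ, hφ, hu⟩ v ⟨χ, hχ, hv⟩
    exact ⟨φ + χ, hφ.add hχ, (Lp.coeFn_add u v).trans (hu.add hv)⟩
  · rintro c u ⟨φ, hφ, hu⟩
    exact ⟨c • φ, hφ.const_smul c, (Lp.coeFn_smul c u).trans (hu.const_smul c)⟩

theorem norm_sq_le_hsInner (hs : s ∈ Ioo (0 : ℝ) 1) {D : Set (E d)} (w : Lp ℝ 2 (space D)) :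
    ‖w‖ ^ 2 ≤ hsInner D s w w := by
  have hsq : ∫ x, w x * w x ∂(space D) = ‖w‖ ^ 2 := by
    rw [← real_inner_self_eq_norm_sq, L2.inner_def]; rfl
  have := fracConst_pos d hs
  rw [hsInner_eq, hsq]
  exact le_add_of_nonneg_right
    (mul_nonneg (by positivity) (integral_nonneg fun z => mul_self_nonneg _))

/-- The sign is inherited from `H^s(Ω)`; only membership needs work. Smooth truncations of
approximating test functions converge to `v` merely in `L²`, but with bounded form by contractivity,
and lower semicontinuity of the form on `H^s_0(Ω)` places the limit there. -/
theorem truncatesForm_sobolevZero (hd : 1 ≤ d) (hs : s ∈ Ioo (0 : ℝ) 1) (hΩ : MeasurableSet Ω)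
    (hb : Bornology.IsBounded Ω) :
    TruncatesForm Ω (W .sobolevZero Ω s) (innerW .sobolevZero Ω s) := by
  have : IsFiniteMeasure (space Ω) := ⟨by simpa using hb.measure_lt_top⟩
  have hB := closedForm_hs (D := Ω) hs
  intro w hw M hM
  obtain ⟨v, hv⟩ := exists_trunc w hM
  have hw' := hw
  rw [W_sobolevZero_eq] at hw'
  have htr := hs_truncation hs hw'.1 hM hv
  refine ⟨v, ?_, hv, htr.2⟩
  have hpos : ∀ n : ℕ, (0 : ℝ) < 1 / ((n : ℝ) + 1) := fun n => by positivity
  choose φ hφ hφw using fun n : ℕ => hw'.2 _ (hpos n)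
  choose η hη using fun n : ℕ => exists_isSmoothTruncation hM (hpos n)
  choose χ hχ hφχ using hφ
  have hηχ : ∀ n, IsTestFunction Ω (η n ∘ χ n) := fun n =>
    (hχ n).comp (hη n).smooth ((hη n).map_zero hM)
  set y : ℕ → L2 Ω := fun n => ((hηχ n).memLp 2 Ω).toLp with hy
  have hyx : ∀ n, y n =ᵐ[space Ω] η n ∘ χ n := fun n => ((hηχ n).memLp 2 Ω).coeFn_toLp
  have hyφ : ∀ n, ∀ᵐ x ∂(space Ω), y n x = η n (φ n x) := fun n => by
    filter_upwards [hyx n, hφχ n] with x h1 h2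
    rw [h1, Function.comp_apply, h2]
  have hφV : ∀ n, φ n ∈ hsDomain Ω s := fun n =>
    testClasses_subset hd hs hΩ hb ⟨χ n, hχ n, hφχ n⟩
  have hyW : ∀ n, y n ∈ W .sobolevZero Ω s := fun n => by
    rw [W_sobolevZero_eq]
    have hyT : y n ∈ testClasses Ω := ⟨_, hηχ n, hyx n⟩
    have hyV := testClasses_subset hd hs hΩ hb hyT
    refine ⟨hyV, fun δ hδ => ⟨y n, hyT, ?_⟩⟩
    have h0 := hB.sub_self hyV hyV
    rw [h0]; linarith
  have hyB : ∀ n, hsInner Ω s (y n) (y n) ≤ 4 * hsInner Ω s w w + 4 := by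
    intro n
    have h1 : hsInner Ω s (y n) (y n) ≤ hsInner Ω s (φ n) (φ n) := by
      refine MemHs.hsInner_le_of_contraction hs (hφV n) (Lp.aestronglyMeasurable _) ?_ ?_
      · filter_upwards [hyφ n] with x hx
        rw [hx]
        simpa [(hη n).map_zero hM] using (hη n).abs_sub_le (φ n x) 0
      · filter_upwards [ae_pairs_fst (hyφ n), ae_pairs_snd (hyφ n)] with z h1 h2
        rw [h1, h2]
        exact (hη n).abs_sub_le _ _
    have h2 := hB.sub_self_le hw'.1 (hB.sub_mem hw'.1 (hφV n))
    simp only [sub_sub_cancel] at h2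
    have h3 : 1 / ((n : ℝ) + 1) ≤ 1 := by
      rw [div_le_one (by positivity)]; linarith [(Nat.cast_nonneg n : (0 : ℝ) ≤ n)]
    have h4 : 0 ≤ hsInner Ω s w w := MemHs.hsInner_self_nonneg hs _
    linarith [hφw n]
  have hone : MemLp (fun _ : E d => (1 : ℝ)) 2 (space Ω) := memLp_const 1
  set e : L2 Ω := hone.toLp with he
  have hdist : ∀ n, ‖y n - v‖ ≤ √(1 / ((n : ℝ) + 1)) + 1 / ((n : ℝ) + 1) * ‖e‖ := by
    intro n
    have h1 : ‖y n - v‖ ≤ ‖|w - φ n| + (1 / ((n : ℝ) + 1)) • e‖ := by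
      refine Lp.norm_le_norm_of_ae_le ?_
      filter_upwards [hyφ n, hv, Lp.coeFn_sub (y n) v, Lp.coeFn_sub w (φ n),
        Lp.coeFn_abs (w - φ n), Lp.coeFn_add |w - φ n| ((1 / ((n : ℝ) + 1)) • e),
        Lp.coeFn_smul (1 / ((n : ℝ) + 1)) e, hone.coeFn_toLp] with x k1 k2 k3 k4 k5 k6 k7 k8
      rw [k3, k6, Pi.sub_apply, Pi.add_apply, k7, k5, k4, Pi.smul_apply, he, k8, Pi.sub_apply,
        k1, k2, smul_eq_mul, mul_one, Real.norm_eq_abs, Real.norm_eq_abs]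
      refine le_trans ?_ (le_abs_self _)
      have e1 := (hη n).abs_sub_min_le (hpos n).le (φ n x)
      have e2 := abs_min_sub_min_le (φ n x) (w x) M
      have e3 := abs_sub_le (η n (φ n x)) (min (φ n x) M) (min (w x) M)
      rw [abs_sub_comm (φ n x)] at e2
      linarith
    refine h1.trans ((norm_add_le _ _).trans ?_)
    rw [norm_abs_eq_norm, norm_smul, Real.norm_eq_abs, abs_of_pos (hpos n)]
    gcongr
    exact Real.le_sqrt_of_sq_le ((norm_sq_le_hsInner hs _).trans (hφw n).le)
  have hlim : Tendsto y atTop (𝓝 v) := by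
    rw [tendsto_iff_norm_sub_tendsto_zero]
    refine squeeze_zero (fun n => norm_nonneg _) hdist ?_
    have h0 := tendsto_one_div_add_atTop_nhds_zero_nat (𝕜 := ℝ)
    simpa using h0.sqrt.add (h0.mul_const ‖e‖)
  exact ((closedForm_sobolevZero hd hs hΩ hb).lsc y v _ hyW hyB hlim).1

end

section

/-! ### The Dirichlet form and its resolvents -/

variable {d : ℕ} {Ω : Set (E d)}

namespace IsTestFunction

variable {φ ψ : E d → ℝ}

theorem differentiable (hψ : IsTestFunction Ω ψ) : Differentiable ℝ ψ :=
  hψ.smooth.differentiable (by simp)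

theorem gradient_add (hφ : IsTestFunction Ω φ) (hψ : IsTestFunction Ω ψ) :
    gradient (φ + ψ) = gradient φ + gradient ψ := by
  funext x
  simp only [gradient, Pi.add_apply]
  rw [fderiv_add (hφ.differentiable x) (hψ.differentiable x), map_add]

theorem gradient_const_smul (hψ : IsTestFunction Ω ψ) (c : ℝ) :
    gradient (c • ψ) = c • gradient ψ := by
  funext x
  simp only [gradient, Pi.smul_apply]
  rw [fderiv_const_smul (hψ.differentiable x), map_smulₛₗ]
  rfl

theorem gradient_comp {η : ℝ → ℝ} (hη : Differentiable ℝ η) (hψ : IsTestFunction Ω ψ) (x : E d) :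
    gradient (η ∘ ψ) x = deriv η (ψ x) • gradient ψ x := by
  simp only [gradient]
  rw [((hη (ψ x)).hasDerivAt.comp_hasFDerivAt x (hψ.differentiable x).hasFDerivAt).fderiv,
    map_smulₛₗ]
  rfl

theorem norm_gradient (x : E d) : ‖gradient ψ x‖ = ‖fderiv ℝ ψ x‖ := by
  simp [gradient]

theorem continuous_gradient (hψ : IsTestFunction Ω ψ) : Continuous (gradient ψ) :=
  (InnerProductSpace.toDual ℝ (E d)).symm.continuous.comp (hψ.smooth.continuous_fderiv (by simp))

theorem hasCompactSupport_gradient (hψ : IsTestFunction Ω ψ) : HasCompactSupport (gradient ψ) :=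
  (hψ.hasCompactSupport.fderiv ℝ).comp_left (map_zero _)

theorem memLp_gradient (hψ : IsTestFunction Ω ψ) (D : Set (E d)) :
    MemLp (gradient ψ) 2 (space D) :=
  (hψ.continuous_gradient.memLp_of_hasCompactSupport hψ.hasCompactSupport_gradient).restrict D

/-- The class of a test function in `L²(Ω)`. -/
def toL2 (hψ : IsTestFunction Ω ψ) : L2 Ω := (hψ.memLp 2 Ω).toLp ψ

theorem coeFn_toL2 (hψ : IsTestFunction Ω ψ) : hψ.toL2 =ᵐ[space Ω] ψ := MemLp.coeFn_toLp _

theorem inner_toL2 (hψ : IsTestFunction Ω ψ) (w : L2 Ω) :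
    inner ℝ w hψ.toL2 = ∫ x, w x * ψ x ∂(space Ω) := by
  rw [L2.inner_def]
  refine integral_congr_ae ?_
  filter_upwards [hψ.coeFn_toL2] with x hx
  rw [hx]; simp [mul_comm]

/-- The class of the gradient of a test function in `L²(Ω; ℝ^d)`. -/
def gradToL2 (hψ : IsTestFunction Ω ψ) : Lp (E d) 2 (space Ω) := (hψ.memLp_gradient Ω).toLp _

theorem coeFn_gradToL2 (hψ : IsTestFunction Ω ψ) : hψ.gradToL2 =ᵐ[space Ω] gradient ψ :=
  MemLp.coeFn_toLp _

end IsTestFunction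

theorem norm_sq_toLp {F : Type*} [NormedAddCommGroup F] [InnerProductSpace ℝ F]
    {X : Type*} [MeasurableSpace X] {m : Measure X} (g : Lp F 2 m) :
    ‖g‖ ^ 2 = ∫ x, ‖g x‖ ^ 2 ∂m := by
  rw [← real_inner_self_eq_norm_sq, L2.inner_def]
  simp only [real_inner_self_eq_norm_sq]

/-- The Hilbert space containing the pairs `(a w, ∇w)`. -/
abbrev GraphSpace (Ω : Set (E d)) := WithLp 2 (L2 Ω × Lp (E d) 2 (space Ω))

/-- The pair `(a ψ, ∇ψ)` for a test function `ψ`. -/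
def graphPoint (a : ℝ) {ψ : E d → ℝ} (hψ : IsTestFunction Ω ψ) : GraphSpace Ω :=
  WithLp.toLp 2 (a • hψ.toL2, hψ.gradToL2)

/-- The pairs `(a ψ, ∇ψ)`, where `ψ` is a test function. -/
def testGraph (Ω : Set (E d)) (a : ℝ) : Submodule ℝ (GraphSpace Ω) where
  carrier := {x | ∃ (ψ : E d → ℝ) (hψ : IsTestFunction Ω ψ), x = graphPoint a hψ}
  zero_mem' := by
    refine ⟨0, IsTestFunction.zero, ?_⟩
    have h1 : (IsTestFunction.zero (Ω := Ω)).toL2 = 0 := MemLp.toLp_zero _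
    have h2 : (IsTestFunction.zero (Ω := Ω)).gradToL2 = 0 := by
      refine Lp.ext ?_
      filter_upwards [(IsTestFunction.zero (Ω := Ω)).coeFn_gradToL2,
        Lp.coeFn_zero (E d) 2 (space Ω)] with x h1 h2
      rw [h1, h2]
      simp [gradient]
    rw [graphPoint, h1, h2, smul_zero]
    rfl
  add_mem' := by
    rintro _ _ ⟨φ, hφ, rfl⟩ ⟨ψ, hψ, rfl⟩
    refine ⟨φ + ψ, hφ.add hψ, ?_⟩
    have h1 : (hφ.add hψ).toL2 = hφ.toL2 + hψ.toL2 := MemLp.toLp_add _ _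
    have h2 : (hφ.add hψ).gradToL2 = hφ.gradToL2 + hψ.gradToL2 := by
      refine Lp.ext ?_
      filter_upwards [(hφ.add hψ).coeFn_gradToL2, hφ.coeFn_gradToL2, hψ.coeFn_gradToL2,
        Lp.coeFn_add hφ.gradToL2 hψ.gradToL2] with x k1 k2 k3 k4
      rw [k1, k4, Pi.add_apply, k2, k3, hφ.gradient_add hψ, Pi.add_apply]
    change _ = WithLp.toLp 2 (a • (hφ.add hψ).toL2, (hφ.add hψ).gradToL2)
    rw [h1, h2, smul_add]
    rfl
  smul_mem' := by
    rintro c _ ⟨ψ, hψ, rfl⟩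
    refine ⟨c • ψ, hψ.const_smul c, ?_⟩
    have h1 : (hψ.const_smul c).toL2 = c • hψ.toL2 := MemLp.toLp_const_smul _ _
    have h2 : (hψ.const_smul c).gradToL2 = c • hψ.gradToL2 := by
      refine Lp.ext ?_
      filter_upwards [(hψ.const_smul c).coeFn_gradToL2, hψ.coeFn_gradToL2,
        Lp.coeFn_smul c hψ.gradToL2] with x k1 k2 k3
      rw [k1, k3, Pi.smul_apply, k2, hψ.gradient_const_smul, Pi.smul_apply]
    change _ = WithLp.toLp 2 (a • (hψ.const_smul c).toL2, (hψ.const_smul c).gradToL2)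
    rw [h1, h2, smul_comm a c]
    rfl

/-- The space `H_0^1(Ω)` with the norm `(a² ‖w‖² + ‖∇w‖²)^{1/2}`, as the space of pairs
`(a w, ∇w)`. -/
abbrev formSpace (Ω : Set (E d)) (a : ℝ) : Submodule ℝ (GraphSpace Ω) :=
  (testGraph Ω a).topologicalClosure

instance (a : ℝ) : CompleteSpace (formSpace Ω a) :=
  (Submodule.isClosed_topologicalClosure _).completeSpace_coe

/-- The element of `formSpace Ω a` given by a test function. -/
def testVec (a : ℝ) {ψ : E d → ℝ} (hψ : IsTestFunction Ω ψ) : formSpace Ω a :=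
  ⟨graphPoint a hψ, subset_closure ⟨ψ, hψ, rfl⟩⟩

/-- The inclusion of `H_0^1(Ω)` in `L²(Ω)`. -/
def formVal (Ω : Set (E d)) (a : ℝ) : formSpace Ω a →L[ℝ] L2 Ω :=
  a⁻¹ • (WithLp.fstL 2 ℝ (L2 Ω) (Lp (E d) 2 (space Ω)) ∘L (formSpace Ω a).subtypeL)

variable {a : ℝ}

theorem formVal_apply (x : formSpace Ω a) : formVal Ω a x = a⁻¹ • x.1.fst := rfl

theorem fst_eq_smul_formVal (ha : 0 < a) (x : formSpace Ω a) : x.1.fst = a • formVal Ω a x := by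
  rw [formVal_apply, smul_smul, mul_inv_cancel₀ ha.ne', one_smul]

theorem formVal_testVec (ha : 0 < a) {ψ : E d → ℝ} (hψ : IsTestFunction Ω ψ) :
    formVal Ω a (testVec a hψ) = hψ.toL2 := by
  rw [formVal_apply]
  change a⁻¹ • a • hψ.toL2 = _
  rw [smul_smul, inv_mul_cancel₀ ha.ne', one_smul]

theorem exists_testVec_near (x : formSpace Ω a) {δ : ℝ} (hδ : 0 < δ) :
    ∃ (ψ : E d → ℝ) (hψ : IsTestFunction Ω ψ), ‖x - testVec a hψ‖ < δ := by
  obtain ⟨_, ⟨ψ, hψ, rfl⟩, h⟩ := Metric.mem_closure_iff.1 x.2 δ hδ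
  exact ⟨ψ, hψ, by rwa [← dist_eq_norm]⟩

theorem formSpace_closed_induction {P : formSpace Ω a → Prop} (hP : IsClosed {x | P x})
    (h : ∀ (ψ : E d → ℝ) (hψ : IsTestFunction Ω ψ), P (testVec a hψ)) (x : formSpace Ω a) :
    P x := by
  refine hP.closure_subset (Metric.mem_closure_iff.2 fun δ hδ => ?_)
  obtain ⟨ψ, hψ, hlt⟩ := exists_testVec_near x hδ
  exact ⟨testVec a hψ, h ψ hψ, by rwa [dist_eq_norm]⟩

theorem formSpace_ext {x y : formSpace Ω a}
    (h : ∀ (ψ : E d → ℝ) (hψ : IsTestFunction Ω ψ),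
      inner ℝ x (testVec a hψ) = inner ℝ y (testVec a hψ)) : x = y := by
  have key : ∀ z : formSpace Ω a, inner ℝ (x - y) z = 0 :=
    formSpace_closed_induction (isClosed_eq (continuous_const.inner continuous_id) continuous_const)
      fun ψ hψ => by rw [inner_sub_left, h ψ hψ, _root_.sub_self]
  exact sub_eq_zero.1 (inner_self_eq_zero.1 (key (x - y)))

theorem inner_gradToL2 (g : Lp (E d) 2 (space Ω)) {ψ : E d → ℝ} (hψ : IsTestFunction Ω ψ) :
    inner ℝ g hψ.gradToL2 = ∫ x, inner ℝ (g x) (gradient ψ x) ∂(space Ω) := by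
  rw [L2.inner_def]
  refine integral_congr_ae ?_
  filter_upwards [hψ.coeFn_gradToL2] with x hx
  rw [hx]

theorem inner_testVec (ha : 0 < a) (x : formSpace Ω a) {ψ : E d → ℝ} (hψ : IsTestFunction Ω ψ) :
    inner ℝ x (testVec a hψ) =
      a ^ 2 * inner ℝ (formVal Ω a x) hψ.toL2 + inner ℝ x.1.snd hψ.gradToL2 := by
  change inner ℝ x.1.fst (a • hψ.toL2) + inner ℝ x.1.snd hψ.gradToL2 = _
  rw [fst_eq_smul_formVal ha, inner_smul_left, inner_smul_right]
  simp only [conj_trivial]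
  ring

theorem norm_sq_formSpace (ha : 0 < a) (x : formSpace Ω a) :
    ‖x‖ ^ 2 = a ^ 2 * ‖formVal Ω a x‖ ^ 2 + ‖x.1.snd‖ ^ 2 := by
  have : ‖x‖ ^ 2 = ‖x.1‖ ^ 2 := rfl
  rw [this, WithLp.prod_norm_sq_eq_of_L2, fst_eq_smul_formVal ha, norm_smul, mul_pow,
    Real.norm_eq_abs, sq_abs]

/-- The resolvent `(a² - Δ)⁻¹` of the Dirichlet Laplacian. -/
def dirichletResolvent (Ω : Set (E d)) (a : ℝ) : L2 Ω →L[ℝ] L2 Ω :=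
  formVal Ω a ∘L ContinuousLinearMap.adjoint (formVal Ω a)

/-- The adjoint of the inclusion solves `a² x - Δ x = u` weakly, which is why the inclusion composed
with it is the resolvent. -/
theorem inner_adjoint_testVec (ha : 0 < a) (u : L2 Ω) {ψ : E d → ℝ} (hψ : IsTestFunction Ω ψ) :
    inner ℝ (ContinuousLinearMap.adjoint (formVal Ω a) u) (testVec a hψ) =
      inner ℝ u hψ.toL2 := by
  rw [ContinuousLinearMap.adjoint_inner_left, formVal_testVec ha]

theorem inner_dirichletResolvent (u v : L2 Ω) :
    inner ℝ (dirichletResolvent Ω a u) v =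
      inner ℝ (ContinuousLinearMap.adjoint (formVal Ω a) u)
        (ContinuousLinearMap.adjoint (formVal Ω a) v) := by
  rw [ContinuousLinearMap.adjoint_inner_right]
  rfl

theorem dirichletResolvent_symm (u v : L2 Ω) :
    inner ℝ (dirichletResolvent Ω a u) v = inner ℝ u (dirichletResolvent Ω a v) := by
  rw [inner_dirichletResolvent, real_inner_comm, ← inner_dirichletResolvent, real_inner_comm]

theorem ae_le_of_tendsto_L2 {X : Type*} [MeasurableSpace X] {m : Measure X} {u : ℕ → Lp ℝ 2 m}
    {u₀ : Lp ℝ 2 m} (h : Tendsto u atTop (𝓝 u₀)) {M : ℝ} (hu : ∀ n, ∀ᵐ x ∂m, u n x ≤ M) :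
    ∀ᵐ x ∂m, u₀ x ≤ M := by
  obtain ⟨φ, -, hφ⟩ := exists_subseq_tendsto_ae h
  filter_upwards [hφ, ae_all_iff.2 hu] with x h1 h2
  exact le_of_tendsto h1 (Eventually.of_forall fun n => h2 _)

/-- Composition with a smooth truncation does not increase the energy `‖x - t ι^* v‖`, where
`t = a²` and `v ≤ M`. -/
theorem norm_sub_testVec_comp_le (ha : 0 < a) {M δ : ℝ} (hM : 0 ≤ M) {v : L2 Ω}
    (hv : ∀ᵐ x ∂(space Ω), v x ≤ M) {η : ℝ → ℝ} (hη : IsSmoothTruncation η M δ) {ψ : E d → ℝ}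
    (hψ : IsTestFunction Ω ψ) :
    ‖a ^ 2 • ContinuousLinearMap.adjoint (formVal Ω a) v -
        testVec a (hψ.comp hη.smooth (hη.map_zero hM))‖ ≤
      ‖a ^ 2 • ContinuousLinearMap.adjoint (formVal Ω a) v - testVec a hψ‖ := by
  set h := a ^ 2 • ContinuousLinearMap.adjoint (formVal Ω a) v with hh
  -- Up to a constant, the squared distance to `h` is the energy `a² ‖χ - v‖² + ‖∇χ‖²`, and both
  -- terms decrease under truncation.
  have key : ∀ {χ : E d → ℝ} (hχ : IsTestFunction Ω χ), ‖h - testVec a hχ‖ ^ 2 =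
      ‖h‖ ^ 2 - a ^ 2 * ‖v‖ ^ 2 + a ^ 2 * ‖hχ.toL2 - v‖ ^ 2 + ‖hχ.gradToL2‖ ^ 2 := by
    intro χ hχ
    rw [norm_sub_sq_real, norm_sq_formSpace ha (testVec a hχ), formVal_testVec ha]
    have h1 : inner ℝ h (testVec a hχ) = a ^ 2 * inner ℝ v hχ.toL2 := by
      rw [hh, ← map_smul, inner_adjoint_testVec ha, real_inner_smul_left]
    rw [h1, norm_sub_sq_real, real_inner_comm]
    change _ - _ + (_ + ‖hχ.gradToL2‖ ^ 2) = _
    ring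
  refine le_of_sq_le_sq ?_ (norm_nonneg _)
  rw [key, key]
  have h1 : ‖(hψ.comp hη.smooth (hη.map_zero hM)).toL2 - v‖ ≤ ‖hψ.toL2 - v‖ := by
    refine Lp.norm_le_norm_of_ae_le ?_
    filter_upwards [hv, (hψ.comp hη.smooth (hη.map_zero hM)).coeFn_toL2, hψ.coeFn_toL2,
      Lp.coeFn_sub (hψ.comp hη.smooth (hη.map_zero hM)).toL2 v, Lp.coeFn_sub hψ.toL2 v]
      with x k1 k2 k3 k4 k5
    rw [k4, k5, Pi.sub_apply, Pi.sub_apply, k2, k3, Function.comp_apply]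
    rcases le_total (ψ x) M with h | h
    · rw [hη.eq_self _ h]
    · rw [Real.norm_of_nonneg (by linarith [hη.le_of_le _ h]),
        Real.norm_of_nonneg (by linarith)]
      linarith [hη.le_self (ψ x)]
  have h2 : ‖(hψ.comp hη.smooth (hη.map_zero hM)).gradToL2‖ ≤ ‖hψ.gradToL2‖ := by
    refine Lp.norm_le_norm_of_ae_le ?_
    filter_upwards [(hψ.comp hη.smooth (hη.map_zero hM)).coeFn_gradToL2, hψ.coeFn_gradToL2]
      with x k1 k2
    rw [k1, k2, hψ.gradient_comp (hη.smooth.differentiable (by simp)), norm_smul,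
      Real.norm_of_nonneg (hη.deriv_nonneg _)]
    exact mul_le_of_le_one_left (norm_nonneg _) (hη.deriv_le_one _)
  gcongr

/-- The resolvent `t (t - Δ)⁻¹`, `t = a²`, is sub-Markovian. -/
theorem dirichletResolvent_le (ha : 0 < a) {M : ℝ} (hM : 0 ≤ M) {v : L2 Ω}
    (hv : ∀ᵐ x ∂(space Ω), v x ≤ M) :
    ∀ᵐ x ∂(space Ω), (a ^ 2 • dirichletResolvent Ω a v : L2 Ω) x ≤ M := by
  set h := a ^ 2 • ContinuousLinearMap.adjoint (formVal Ω a) v with hh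
  have hval : a ^ 2 • dirichletResolvent Ω a v = formVal Ω a h := by
    rw [hh, map_smul]; rfl
  rw [hval]
  -- Test functions approach `h` in the form norm, and their truncations are no farther from `h`; so
  -- `h` is a limit of functions bounded by `M + 1 / (n + 1)`.
  have key : ∀ n : ℕ, ∀ᵐ x ∂(space Ω), formVal Ω a h x ≤ M + 1 / ((n : ℝ) + 1) := by
    intro n
    obtain ⟨η, hη⟩ := exists_isSmoothTruncation hM (Nat.one_div_pos_of_nat (α := ℝ) (n := n))
    choose ψ hψ hlt using fun k : ℕ =>
      exists_testVec_near h (Nat.one_div_pos_of_nat (α := ℝ) (n := k))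
    have hlim : Tendsto (fun k => testVec a ((hψ k).comp hη.smooth (hη.map_zero hM))) atTop
        (𝓝 h) := by
      rw [tendsto_iff_norm_sub_tendsto_zero]
      refine squeeze_zero (fun _ => norm_nonneg _) (fun k => ?_)
        tendsto_one_div_add_atTop_nhds_zero_nat
      rw [norm_sub_rev]
      exact (norm_sub_testVec_comp_le ha hM hv hη (hψ k)).trans (hlt k).le
    have hlim' := ((formVal Ω a).continuous.tendsto h).comp hlim
    refine ae_le_of_tendsto_L2 hlim' fun k => ?_
    rw [Function.comp_apply, formVal_testVec ha]
    filter_upwards [((hψ k).comp hη.smooth (hη.map_zero hM)).coeFn_toL2] with x hx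
    rw [hx]
    exact hη.le_add _
  filter_upwards [ae_all_iff.2 key] with x hx
  have : Tendsto (fun n : ℕ => M + 1 / ((n : ℝ) + 1)) atTop (𝓝 (M + 0)) :=
    tendsto_const_nhds.add tendsto_one_div_add_atTop_nhds_zero_nat
  rw [add_zero] at this
  exact ge_of_tendsto' this hx

/-- `⟨v - t R_t v, w - v⟩ ≥ 0` for `v = min w M`. -/
theorem inner_sub_dirichletResolvent_nonneg (ha : 0 < a) {M : ℝ} (hM : 0 ≤ M) {v w : L2 Ω}
    (hv : ∀ᵐ x ∂(space Ω), v x = min (w x) M) :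
    0 ≤ inner ℝ (v - a ^ 2 • dirichletResolvent Ω a v) (w - v) := by
  rw [L2.inner_def]
  have hle := dirichletResolvent_le ha hM (v := v) (by
    filter_upwards [hv] with x hx
    rw [hx]; exact min_le_right _ _)
  refine integral_nonneg_of_ae ?_
  filter_upwards [hv, hle, Lp.coeFn_sub v (a ^ 2 • dirichletResolvent Ω a v), Lp.coeFn_sub w v]
    with x h1 h2 h3 h4
  rw [h3, h4, Pi.sub_apply, Pi.sub_apply, h1]
  simp only [Pi.zero_apply, RCLike.inner_apply, conj_trivial]
  rcases le_total (w x) M with h | h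
  · rw [min_eq_left h]; simp
  · rw [min_eq_right h]
    exact mul_nonneg (by linarith) (by linarith)

end

section

/-! ### The compact embedding of `H_0^1` -/

theorem enorm_integral_sq_le {X F : Type*} [MeasurableSpace X] {m : Measure X}
    [NormedAddCommGroup F] [NormedSpace ℝ F] {g : X → F} (hg : AEStronglyMeasurable g m) :
    ‖∫ x, g x ∂m‖ₑ ^ 2 ≤ m univ * ∫⁻ x, ‖g x‖ₑ ^ 2 ∂m := by
  have h1 := enorm_integral_le_lintegral_enorm (μ := m) g
  have h2 := ENNReal.lintegral_mul_le_Lp_mul_Lq m Real.HolderConjugate.two_two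
    (f := fun _ => 1) (g := fun x => ‖g x‖ₑ) aemeasurable_const hg.enorm
  simp only [Pi.mul_apply, one_mul, one_pow, lintegral_const, ENNReal.rpow_two] at h2
  have h3 : ∀ y : ℝ≥0∞, (y ^ (1 / 2 : ℝ)) ^ 2 = y := fun y => by
    rw [← ENNReal.rpow_natCast, ← ENNReal.rpow_mul]; norm_num
  calc ‖∫ x, g x ∂m‖ₑ ^ 2 ≤ (m univ ^ (1 / 2 : ℝ) * (∫⁻ x, ‖g x‖ₑ ^ 2 ∂m) ^ (1 / 2 : ℝ)) ^ 2 := by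
        gcongr; exact h1.trans h2
    _ = _ := by rw [mul_pow, h3, h3]

theorem enorm_sq_toLp {F : Type*} [NormedAddCommGroup F] {X : Type*} [MeasurableSpace X]
    {m : Measure X} (g : Lp F 2 m) : ‖g‖ₑ ^ 2 = ∫⁻ x, ‖g x‖ₑ ^ 2 ∂m := by
  rw [Lp.enorm_def, eLpNorm_eq_lintegral_rpow_enorm_toReal two_ne_zero ENNReal.ofNat_ne_top,
    ← ENNReal.rpow_natCast, ← ENNReal.rpow_mul]
  norm_num

theorem coeFn_finsetSum {ι X : Type*} [MeasurableSpace X] {m : Measure X} (F : Finset ι)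
    (u : ι → Lp ℝ 2 m) : ∀ᵐ x ∂m, (∑ i ∈ F, u i : Lp ℝ 2 m) x = ∑ i ∈ F, u i x := by
  classical
  induction F using Finset.induction_on with
  | empty =>
    filter_upwards [Lp.coeFn_zero ℝ 2 m] with x hx
    simpa using hx
  | insert i F hi ih =>
    filter_upwards [ih, Lp.coeFn_add (u i) (∑ i ∈ F, u i)] with x h1 h2
    rw [Finset.sum_insert hi, Finset.sum_insert hi, h2, Pi.add_apply, h1]

variable {d : ℕ} {Ω : Set (E d)} {a : ℝ}

theorem IsTestFunction.enorm_sub_sq_le {ψ : E d → ℝ} (hψ : IsTestFunction Ω ψ) (x z : E d) :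
    ‖ψ x - ψ (x + z)‖ₑ ^ 2 ≤
      ‖z‖ₑ ^ 2 * ∫⁻ t in Ioc (0 : ℝ) 1, ‖gradient ψ (x + t • z)‖ₑ ^ 2 := by
  have hline : Continuous fun t : ℝ => x + t • z := by fun_prop
  have hcont : Continuous fun t : ℝ => fderiv ℝ ψ (x + t • z) z :=
    ((hψ.smooth.continuous_fderiv (by simp)).comp hline).clm_apply continuous_const
  have hderiv : ∀ t ∈ uIcc (0 : ℝ) 1,
      HasDerivAt (fun t : ℝ => ψ (x + t • z)) (fderiv ℝ ψ (x + t • z) z) t := by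
    intro t _
    have h1 : HasDerivAt (fun t : ℝ => x + t • z) z t := by
      simpa using ((hasDerivAt_id t).smul_const z).const_add x
    exact (hψ.differentiable _).hasFDerivAt.comp_hasDerivAt t h1
  have h := intervalIntegral.integral_eq_sub_of_hasDerivAt hderiv (hcont.intervalIntegrable _ _)
  simp only [one_smul, zero_smul, add_zero] at h
  rw [intervalIntegral.integral_of_le zero_le_one] at h
  rw [← enorm_neg, neg_sub, ← h]
  refine (enorm_integral_sq_le hcont.aestronglyMeasurable).trans ?_
  rw [Measure.restrict_apply_univ, Real.volume_Ioc, sub_zero, ENNReal.ofReal_one, one_mul,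
    ← lintegral_const_mul' _ _ (by simp)]
  refine lintegral_mono fun t => ?_
  rw [← mul_pow]
  gcongr
  rw [mul_comm, ← ofReal_norm, ← ofReal_norm, ← ofReal_norm, ← ENNReal.ofReal_mul (norm_nonneg _),
    IsTestFunction.norm_gradient]
  exact ENNReal.ofReal_le_ofReal ((fderiv ℝ ψ (x + t • z)).le_opNorm z)

/-- Integrate the estimate along the segment, exchange the integrals, and use translation
invariance. -/
theorem IsTestFunction.lintegral_translate_le {ψ : E d → ℝ} (hψ : IsTestFunction Ω ψ) (z : E d) :
    ∫⁻ x, ‖ψ x - ψ (x + z)‖ₑ ^ 2 ≤ ‖z‖ₑ ^ 2 * ∫⁻ x, ‖gradient ψ x‖ₑ ^ 2 := by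
  calc ∫⁻ x, ‖ψ x - ψ (x + z)‖ₑ ^ 2
      ≤ ∫⁻ x, ‖z‖ₑ ^ 2 * ∫⁻ t in Ioc (0 : ℝ) 1, ‖gradient ψ (x + t • z)‖ₑ ^ 2 :=
        lintegral_mono fun x => hψ.enorm_sub_sq_le x z
    _ = ‖z‖ₑ ^ 2 * ∫⁻ t in Ioc (0 : ℝ) 1, ∫⁻ x, ‖gradient ψ (x + t • z)‖ₑ ^ 2 := by
        rw [lintegral_const_mul' _ _ (by simp), lintegral_lintegral_swap]
        refine Measurable.aemeasurable ?_
        have : Continuous fun q : E d × ℝ => gradient ψ (q.1 + q.2 • z) :=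
          hψ.continuous_gradient.comp (by fun_prop)
        exact (this.measurable.enorm.pow_const 2)
    _ = _ := by
        simp_rw [lintegral_add_right_eq_self (fun x => ‖gradient ψ x‖ₑ ^ 2)]
        simp

/-- The index of the cube of the grid `h ℤ^d` containing a point. -/
def gridIndex (h : ℝ) (x : E d) (j : Fin d) : ℤ := ⌊x j / h⌋

/-- The cubes of side `h`. -/
def gridCell (h : ℝ) (n : Fin d → ℤ) : Set (E d) := {x | gridIndex h x = n}

theorem mem_gridCell_iff {h : ℝ} (hh : 0 < h) {n : Fin d → ℤ} {x : E d} :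
    x ∈ gridCell h n ↔ ∀ j, x j ∈ Ico (h * n j) (h * n j + h) := by
  change gridIndex h x = n ↔ _
  rw [funext_iff]
  refine forall_congr' fun j => ?_
  rw [gridIndex, Int.floor_eq_iff, le_div_iff₀ hh, div_lt_iff₀ hh, mem_Ico, add_mul, one_mul,
    mul_comm h]

theorem gridCell_eq_preimage {h : ℝ} (hh : 0 < h) (n : Fin d → ℤ) :
    gridCell h n = (WithLp.ofLp : E d → Fin d → ℝ) ⁻¹'
      univ.pi fun j => Ico (h * n j) (h * n j + h) := by
  ext x
  rw [mem_gridCell_iff hh]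
  simp

theorem measurableSet_gridCell {h : ℝ} (hh : 0 < h) (n : Fin d → ℤ) :
    MeasurableSet (gridCell h n : Set (E d)) := by
  rw [gridCell_eq_preimage hh]
  exact (PiLp.volume_preserving_ofLp (Fin d)).measurable
    (MeasurableSet.univ_pi fun _ => measurableSet_Ico)

theorem volume_gridCell {h : ℝ} (hh : 0 < h) (n : Fin d → ℤ) :
    volume (gridCell h n : Set (E d)) = ENNReal.ofReal (h ^ d) := by
  rw [gridCell_eq_preimage hh, (PiLp.volume_preserving_ofLp (Fin d)).measure_preimage
    (MeasurableSet.univ_pi fun _ => measurableSet_Ico).nullMeasurableSet, Real.volume_pi_Ico]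
  simp [ENNReal.ofReal_pow hh.le]

theorem norm_sub_le_of_mem_gridCell {h : ℝ} (hh : 0 < h) {n : Fin d → ℤ} {x y : E d}
    (hx : x ∈ gridCell h n) (hy : y ∈ gridCell h n) : ‖y - x‖ ≤ h * √d := by
  rw [mem_gridCell_iff hh] at hx hy
  rw [EuclideanSpace.norm_eq]
  refine Real.sqrt_le_iff.2 ⟨by positivity, ?_⟩
  rw [mul_pow, Real.sq_sqrt (Nat.cast_nonneg d)]
  calc ∑ j, ‖(y - x) j‖ ^ 2 ≤ ∑ _j : Fin d, h ^ 2 := by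
        refine Finset.sum_le_sum fun j _ => ?_
        have h1 := hx j
        have h2 := hy j
        rw [mem_Ico] at h1 h2
        rw [PiLp.sub_apply, Real.norm_eq_abs, sq_abs]
        exact sq_le_sq' (by linarith) (by linarith)
    _ = h ^ 2 * d := by simp [mul_comm]

theorem finite_gridIndex_image (h : ℝ) (hb : Bornology.IsBounded Ω) :
    (gridIndex h '' Ω).Finite := by
  obtain ⟨R, -, hR⟩ := hb.exists_pos_norm_le
  refine (Set.finite_Icc (fun _ : Fin d => ⌊-(R / |h|)⌋) fun _ => ⌊R / |h|⌋).subset ?_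
  rintro _ ⟨x, hx, rfl⟩
  have key : ∀ j, |x j / h| ≤ R / |h| := fun j => by
    rw [abs_div]
    gcongr
    exact (PiLp.norm_apply_le x j).trans (hR x hx)
  exact ⟨fun j => Int.floor_mono (abs_le.1 (key j)).1,
    fun j => Int.floor_mono (abs_le.1 (key j)).2⟩

/-- A function is close to its averages over the cubes of a grid. -/
theorem IsTestFunction.enorm_sub_average_sq_le {ψ : E d → ℝ} (hψ : IsTestFunction Ω ψ) {h : ℝ}
    (hh : 0 < h) (x : E d) :
    ‖ψ x - (h ^ d)⁻¹ * ∫ y in gridCell h (gridIndex h x), ψ y‖ₑ ^ 2 ≤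
      (ENNReal.ofReal (h ^ d))⁻¹ *
        ∫⁻ z in Metric.closedBall 0 (h * √d), ‖ψ x - ψ (x + z)‖ₑ ^ 2 := by
  set Q : Set (E d) := gridCell h (gridIndex h x) with hQ
  have hxQ : x ∈ Q := rfl
  have hm := volume_gridCell (d := d) hh (gridIndex h x)
  have hmpos : 0 < h ^ d := by positivity
  have hQfin : volume Q ≠ ∞ := by rw [hQ, hm]; exact ENNReal.ofReal_ne_top
  have hint : IntegrableOn ψ Q :=
    (hψ.smooth.continuous.integrable_of_hasCompactSupport hψ.hasCompactSupport).integrableOn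
  have hconst : IntegrableOn (fun _ => ψ x) Q := integrableOn_const hQfin
  have h1 : ψ x - (h ^ d)⁻¹ * ∫ y in Q, ψ y = (h ^ d)⁻¹ * ∫ y in Q, (ψ x - ψ y) := by
    rw [integral_sub hconst hint, setIntegral_const, Measure.real, hQ, hm,
      ENNReal.toReal_ofReal hmpos.le, smul_eq_mul]
    field_simp
  have h2 : ∫⁻ y in Q, ‖ψ x - ψ y‖ₑ ^ 2 ≤
      ∫⁻ z in Metric.closedBall 0 (h * √d), ‖ψ x - ψ (x + z)‖ₑ ^ 2 := by
    rw [← lintegral_indicator (measurableSet_gridCell hh _),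
      ← lintegral_indicator Metric.isClosed_closedBall.measurableSet,
      ← lintegral_add_left_eq_self _ x]
    refine lintegral_mono fun z => ?_
    by_cases hz : x + z ∈ Q
    · rw [indicator_of_mem hz, indicator_of_mem]
      rw [mem_closedBall_zero_iff]
      simpa using norm_sub_le_of_mem_gridCell hh hxQ hz
    · rw [indicator_of_notMem hz]; exact zero_le
  have h3 := enorm_integral_sq_le (m := volume.restrict Q) (g := fun y => ψ x - ψ y)
    (hconst.sub hint).aestronglyMeasurable
  rw [Measure.restrict_apply_univ, hQ, hm] at h3
  have h0 : ENNReal.ofReal (h ^ d) ≠ 0 := by simpa using hmpos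
  rw [h1, enorm_mul, mul_pow]
  calc ‖(h ^ d)⁻¹‖ₑ ^ 2 * ‖∫ y in Q, (ψ x - ψ y)‖ₑ ^ 2
      ≤ ‖(h ^ d)⁻¹‖ₑ ^ 2 * (ENNReal.ofReal (h ^ d) * ∫⁻ y in Q, ‖ψ x - ψ y‖ₑ ^ 2) := by gcongr
    _ = (ENNReal.ofReal (h ^ d))⁻¹ * ∫⁻ y in Q, ‖ψ x - ψ y‖ₑ ^ 2 := by
        rw [Real.enorm_of_nonneg (by positivity), ENNReal.ofReal_inv_of_pos hmpos, sq, ← mul_assoc,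
          mul_assoc _ _ (ENNReal.ofReal (h ^ d)), ENNReal.inv_mul_cancel h0 ENNReal.ofReal_ne_top,
          mul_one]
    _ ≤ _ := by gcongr

/-- The translation estimate integrated over all shifts up to the diameter `h * √d` of a cell. The
volume ratio of ball and cell does not depend on `h`, so the error is of order `h` in `L²`. -/
theorem IsTestFunction.lintegral_sub_average_sq_le {ψ : E d → ℝ} (hψ : IsTestFunction Ω ψ) {h : ℝ}
    (hh : 0 < h) :
    ∫⁻ x, ‖ψ x - (h ^ d)⁻¹ * ∫ y in gridCell h (gridIndex h x), ψ y‖ₑ ^ 2 ≤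
      volume (Metric.closedBall (0 : E d) √d) * ENNReal.ofReal (h * √d) ^ 2 *
        ∫⁻ x, ‖gradient ψ x‖ₑ ^ 2 := by
  have hmpos : 0 < h ^ d := by positivity
  have h0 : ENNReal.ofReal (h ^ d) ≠ 0 := by simpa using hmpos
  have hvol : volume (Metric.closedBall (0 : E d) (h * √d)) =
      ENNReal.ofReal (h ^ d) * volume (Metric.closedBall (0 : E d) √d) := by
    rw [Measure.addHaar_closedBall_mul _ _ hh.le (Real.sqrt_nonneg _), finrank_euclideanSpace_fin]
  have hmeas : Measurable fun q : E d × E d => ‖ψ q.1 - ψ (q.1 + q.2)‖ₑ ^ 2 := by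
    have hc := hψ.smooth.continuous
    have : Continuous fun q : E d × E d => ψ q.1 - ψ (q.1 + q.2) := by fun_prop
    exact this.measurable.enorm.pow_const 2
  calc ∫⁻ x, ‖ψ x - (h ^ d)⁻¹ * ∫ y in gridCell h (gridIndex h x), ψ y‖ₑ ^ 2
      ≤ ∫⁻ x, (ENNReal.ofReal (h ^ d))⁻¹ *
        ∫⁻ z in Metric.closedBall 0 (h * √d), ‖ψ x - ψ (x + z)‖ₑ ^ 2 :=
        lintegral_mono fun x => hψ.enorm_sub_average_sq_le hh x
    _ = (ENNReal.ofReal (h ^ d))⁻¹ *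
        ∫⁻ z in Metric.closedBall 0 (h * √d), ∫⁻ x, ‖ψ x - ψ (x + z)‖ₑ ^ 2 := by
        rw [lintegral_const_mul' _ _ (by simpa using hmpos), lintegral_lintegral_swap]
        exact hmeas.aemeasurable
    _ ≤ (ENNReal.ofReal (h ^ d))⁻¹ * ∫⁻ _ in Metric.closedBall (0 : E d) (h * √d),
          ENNReal.ofReal (h * √d) ^ 2 * ∫⁻ x, ‖gradient ψ x‖ₑ ^ 2 := by
        refine mul_le_mul' le_rfl ?_
        refine setLIntegral_mono' (s := Metric.closedBall (0 : E d) (h * √d))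
          Metric.isClosed_closedBall.measurableSet fun z hz => ?_
        refine (hψ.lintegral_translate_le z).trans ?_
        gcongr
        rw [← ofReal_norm]
        exact ENNReal.ofReal_le_ofReal (mem_closedBall_zero_iff.1 hz)
    _ = _ := by
        rw [setLIntegral_const, hvol]
        calc _ = ((ENNReal.ofReal (h ^ d))⁻¹ * ENNReal.ofReal (h ^ d)) *
              (volume (Metric.closedBall (0 : E d) √d) * ENNReal.ofReal (h * √d) ^ 2 *
                ∫⁻ x, ‖gradient ψ x‖ₑ ^ 2) := by ring
          _ = _ := by rw [ENNReal.inv_mul_cancel h0 ENNReal.ofReal_ne_top, one_mul]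

theorem IsTestFunction.lintegral_gradient {ψ : E d → ℝ} (hψ : IsTestFunction Ω ψ) :
    ∫⁻ x, ‖gradient ψ x‖ₑ ^ 2 = ‖hψ.gradToL2‖ₑ ^ 2 := by
  rw [enorm_sq_toLp, lintegral_congr_ae (μ := space Ω) (g := fun x => ‖gradient ψ x‖ₑ ^ 2) (by
    filter_upwards [hψ.coeFn_gradToL2] with x hx
    rw [hx]), setLIntegral_eq_of_support_subset]
  intro x hx
  refine hψ.tsupport_subset (support_fderiv_subset ℝ (f := ψ) ?_)
  rw [Function.mem_support] at hx ⊢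
  contrapose! hx
  simp [gradient, hx]

variable [IsFiniteMeasure (space Ω)]

/-- Averaging over the cubes with index in `F`. -/
def gridAverage (Ω : Set (E d)) [IsFiniteMeasure (space Ω)] {h : ℝ} (hh : 0 < h)
    (F : Finset (Fin d → ℤ)) : L2 Ω →L[ℝ] L2 Ω :=
  ∑ n ∈ F, (h ^ d)⁻¹ • ContinuousLinearMap.smulRight
    (innerSL ℝ (indicatorConstLp 2 (measurableSet_gridCell hh n)
      (measure_ne_top (space Ω) _) (1 : ℝ)))
    (indicatorConstLp 2 (measurableSet_gridCell hh n) (measure_ne_top (space Ω) _) (1 : ℝ))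

theorem isCompactOperator_gridAverage {h : ℝ} (hh : 0 < h) (F : Finset (Fin d → ℤ)) :
    IsCompactOperator (gridAverage Ω hh F) := by
  have : gridAverage Ω hh F ∈ compactOperator (RingHom.id ℝ) (L2 Ω) (L2 Ω) := by
    refine Submodule.sum_mem _ fun n _ => Submodule.smul_mem _ _ ?_
    set e : L2 Ω := indicatorConstLp 2 (measurableSet_gridCell hh n)
      (measure_ne_top (space Ω) _) (1 : ℝ)
    exact (isCompactOperator_of_locallyCompactSpace_dom (innerSL ℝ e)).clm_comp
      (ContinuousLinearMap.toSpanSingleton ℝ e)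
  exact this

theorem gridAverage_toL2 (hΩ : MeasurableSet Ω) {h : ℝ} (hh : 0 < h) {F : Finset (Fin d → ℤ)}
    (hF : ∀ x ∈ Ω, gridIndex h x ∈ F) {ψ : E d → ℝ} (hψ : IsTestFunction Ω ψ) :
    ∀ᵐ x ∂(space Ω), gridAverage Ω hh F hψ.toL2 x =
      (h ^ d)⁻¹ * ∫ y in gridCell h (gridIndex h x), ψ y := by
  have hval : ∀ n : Fin d → ℤ, inner ℝ (indicatorConstLp 2 (measurableSet_gridCell hh n)
      (measure_ne_top (space Ω) _) (1 : ℝ)) hψ.toL2 = ∫ y in gridCell h n, ψ y := by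
    intro n
    rw [L2.inner_indicatorConstLp_one, integral_congr_ae (ae_restrict_of_ae hψ.coeFn_toL2),
      Measure.restrict_restrict (measurableSet_gridCell hh n), inter_comm]
    -- A cell may stick out of `Ω`, but the test function vanishes there.
    refine (setIntegral_eq_of_subset_of_forall_sdiff_eq_zero (measurableSet_gridCell hh n)
      inter_subset_right fun x hx => ?_).symm
    refine image_eq_zero_of_notMem_tsupport fun hx' => hx.2 ⟨hψ.tsupport_subset hx', hx.1⟩
  have hsum : gridAverage Ω hh F hψ.toL2 = ∑ n ∈ F,
      ((h ^ d)⁻¹ * ∫ y in gridCell h n, ψ y) • (indicatorConstLp 2 (measurableSet_gridCell hh n)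
        (measure_ne_top (space Ω) _) (1 : ℝ) : L2 Ω) := by
    rw [gridAverage, sum_apply]
    refine Finset.sum_congr rfl fun n _ => ?_
    rw [smul_apply, ContinuousLinearMap.smulRight_apply, innerSL_apply_apply,
      hval, smul_smul]
  rw [hsum]
  have hcoe : ∀ n ∈ F, ∀ᵐ x ∂(space Ω), (((h ^ d)⁻¹ * ∫ y in gridCell h n, ψ y) •
      (indicatorConstLp 2 (measurableSet_gridCell hh n)
        (measure_ne_top (space Ω) _) (1 : ℝ) : L2 Ω)) x =
      ((h ^ d)⁻¹ * ∫ y in gridCell h n, ψ y) * (gridCell h n).indicator (fun _ => 1) x := by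
    intro n _
    filter_upwards [Lp.coeFn_smul ((h ^ d)⁻¹ * ∫ y in gridCell h n, ψ y)
      (indicatorConstLp 2 (measurableSet_gridCell hh n)
        (measure_ne_top (space Ω) _) (1 : ℝ) : L2 Ω),
      indicatorConstLp_coeFn (p := 2) (hs := measurableSet_gridCell hh n)
        (hμs := measure_ne_top (space Ω) (gridCell h n)) (c := (1 : ℝ))] with x h1 h2
    rw [h1, Pi.smul_apply, h2, smul_eq_mul]
  filter_upwards [ae_restrict_mem hΩ, (ae_ball_iff F.countable_toSet).2 hcoe,
    coeFn_finsetSum F fun n => ((h ^ d)⁻¹ * ∫ y in gridCell h n, ψ y) •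
      (indicatorConstLp 2 (measurableSet_gridCell hh n)
        (measure_ne_top (space Ω) _) (1 : ℝ) : L2 Ω)] with x hx h1 h2
  rw [h2, Finset.sum_congr rfl h1, Finset.sum_eq_single (gridIndex h x)]
  · rw [indicator_of_mem (show x ∈ gridCell h (gridIndex h x) from rfl), mul_one]
  · intro n _ hn
    have hx' : x ∉ gridCell h n := fun hx' => hn (Eq.symm hx')
    rw [indicator_of_notMem hx', mul_zero]
  · exact fun hn => absurd (hF x hx) hn

/-- Both sides are continuous on the form space, so the estimate for test functions extends by
density. It makes the inclusion a norm limit of finite rank operators. -/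
theorem norm_formVal_sub_gridAverage_sq_le (hΩ : MeasurableSet Ω) (ha : 0 < a) {h : ℝ}
    (hh : 0 < h) {F : Finset (Fin d → ℤ)} (hF : ∀ x ∈ Ω, gridIndex h x ∈ F) (x : formSpace Ω a) :
    ‖formVal Ω a x - gridAverage Ω hh F (formVal Ω a x)‖ ^ 2 ≤
      volume.real (Metric.closedBall (0 : E d) √d) * (h * √d) ^ 2 * ‖x‖ ^ 2 := by
  revert x
  refine formSpace_closed_induction (isClosed_le (by fun_prop) (by fun_prop)) fun ψ hψ => ?_
  have hgrad : ‖hψ.gradToL2‖ ^ 2 ≤ ‖testVec a hψ‖ ^ 2 := by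
    rw [norm_sq_formSpace ha]
    exact le_add_of_nonneg_left (by positivity)
  have hmain : ‖formVal Ω a (testVec a hψ) - gridAverage Ω hh F (formVal Ω a (testVec a hψ))‖ ^ 2 ≤
      volume.real (Metric.closedBall (0 : E d) √d) * (h * √d) ^ 2 * ‖hψ.gradToL2‖ ^ 2 := by
    rw [formVal_testVec ha, ← ENNReal.ofReal_le_ofReal_iff (by positivity),
      ENNReal.ofReal_mul (by positivity), ENNReal.ofReal_mul (by positivity),
      ENNReal.ofReal_pow (norm_nonneg _), ENNReal.ofReal_pow (norm_nonneg _),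
      ENNReal.ofReal_pow (by positivity), ofReal_norm, ofReal_norm,
      ofReal_measureReal Metric.isBounded_closedBall.measure_lt_top.ne, enorm_sq_toLp,
      ← hψ.lintegral_gradient]
    refine le_trans ?_ (hψ.lintegral_sub_average_sq_le hh)
    refine le_trans (le_of_eq (lintegral_congr_ae ?_)) (setLIntegral_le_lintegral Ω _)
    filter_upwards [gridAverage_toL2 hΩ hh hF hψ, hψ.coeFn_toL2,
      Lp.coeFn_sub hψ.toL2 (gridAverage Ω hh F hψ.toL2)] with x h1 h2 h3
    rw [h3, Pi.sub_apply, h1, h2]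
  refine hmain.trans ?_
  gcongr

/-- The embedding of `H_0^1(Ω)` in `L²(Ω)` is compact if `Ω` is bounded. -/
theorem isCompactOperator_formVal (hΩ : MeasurableSet Ω) (hb : Bornology.IsBounded Ω)
    (ha : 0 < a) : IsCompactOperator (formVal Ω a) := by
  set h : ℕ → ℝ := fun n => 1 / ((n : ℝ) + 1) with hh
  have hpos : ∀ n, 0 < h n := fun n => Nat.one_div_pos_of_nat
  set F : ℕ → Finset (Fin d → ℤ) := fun n => (finite_gridIndex_image (h n) hb).toFinset
  have hF : ∀ n, ∀ x ∈ Ω, gridIndex (h n) x ∈ F n := fun n x hx => by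
    simpa [F] using ⟨x, hx, rfl⟩
  set κ := volume.real (Metric.closedBall (0 : E d) √d)
  have hlim : Tendsto (fun n => gridAverage Ω (hpos n) (F n) ∘L formVal Ω a) atTop
      (𝓝 (formVal Ω a)) := by
    refine (tendsto_iff_norm_sub_tendsto_zero (E := formSpace Ω a →L[ℝ] L2 Ω)).2 ?_
    have h0 : Tendsto (fun n => √κ * √d * h n) atTop (𝓝 0) := by
      simpa [hh] using (tendsto_one_div_add_atTop_nhds_zero_nat (𝕜 := ℝ)).const_mul (√κ * √d)
    refine squeeze_zero (fun _ => ContinuousLinearMap.opNorm_nonneg _) (fun n => ?_) h0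
    have hn := (hpos n).le
    refine ContinuousLinearMap.opNorm_le_bound _ (by positivity) fun x => ?_
    refine le_of_sq_le_sq ?_ (by positivity)
    rw [sub_apply, ContinuousLinearMap.comp_apply, norm_sub_rev]
    refine (norm_formVal_sub_gridAverage_sq_le hΩ ha (hpos n) (hF n) x).trans (le_of_eq ?_)
    rw [mul_pow, mul_pow, mul_pow, mul_pow, Real.sq_sqrt measureReal_nonneg,
      Real.sq_sqrt (Nat.cast_nonneg d)]
    ring
  exact isCompactOperator_of_tendsto hlim (Eventually.of_forall fun n =>
    (isCompactOperator_gridAverage (hpos n) (F n)).comp_clm _)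

end

section

/-! ### The eigenfunction expansion of the Dirichlet Laplacian -/

variable {d : ℕ} {Ω : Set (E d)} {a μ : ℝ}

/-- The pair `(a φ, G)` is an element of the form space, and the weak eigenvalue equation identifies
it with the adjoint inclusion of `(a² + μ) φ`. -/
theorem IsDirichletEigenfunction.resolvent_eq (ha : 0 < a) {φ : L2 Ω}
    (h : IsDirichletEigenfunction Ω μ φ) : (a ^ 2 + μ) • dirichletResolvent Ω a φ = φ := by
  obtain ⟨G, hG, happ, heq⟩ := h
  set g : Lp (E d) 2 (space Ω) := hG.toLp G with hg
  have hgG : g =ᵐ[space Ω] G := hG.coeFn_toLp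
  have hmem : (WithLp.toLp 2 (a • φ, g) : GraphSpace Ω) ∈ formSpace Ω a := by
    refine Metric.mem_closure_iff.2 fun δ hδ => ?_
    obtain ⟨ψ, hψ, h1, h2⟩ := happ (δ ^ 2 / (a ^ 2 + 1)) (by positivity)
    refine ⟨graphPoint a hψ, ⟨ψ, hψ, rfl⟩, ?_⟩
    rw [dist_eq_norm]
    refine lt_of_pow_lt_pow_left₀ 2 hδ.le ?_
    rw [WithLp.prod_norm_sq_eq_of_L2]
    change ‖a • φ - a • hψ.toL2‖ ^ 2 + ‖g - hψ.gradToL2‖ ^ 2 < _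
    rw [← smul_sub, norm_smul, mul_pow, Real.norm_eq_abs, sq_abs, norm_sq_toLp, norm_sq_toLp]
    have e1 : ∫ x, ‖(φ - hψ.toL2 : L2 Ω) x‖ ^ 2 ∂(space Ω) = ∫ x, (φ x - ψ x) ^ 2 ∂(space Ω) := by
      refine integral_congr_ae ?_
      filter_upwards [Lp.coeFn_sub φ hψ.toL2, hψ.coeFn_toL2] with x k1 k2
      rw [k1, Pi.sub_apply, k2, Real.norm_eq_abs, sq_abs]
    have e2 : ∫ x, ‖(g - hψ.gradToL2 : Lp (E d) 2 (space Ω)) x‖ ^ 2 ∂(space Ω) =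
        ∫ x, ‖G x - gradient ψ x‖ ^ 2 ∂(space Ω) := by
      refine integral_congr_ae ?_
      filter_upwards [Lp.coeFn_sub g hψ.gradToL2, hψ.coeFn_gradToL2, hgG] with x k1 k2 k3
      rw [k1, Pi.sub_apply, k2, k3]
    rw [e1, e2]
    calc _ < a ^ 2 * (δ ^ 2 / (a ^ 2 + 1)) + δ ^ 2 / (a ^ 2 + 1) := by gcongr
      _ = δ ^ 2 := by field_simp
  obtain ⟨p, hp1, hp2⟩ : ∃ p : formSpace Ω a, p.1.fst = a • φ ∧ p.1.snd = g :=
    ⟨⟨_, hmem⟩, rfl, rfl⟩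
  have hpval : formVal Ω a p = φ := by
    rw [formVal_apply, hp1, smul_smul, inv_mul_cancel₀ ha.ne', one_smul]
  have hpeq : p = ContinuousLinearMap.adjoint (formVal Ω a) ((a ^ 2 + μ) • φ) := by
    refine formSpace_ext fun v hv => ?_
    refine (inner_testVec ha p hv).trans ?_
    rw [inner_adjoint_testVec ha, hpval, hp2, real_inner_smul_left, add_mul, hv.inner_toL2,
      ← heq v hv, inner_gradToL2]
    congr 1
    refine integral_congr_ae ?_
    filter_upwards [hgG] with x hx
    rw [hx]
  calc (a ^ 2 + μ) • dirichletResolvent Ω a φ = formVal Ω a p := by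
        rw [hpeq, ← map_smul]; rfl
    _ = φ := hpval

/-- Conversely, the second component of the adjoint inclusion of `(1 + μ) φ` serves as the weak
gradient of `φ`. -/
theorem isDirichletEigenfunction_of_resolvent {φ : L2 Ω}
    (h : (1 + μ) • dirichletResolvent Ω 1 φ = φ) : IsDirichletEigenfunction Ω μ φ := by
  obtain ⟨p, hp⟩ : ∃ p, p = ContinuousLinearMap.adjoint (formVal Ω 1) ((1 + μ) • φ) := ⟨_, rfl⟩
  have hpval : formVal Ω 1 p = φ := by
    rw [← h, hp, map_smul, map_smul, h]; exact h
  refine ⟨p.1.snd, Lp.memLp _, fun δ hδ => ?_, fun v hv => ?_⟩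
  · obtain ⟨ψ, hψ, hlt⟩ := exists_testVec_near p (Real.sqrt_pos.2 hδ)
    have hsq : ‖p - testVec 1 hψ‖ ^ 2 < δ := by
      rw [← Real.sq_sqrt hδ.le]
      gcongr
    rw [norm_sq_formSpace one_pos, map_sub, hpval, formVal_testVec one_pos, norm_sq_toLp,
      norm_sq_toLp, one_pow, one_mul] at hsq
    have e1 : ∫ x, ‖(φ - hψ.toL2 : L2 Ω) x‖ ^ 2 ∂(space Ω) = ∫ x, (φ x - ψ x) ^ 2 ∂(space Ω) := by
      refine integral_congr_ae ?_
      filter_upwards [Lp.coeFn_sub φ hψ.toL2, hψ.coeFn_toL2] with x k1 k2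
      rw [k1, Pi.sub_apply, k2, Real.norm_eq_abs, sq_abs]
    have e2 : ∫ x, ‖(p - testVec 1 hψ).1.snd x‖ ^ 2 ∂(space Ω) =
        ∫ x, ‖p.1.snd x - gradient ψ x‖ ^ 2 ∂(space Ω) := by
      refine integral_congr_ae ?_
      filter_upwards [Lp.coeFn_sub p.1.snd hψ.gradToL2, hψ.coeFn_gradToL2] with x k1 k2
      change ‖(p.1.snd - hψ.gradToL2 : Lp (E d) 2 (space Ω)) x‖ ^ 2 = _
      rw [k1, Pi.sub_apply, k2]
    rw [e1, e2] at hsq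
    have h1 : 0 ≤ ∫ x, (φ x - ψ x) ^ 2 ∂(space Ω) := by positivity
    have h2 : 0 ≤ ∫ x, ‖p.1.snd x - gradient ψ x‖ ^ 2 ∂(space Ω) := by positivity
    exact ⟨ψ, hψ, by linarith, by linarith⟩
  · have h1 := inner_testVec one_pos p hv
    have h2 := inner_adjoint_testVec one_pos ((1 + μ) • φ) hv
    rw [← hp] at h2
    rw [h2, hpval, real_inner_smul_left, inner_gradToL2, hv.inner_toL2] at h1
    linarith

/-- The (closed) eigenspaces. -/
abbrev closedEigenspace (Ω : Set (E d)) (μ : ℝ) : Submodule ℝ (L2 Ω) :=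
  (dirichletEigenspace Ω μ).topologicalClosure

theorem resolvent_eq_of_mem (ha : 0 < a) {φ : L2 Ω} (hφ : φ ∈ closedEigenspace Ω μ) :
    (a ^ 2 + μ) • dirichletResolvent Ω a φ = φ := by
  set T := (a ^ 2 + μ) • dirichletResolvent Ω a - ContinuousLinearMap.id ℝ (L2 Ω)
  have hle : closedEigenspace Ω μ ≤ LinearMap.ker T.toLinearMap := by
    refine Submodule.topologicalClosure_minimal _ (Submodule.span_le.2 fun φ hφ => ?_)
      T.isClosed_ker
    exact sub_eq_zero.2 (hφ.resolvent_eq ha)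
  exact sub_eq_zero.1 (hle hφ)

/-- For `a = √(-μ)` the factor `a² + μ` in the resolvent identity vanishes. -/
theorem eq_zero_of_mem_of_neg (hμ : μ < 0) {φ : L2 Ω} (hφ : φ ∈ closedEigenspace Ω μ) :
    φ = 0 := by
  have h := resolvent_eq_of_mem (Real.sqrt_pos.2 (neg_pos.2 hμ)) hφ
  rw [Real.sq_sqrt (by linarith), neg_add_cancel, zero_smul] at h
  exact h.symm

theorem inner_eq_zero_of_mem {ν : ℝ} (hne : μ ≠ ν) {φ ψ : L2 Ω} (hφ : φ ∈ closedEigenspace Ω μ)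
    (hψ : ψ ∈ closedEigenspace Ω ν) : inner ℝ φ ψ = 0 := by
  have h1 : (1 + μ) * inner ℝ φ (dirichletResolvent Ω 1 ψ) = inner ℝ φ ψ := by
    rw [← dirichletResolvent_symm, ← real_inner_smul_left]
    have := resolvent_eq_of_mem one_pos hφ
    rw [one_pow] at this
    rw [this]
  have h2 : (1 + ν) * inner ℝ φ (dirichletResolvent Ω 1 ψ) = inner ℝ φ ψ := by
    rw [← real_inner_smul_right]
    have := resolvent_eq_of_mem one_pos hψ
    rw [one_pow] at this
    rw [this]
  have h3 : (μ - ν) * inner ℝ φ (dirichletResolvent Ω 1 ψ) = 0 := by linarith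
  rw [← h1, (mul_eq_zero.1 h3).resolve_left (sub_ne_zero.2 hne), mul_zero]

theorem eigenProj_mem (μ : ℝ) (w : L2 Ω) : eigenProj Ω μ w ∈ closedEigenspace Ω μ :=
  Submodule.starProjection_apply_mem _ w

theorem eigenProj_of_mem {w : L2 Ω} (hw : w ∈ closedEigenspace Ω μ) : eigenProj Ω μ w = w :=
  Submodule.starProjection_eq_self_iff.2 hw

theorem inner_eigenProj_left (u w : L2 Ω) :
    inner ℝ (eigenProj Ω μ u) w = inner ℝ (eigenProj Ω μ u) (eigenProj Ω μ w) := by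
  conv_lhs => rw [← eigenProj_of_mem (eigenProj_mem μ u)]
  exact Submodule.inner_starProjection_left_eq_right _ _ _

theorem eigenProj_of_mem_of_ne {ν : ℝ} (hne : ν ≠ μ) {w : L2 Ω} (hw : w ∈ closedEigenspace Ω ν) :
    eigenProj Ω μ w = 0 :=
  (Submodule.starProjection_apply_eq_zero_iff _).2 ((Submodule.mem_orthogonal _ _).2
    fun _ hu => inner_eq_zero_of_mem hne.symm hu hw)

theorem eigenProj_of_neg (hμ : μ < 0) (w : L2 Ω) : eigenProj Ω μ w = 0 :=
  eq_zero_of_mem_of_neg hμ (eigenProj_mem μ w)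

variable [IsFiniteMeasure (space Ω)]

/-- The form of the resolvent is the squared norm of the adjoint inclusion, so `φ` is orthogonal to
all test functions. -/
theorem eq_zero_of_dirichletResolvent_eq_zero (hΩ : IsOpen Ω) {φ : L2 Ω}
    (h : dirichletResolvent Ω a φ = 0) (ha : 0 < a) : φ = 0 := by
  have h0 : ContinuousLinearMap.adjoint (formVal Ω a) φ = 0 := by
    rw [← inner_self_eq_zero (𝕜 := ℝ), ← inner_dirichletResolvent, h, inner_zero_left]
  have hint : LocallyIntegrableOn φ Ω :=
    IntegrableOn.locallyIntegrableOn ((Lp.memLp φ).integrable one_le_two)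
  have key := hΩ.ae_eq_zero_of_integral_contDiff_smul_eq_zero hint fun g hg hgc hgs => by
    have hg' : IsTestFunction Ω g := ⟨hg, hgc, hgs⟩
    have h1 : inner ℝ φ hg'.toL2 = 0 := by
      rw [← formVal_testVec ha hg', ← ContinuousLinearMap.adjoint_inner_left, h0, inner_zero_left]
    rw [hg'.inner_toL2] at h1
    rw [← h1, setIntegral_eq_integral_of_forall_compl_eq_zero]
    · simp only [smul_eq_mul, mul_comm]
    · intro x hx
      rw [image_eq_zero_of_notMem_tsupport fun hx' => hx (hgs hx'), mul_zero]
  refine (Lp.eq_zero_iff_ae_eq_zero).2 ?_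
  exact (ae_restrict_iff' hΩ.measurableSet).2 key

/-- The spectral theorem for the compact symmetric resolvent at `a = 1`. An eigenvalue `κ ≠ 0`
corresponds to the Dirichlet eigenvalue `κ⁻¹ - 1`, and `κ = 0` is excluded by injectivity. -/
theorem iSup_closedEigenspace_orthogonal (hΩ : IsOpen Ω) (hb : Bornology.IsBounded Ω) :
    (⨆ μ, closedEigenspace Ω μ)ᗮ = ⊥ := by
  have hcomp : IsCompactOperator (dirichletResolvent Ω 1) :=
    (isCompactOperator_formVal hΩ.measurableSet hb one_pos).comp_clm _
  have hsymm : (dirichletResolvent Ω 1 : L2 Ω →ₗ[ℝ] L2 Ω).IsSymmetric := dirichletResolvent_symm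
  have hle : (⨆ κ, Module.End.eigenspace (dirichletResolvent Ω 1 : L2 Ω →ₗ[ℝ] L2 Ω) κ) ≤
      ⨆ μ, closedEigenspace Ω μ := by
    refine iSup_le fun κ => ?_
    intro φ hφ
    have hφ' : dirichletResolvent Ω 1 φ = κ • φ := Module.End.mem_eigenspace_iff.1 hφ
    rcases eq_or_ne κ 0 with rfl | hκ
    · rw [zero_smul] at hφ'
      rw [eq_zero_of_dirichletResolvent_eq_zero hΩ hφ' one_pos]
      exact Submodule.zero_mem _
    · refine Submodule.mem_iSup_of_mem (κ⁻¹ - 1) (subset_closure (Submodule.subset_span ?_))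
      refine isDirichletEigenfunction_of_resolvent ?_
      rw [hφ', smul_smul]
      have : (1 + (κ⁻¹ - 1)) * κ = 1 := by field_simp; ring
      rw [this, one_smul]
  rw [eq_bot_iff, ← ContinuousLinearMap.orthogonalComplement_iSup_eigenspaces_eq_bot hcomp hsymm]
  exact Submodule.orthogonal_le hle

theorem isHilbertSum_closedEigenspace (hΩ : IsOpen Ω) (hb : Bornology.IsBounded Ω) :
    IsHilbertSum ℝ (fun μ : ℝ => closedEigenspace Ω μ)
      fun μ => (closedEigenspace Ω μ).subtypeₗᵢ := by
  refine IsHilbertSum.mkInternal _ (OrthogonalFamily.of_pairwise fun μ ν hne => ?_) ?_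
  · exact Submodule.isOrtho_iff_inner_eq.2 fun φ hφ ψ hψ => inner_eq_zero_of_mem hne hφ hψ
  · rw [Submodule.topologicalClosure_eq_top_iff.2 (iSup_closedEigenspace_orthogonal hΩ hb)]

/-- The eigenfunction expansion. -/
theorem hasSum_eigenProj (hΩ : IsOpen Ω) (hb : Bornology.IsBounded Ω) (w : L2 Ω) :
    HasSum (fun μ : ℝ => eigenProj Ω μ w) w := by
  have hV := isHilbertSum_closedEigenspace hΩ hb
  set f := hV.linearIsometryEquiv w with hf
  have hsum : HasSum (fun μ : ℝ => (f μ : L2 Ω)) w := by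
    have := hV.hasSum_linearIsometryEquiv_symm f
    rwa [hf, LinearIsometryEquiv.symm_apply_apply] at this
  have heq : ∀ μ : ℝ, eigenProj Ω μ w = f μ := by
    intro μ
    have h1 := hsum.mapL (eigenProj Ω μ)
    have h2 := hasSum_single (f := fun ν : ℝ => eigenProj Ω μ (f ν : L2 Ω)) μ
      fun ν hν => eigenProj_of_mem_of_ne hν (f ν).2
    rw [h1.unique h2]
    exact eigenProj_of_mem (f μ).2
  simpa only [heq] using hsum

/-- The quadratic form of `1 - t (t - Δ)⁻¹`, `t = a²`. -/
theorem hasSum_inner_sub_dirichletResolvent (hΩ : IsOpen Ω) (hb : Bornology.IsBounded Ω)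
    (ha : 0 < a) (w : L2 Ω) :
    HasSum (fun μ : ℝ => μ / (a ^ 2 + μ) * ‖eigenProj Ω μ w‖ ^ 2)
      (inner ℝ (w - a ^ 2 • dirichletResolvent Ω a w) w) := by
  have h := (hasSum_eigenProj hΩ hb w).mapL (innerSL ℝ w ∘L
    (ContinuousLinearMap.id ℝ (L2 Ω) - a ^ 2 • dirichletResolvent Ω a))
  have e : ∀ v, (innerSL ℝ w ∘L (ContinuousLinearMap.id ℝ (L2 Ω) - a ^ 2 • dirichletResolvent Ω a))
      v = inner ℝ (v - a ^ 2 • dirichletResolvent Ω a v) w := fun v =>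
    real_inner_comm (v - a ^ 2 • dirichletResolvent Ω a v) w
  simp only [e] at h
  have heq : ∀ μ : ℝ,
      inner ℝ (eigenProj Ω μ w - a ^ 2 • dirichletResolvent Ω a (eigenProj Ω μ w)) w =
      μ / (a ^ 2 + μ) * ‖eigenProj Ω μ w‖ ^ 2 := by
    intro μ
    rcases lt_or_ge μ 0 with hμ | hμ
    · simp [eigenProj_of_neg hμ]
    · have hpos : 0 < a ^ 2 + μ := by positivity
      have hR : dirichletResolvent Ω a (eigenProj Ω μ w) = (a ^ 2 + μ)⁻¹ • eigenProj Ω μ w := by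
        rw [eq_inv_smul_iff₀ hpos.ne']
        exact resolvent_eq_of_mem ha (eigenProj_mem μ w)
      rw [hR, inner_sub_left, smul_smul, real_inner_smul_left, inner_eigenProj_left,
        real_inner_self_eq_norm_sq]
      field_simp
      ring
  simpa only [heq] using h

end

section

/-! ### The spectral space -/

variable {d : ℕ} {Ω : Set (E d)} {s μ : ℝ}

/-- Sums run over all real `μ`. For negative `μ` the projection is zero, so the value of `μ ^ s`
there is irrelevant. -/
theorem spectralTerm_nonneg {c : ℝ} (hc : 0 ≤ μ → 0 ≤ c) (w : L2 Ω) :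
    0 ≤ c * ‖eigenProj Ω μ w‖ ^ 2 := by
  rcases lt_or_ge μ 0 with h | h
  · simp [eigenProj_of_neg h]
  · exact mul_nonneg (hc h) (by positivity)

theorem rpow_mul_norm_eigenProj_nonneg (w : L2 Ω) : 0 ≤ μ ^ s * ‖eigenProj Ω μ w‖ ^ 2 :=
  spectralTerm_nonneg (fun h => Real.rpow_nonneg h s) w

/-- The domain of the spectral form. -/
def spectralDomain (Ω : Set (E d)) (s : ℝ) : Set (L2 Ω) :=
  {w | Summable fun μ : ℝ => μ ^ s * ‖eigenProj Ω μ w‖ ^ 2}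

theorem spectralInner_self (w : L2 Ω) :
    spectralInner Ω s w w = ∑' μ : ℝ, μ ^ s * ‖eigenProj Ω μ w‖ ^ 2 := by
  simp only [spectralInner, real_inner_self_eq_norm_sq]

theorem summable_spectralInner {u w : L2 Ω} (hu : u ∈ spectralDomain Ω s)
    (hw : w ∈ spectralDomain Ω s) :
    Summable fun μ : ℝ => μ ^ s * inner ℝ (eigenProj Ω μ u) (eigenProj Ω μ w) := by
  refine Summable.of_norm_bounded (Summable.add hu hw) fun μ => ?_
  rcases lt_or_ge μ 0 with h | h
  · simp [eigenProj_of_neg h]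
  · have h1 := abs_real_inner_le_norm (eigenProj Ω μ u) (eigenProj Ω μ w)
    have h2 := two_mul_le_add_sq ‖eigenProj Ω μ u‖ ‖eigenProj Ω μ w‖
    have h3 := mul_nonneg (norm_nonneg (eigenProj Ω μ u)) (norm_nonneg (eigenProj Ω μ w))
    rw [norm_mul, Real.norm_of_nonneg (Real.rpow_nonneg h s), ← mul_add, Real.norm_eq_abs]
    exact mul_le_mul_of_nonneg_left (by linarith) (Real.rpow_nonneg h s)

theorem closedForm_spectral_aux :
    ClosedForm (spectralDomain Ω s) (spectralInner Ω s) where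
  zero_mem := by
    change Summable _
    simp
  add_mem u hu v hv := by
    refine Summable.of_nonneg_of_le (fun μ => rpow_mul_norm_eigenProj_nonneg _) (fun μ => ?_)
      ((Summable.add hu hv).mul_left 2)
    rcases lt_or_ge μ 0 with h | h
    · simp [eigenProj_of_neg h]
    · have h1 := norm_add_le (eigenProj Ω μ u) (eigenProj Ω μ v)
      have h2 := two_mul_le_add_sq ‖eigenProj Ω μ u‖ ‖eigenProj Ω μ v‖
      have h3 : ‖eigenProj Ω μ (u + v)‖ ^ 2 ≤
          2 * (‖eigenProj Ω μ u‖ ^ 2 + ‖eigenProj Ω μ v‖ ^ 2) := by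
        rw [map_add]
        calc _ ≤ (‖eigenProj Ω μ u‖ + ‖eigenProj Ω μ v‖) ^ 2 := by gcongr
          _ ≤ _ := by linarith [add_sq ‖eigenProj Ω μ u‖ ‖eigenProj Ω μ v‖]
      calc _ ≤ μ ^ s * (2 * (‖eigenProj Ω μ u‖ ^ 2 + ‖eigenProj Ω μ v‖ ^ 2)) :=
            mul_le_mul_of_nonneg_left h3 (Real.rpow_nonneg h s)
        _ = _ := by ring
  smul_mem c u hu := by
    refine (Summable.mul_left (c ^ 2) hu).congr fun μ => ?_
    rw [map_smul, norm_smul, mul_pow, Real.norm_eq_abs, sq_abs]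
    ring
  symm u _ v _ := tsum_congr fun μ => by rw [real_inner_comm]
  add_left u hu v hv z hz := by
    simp only [spectralInner]
    rw [← (summable_spectralInner hu hz).tsum_add (summable_spectralInner hv hz)]
    refine tsum_congr fun μ => ?_
    rw [map_add, inner_add_left, mul_add]
  smul_left c u _ z _ := by
    simp only [spectralInner]
    rw [← tsum_mul_left]
    refine tsum_congr fun μ => ?_
    rw [map_smul, real_inner_smul_left]
    ring
  nonneg u _ := by
    rw [spectralInner_self]
    exact tsum_nonneg fun μ => rpow_mul_norm_eigenProj_nonneg _
  lsc w wbar c hw hc hlim := by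
    have hnn : (0 : ℝ → ℝ) ≤ fun μ : ℝ => μ ^ s * ‖eigenProj Ω μ wbar‖ ^ 2 :=
      fun μ => rpow_mul_norm_eigenProj_nonneg _
    -- Each projection is continuous, so finite partial sums pass to the limit and keep the bound
    -- `c`.
    have key : ∀ F : Finset ℝ, ∑ μ ∈ F, μ ^ s * ‖eigenProj Ω μ wbar‖ ^ 2 ≤ c := by
      intro F
      have h1 : Tendsto (fun n => ∑ μ ∈ F, μ ^ s * ‖eigenProj Ω μ (w n)‖ ^ 2) atTop
          (𝓝 (∑ μ ∈ F, μ ^ s * ‖eigenProj Ω μ wbar‖ ^ 2)) :=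
        tendsto_finsetSum _ fun μ _ =>
          ((((eigenProj Ω μ).continuous.tendsto wbar).comp hlim).norm.pow 2).const_mul _
      refine le_of_tendsto' h1 fun n => ?_
      refine le_trans ?_ (hc n)
      rw [spectralInner_self]
      exact Summable.sum_le_tsum F (fun μ _ => rpow_mul_norm_eigenProj_nonneg _) (hw n)
    refine ⟨summable_of_sum_le hnn key, ?_⟩
    rw [spectralInner_self]
    exact Real.tsum_le_of_sum_le hnn key

theorem rpowIntegrand_mul_nonneg (hs : s ∈ Ioo (0 : ℝ) 1) {t : ℝ} (ht : 0 < t) (w : L2 Ω) :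
    0 ≤ Real.rpowIntegrand₀₁ s t μ * ‖eigenProj Ω μ w‖ ^ 2 :=
  spectralTerm_nonneg (Real.rpowIntegrand₀₁_nonneg hs.1 ht.le) w

/-- Expanding at `w = v + (w - v)`, the cross terms are twice the nonnegative pairing of
`inner_sub_dirichletResolvent_nonneg`. -/
theorem inner_sub_dirichletResolvent_add_le {t : ℝ} (ht : 0 < t) {M : ℝ} (hM : 0 ≤ M)
    {v w : L2 Ω} (hv : ∀ᵐ x ∂(space Ω), v x = min (w x) M) :
    inner ℝ (v - t • dirichletResolvent Ω √t v) v +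
        inner ℝ ((w - v) - t • dirichletResolvent Ω √t (w - v)) (w - v) ≤
      inner ℝ (w - t • dirichletResolvent Ω √t w) w := by
  have h := inner_sub_dirichletResolvent_nonneg (Real.sqrt_pos.2 ht) hM hv
  rw [Real.sq_sqrt ht.le] at h
  obtain ⟨z, hz⟩ : ∃ z, z = w - v := ⟨_, rfl⟩
  have hw : w = v + z := by rw [hz]; abel
  rw [← hz] at h ⊢
  rw [hw, map_add]
  have h1 := dirichletResolvent_symm (a := √t) z v
  simp only [smul_add, inner_sub_left, inner_add_left, inner_add_right, real_inner_smul_left]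
    at h ⊢
  have h2 : inner ℝ z v = inner ℝ v z := real_inner_comm v z
  have h3 : inner ℝ z (dirichletResolvent Ω √t v) = inner ℝ (dirichletResolvent Ω √t v) z :=
    real_inner_comm _ _
  rw [h1, h2, h3]
  linarith

/-- Balakrishnan's formula: scaling in `t` extracts the power `μ ^ s` from the integral. -/
theorem lintegral_rpowIntegrand (hs : s ∈ Ioo (0 : ℝ) 1) (w : L2 Ω) (μ : ℝ) :
    ∫⁻ t in Ioi (0 : ℝ), ENNReal.ofReal (Real.rpowIntegrand₀₁ s t μ * ‖eigenProj Ω μ w‖ ^ 2) =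
      ENNReal.ofReal ((∫ t in Ioi (0 : ℝ), Real.rpowIntegrand₀₁ s t 1) *
        (μ ^ s * ‖eigenProj Ω μ w‖ ^ 2)) := by
  rcases lt_or_ge μ 0 with hμ | hμ
  · simp [eigenProj_of_neg hμ]
  · rw [← ofReal_integral_eq_lintegral_ofReal
      ((Real.integrableOn_rpowIntegrand₀₁_Ioi hs hμ).mul_const _)
      ((ae_restrict_iff' measurableSet_Ioi).2 (Eventually.of_forall fun t ht =>
        rpowIntegrand_mul_nonneg hs ht w)), integral_mul_const,
      Real.integral_rpowIntegrand₀₁_eq_rpow_mul_const hs hμ]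
    congr 1
    ring

theorem measurable_rpowIntegrand (c : ℝ) :
    Measurable fun t => ENNReal.ofReal (Real.rpowIntegrand₀₁ s t μ * c) := by
  unfold Real.rpowIntegrand₀₁
  fun_prop

variable [IsFiniteMeasure (space Ω)]

theorem W_spectral_eq (hΩ : IsOpen Ω) (hb : Bornology.IsBounded Ω) :
    W .spectral Ω s = spectralDomain Ω s :=
  Set.ext fun w => ⟨fun h => h.2, fun h => ⟨hasSum_eigenProj hΩ hb w, h⟩⟩

theorem closedForm_spectral (hΩ : IsOpen Ω) (hb : Bornology.IsBounded Ω) :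
    ClosedForm (W .spectral Ω s) (innerW .spectral Ω s) := by
  rw [W_spectral_eq hΩ hb]
  exact closedForm_spectral_aux

/-- The quadratic form of `t^s (1/t - 1/(t - Δ))`. -/
theorem hasSum_rpowIntegrand (hs : s ∈ Ioo (0 : ℝ) 1) (hΩ : IsOpen Ω)
    (hb : Bornology.IsBounded Ω) {t : ℝ} (ht : 0 < t) (w : L2 Ω) :
    HasSum (fun μ : ℝ => Real.rpowIntegrand₀₁ s t μ * ‖eigenProj Ω μ w‖ ^ 2)
      (t ^ (s - 1) * inner ℝ (w - t • dirichletResolvent Ω √t w) w) := by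
  have h := (hasSum_inner_sub_dirichletResolvent hΩ hb (Real.sqrt_pos.2 ht) w).mul_left
    (t ^ (s - 1))
  simp only [Real.sq_sqrt ht.le] at h
  have heq : ∀ μ : ℝ, Real.rpowIntegrand₀₁ s t μ * ‖eigenProj Ω μ w‖ ^ 2 =
      t ^ (s - 1) * (μ / (t + μ) * ‖eigenProj Ω μ w‖ ^ 2) := by
    intro μ
    rcases lt_or_ge μ 0 with hμ | hμ
    · simp [eigenProj_of_neg hμ]
    · rw [Real.rpowIntegrand₀₁_eq_pow_div hs ht.le hμ]
      ring
  simpa only [heq] using h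

/-- The inequality for the resolvents is integrated in `t` with weight `t ^ (s - 1)`. Only finite
sums appear on the left, because membership of `v` and `w - v` in the domain is a consequence still
to be drawn. -/
theorem spectral_sum_truncation_le (hs : s ∈ Ioo (0 : ℝ) 1) (hΩ : IsOpen Ω)
    (hb : Bornology.IsBounded Ω) {M : ℝ} (hM : 0 ≤ M) {v w : L2 Ω}
    (hw : w ∈ spectralDomain Ω s) (hv : ∀ᵐ x ∂(space Ω), v x = min (w x) M) (F : Finset ℝ) :
    ∑ μ ∈ F, (μ ^ s * ‖eigenProj Ω μ v‖ ^ 2 + μ ^ s * ‖eigenProj Ω μ (w - v)‖ ^ 2) ≤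
      spectralInner Ω s w w := by
  set I := ∫ t in Ioi (0 : ℝ), Real.rpowIntegrand₀₁ s t 1 with hI
  have hIpos : 0 < I := Real.integral_rpowIntegrand₀₁_one_pos hs
  -- A countable index set valid for every `t`, without which sum and integral could not be
  -- exchanged.
  set S := Function.support fun μ : ℝ => μ ^ s * ‖eigenProj Ω μ w‖ ^ 2 with hS
  have : Countable S := (Summable.countable_support hw).to_subtype
  have hkS : ∀ t, (Function.support fun μ : ℝ =>
      Real.rpowIntegrand₀₁ s t μ * ‖eigenProj Ω μ w‖ ^ 2) ⊆ S := by
    intro t μ hμ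
    rw [Function.mem_support] at hμ
    rw [hS, Function.mem_support]
    have h0 : μ ≠ 0 := by rintro rfl; simp at hμ
    have h1 := right_ne_zero_of_mul hμ
    have h2 : 0 ≤ μ := by
      by_contra h
      simp [eigenProj_of_neg (not_le.1 h)] at h1
    exact mul_ne_zero (Real.rpow_pos_of_pos (lt_of_le_of_ne h2 h0.symm) s).ne' h1
  have hpt : ∀ t ∈ Ioi (0 : ℝ), ∑ μ ∈ F,
      (ENNReal.ofReal (Real.rpowIntegrand₀₁ s t μ * ‖eigenProj Ω μ v‖ ^ 2) +
        ENNReal.ofReal (Real.rpowIntegrand₀₁ s t μ * ‖eigenProj Ω μ (w - v)‖ ^ 2)) ≤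
      ∑' μ : S, ENNReal.ofReal (Real.rpowIntegrand₀₁ s t μ * ‖eigenProj Ω μ w‖ ^ 2) := by
    intro t ht
    have hw' := hasSum_rpowIntegrand hs hΩ hb ht w
    have e := ENNReal.ofReal_tsum_of_nonneg
      (f := fun μ : S => Real.rpowIntegrand₀₁ s t μ * ‖eigenProj Ω μ w‖ ^ 2)
      (fun μ => rpowIntegrand_mul_nonneg hs ht w) (hw'.summable.subtype S)
    rw [tsum_subtype_eq_of_support_subset (hkS t), hw'.tsum_eq] at e
    rw [← e]
    have hsum := (hasSum_rpowIntegrand hs hΩ hb ht v).add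
      (hasSum_rpowIntegrand hs hΩ hb ht (w - v))
    rw [← mul_add] at hsum
    have h1 := sum_le_hasSum F (fun μ _ => add_nonneg (rpowIntegrand_mul_nonneg hs ht v)
      (rpowIntegrand_mul_nonneg hs ht (w - v))) hsum
    have h2 := mul_le_mul_of_nonneg_left (inner_sub_dirichletResolvent_add_le ht hM hv)
      (Real.rpow_nonneg (le_of_lt ht) (s - 1))
    refine le_trans (le_of_eq ?_) (ENNReal.ofReal_le_ofReal (h1.trans h2))
    rw [ENNReal.ofReal_sum_of_nonneg fun μ _ => add_nonneg (rpowIntegrand_mul_nonneg hs ht v)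
      (rpowIntegrand_mul_nonneg hs ht (w - v))]
    exact Finset.sum_congr rfl fun μ _ => (ENNReal.ofReal_add (rpowIntegrand_mul_nonneg hs ht v)
      (rpowIntegrand_mul_nonneg hs ht (w - v))).symm
  have hint := setLIntegral_mono' (μ := volume) measurableSet_Ioi hpt
  rw [lintegral_finsetSum (f := fun μ t =>
      ENNReal.ofReal (Real.rpowIntegrand₀₁ s t μ * ‖eigenProj Ω μ v‖ ^ 2) +
        ENNReal.ofReal (Real.rpowIntegrand₀₁ s t μ * ‖eigenProj Ω μ (w - v)‖ ^ 2)) F fun μ _ =>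
      (measurable_rpowIntegrand _).add (measurable_rpowIntegrand _),
    lintegral_tsum fun μ => (measurable_rpowIntegrand _).aemeasurable] at hint
  simp only [lintegral_add_left (measurable_rpowIntegrand _), lintegral_rpowIntegrand hs] at hint
  have hnn : ∀ (u : L2 Ω) (μ : ℝ), 0 ≤ I * (μ ^ s * ‖eigenProj Ω μ u‖ ^ 2) := fun u μ =>
    mul_nonneg hIpos.le (rpow_mul_norm_eigenProj_nonneg u)
  rw [← ENNReal.ofReal_tsum_of_nonneg (fun μ : S => hnn w μ)
    ((Summable.mul_left I hw).subtype S), tsum_mul_left,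
    tsum_subtype_eq_of_support_subset (f := fun μ : ℝ => μ ^ s * ‖eigenProj Ω μ w‖ ^ 2)
      Subset.rfl, ← spectralInner_self] at hint
  rw [Finset.sum_congr rfl fun μ _ => (ENNReal.ofReal_add (hnn v μ) (hnn (w - v) μ)).symm,
    ← ENNReal.ofReal_sum_of_nonneg fun μ _ => add_nonneg (hnn v μ) (hnn (w - v) μ),
    ENNReal.ofReal_le_ofReal_iff (mul_nonneg hIpos.le (by
      rw [spectralInner_self]
      exact tsum_nonneg fun μ => rpow_mul_norm_eigenProj_nonneg _))] at hint
  simp only [← mul_add, ← Finset.mul_sum] at hint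
  simp only [← mul_add]
  exact le_of_mul_le_mul_left hint hIpos

/-- Bounded partial sums give membership of `v` and `w - v` in the domain, and comparing with the
expansion of the form at `v + (w - v)` leaves a nonnegative cross term. -/
theorem truncatesForm_spectral (hs : s ∈ Ioo (0 : ℝ) 1) (hΩ : IsOpen Ω)
    (hb : Bornology.IsBounded Ω) :
    TruncatesForm Ω (W .spectral Ω s) (innerW .spectral Ω s) := by
  have hB : ClosedForm (spectralDomain Ω s) (spectralInner Ω s) := closedForm_spectral_aux
  rw [W_spectral_eq hΩ hb]
  intro w hw M hM
  obtain ⟨v, hv⟩ := exists_trunc w hM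
  have key := spectral_sum_truncation_le hs hΩ hb hM hw hv
  have hnn : ∀ u : L2 Ω, ∀ μ : ℝ, 0 ≤ μ ^ s * ‖eigenProj Ω μ u‖ ^ 2 := fun u μ =>
    rpow_mul_norm_eigenProj_nonneg u
  have hsum := summable_of_sum_le (fun μ => add_nonneg (hnn v μ) (hnn (w - v) μ)) key
  have hvV : v ∈ spectralDomain Ω s :=
    Summable.of_nonneg_of_le (hnn v) (fun μ => le_add_of_nonneg_right (hnn (w - v) μ)) hsum
  have hzV : w - v ∈ spectralDomain Ω s := hB.sub_mem hw hvV
  have hle := Real.tsum_le_of_sum_le (fun μ => add_nonneg (hnn v μ) (hnn (w - v) μ)) key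
  rw [Summable.tsum_add hvV hzV, ← spectralInner_self, ← spectralInner_self] at hle
  refine ⟨v, hvV, hv, ?_⟩
  change 0 ≤ spectralInner Ω s v (w - v)
  have hexp := hB.add_smul_self 1 hvV hzV
  rw [one_smul, add_sub_cancel] at hexp
  linarith

end

end SparseControl

end

/-! ### Conclusion for the four choices of `W`. -/

theorem mainTheorem9 {d : ℕ} (hd : 1 ≤ d) (Ω : Set (SparseControl.E d))
    (hΩ : SparseControl.IsBoundedLipschitzDomain Ω) (T : ℝ) (hT : 0 < T)
    (s : ℝ) (hs : s ∈ Set.Ioo (0 : ℝ) 1) (kind : SparseControl.Kind)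
    (p α β γ : ℝ) (hp : p ∈ Set.Ioo (0 : ℝ) 1) (hα : 0 < α) (hβ : 0 < β) (hγ : 0 < γ)
    (f : SparseControl.U T Ω → ℝ) (hf : SparseControl.ObjectiveAssumptions f)
    (b L : ℝ) (ε : ℕ → ℝ)
    (u : ℕ → SparseControl.U T Ω) (w : ℕ → SparseControl.L2 Ω) (Lk : ℕ → ℝ)
    (hgen : SparseControl.IsGenerated kind T Ω s p α β γ f b L ε u w Lk)
    (ubar : SparseControl.U T Ω) (wbar : SparseControl.L2 Ω)
    (hlim : SparseControl.IsWeakLimitPoint kind T Ω s u w ubar wbar)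
    (r q : ℝ) (hr : 1 < r) (hq : 2 < q) (hrq : 1 / r + 2 / q < 1)
    (hemb : SparseControl.EmbedsInLq kind Ω s q)
    (hreg : MeasureTheory.MemLp
      (fun x => ∫ t in Set.Ioo 0 T, |(gradient f ubar) (t, x)|)
      (ENNReal.ofReal r) (SparseControl.space Ω)) :
    MeasureTheory.MemLp wbar ⊤ (SparseControl.space Ω) ∧
      MeasureTheory.MemLp ubar ⊤ (SparseControl.cyl T Ω) := by
  have hb := hΩ.isBounded
  have hm := hΩ.isOpen.measurableSet
  have : MeasureTheory.IsFiniteMeasure (SparseControl.space Ω) :=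
    ⟨by simpa using hb.measure_lt_top⟩
  cases kind with
  | sobolev =>
    exact SparseControl.memLp_top_of_truncatesForm hT hα hβ hγ
      (SparseControl.closedForm_sobolev hs) (SparseControl.truncatesForm_sobolev hs)
      hp hf hgen hlim hr hq hrq hemb hreg
  | sobolevZero =>
    exact SparseControl.memLp_top_of_truncatesForm hT hα hβ hγ
      (SparseControl.closedForm_sobolevZero hd hs hm hb)
      (SparseControl.truncatesForm_sobolevZero hd hs hm hb)
      hp hf hgen hlim hr hq hrq hemb hreg
  | tilde =>
    exact SparseControl.memLp_top_of_truncatesForm hT hα hβ hγ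
      (SparseControl.closedForm_tilde hm hs) (SparseControl.truncatesForm_tilde hm hs)
      hp hf hgen hlim hr hq hrq hemb hreg
  | spectral =>
    exact SparseControl.memLp_top_of_truncatesForm hT hα hβ hγ
      (SparseControl.closedForm_spectral hΩ.isOpen hb)
      (SparseControl.truncatesForm_spectral hs hΩ.isOpen hb)
      hp hf hgen hlim hr hq hrq hemb hreg
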